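/- Let $F$ be a field of characteristic $0$, let $V$ be a finite-dimensional $F$-vector space, and let $G\le \mathrm{GL}(V)$ be a pseudo-reflection group, i.e. a finite subgroup generated by elements $g$ with $\dim\ker(g-1)=\dim V-1$. Let $M$ be an $r$-dimensional $F[G]$-module and let $\chi\colon G\to F^\times$ be a one-dimensional character. Let $S(\cdot)$ denote symmetric algebras, $\wedge$ exterior algebras, let $G$ act on $V^*$ and $M^*$ contragrediently and diagonally on $S(V)\otimes\wedge M$, $S(V^*)\otimes\wedge M^*$ etc., and for a $G$-module $W$ put $W^\chi=\{w\in W:\sigma w=\chi(\sigma)w\ \ \forall\sigma\in G\}$. *Notation.* (a) Let $\Delta_\chi\in S(V^*)$ be such that $S(V^*)^\chi=S(V^*)^G\Delta_\chi$. (b) Let $\theta_1,\dots,\theta_r$ be a basis of the $S(V^*)^G$-module $(S(V^*)\otimes M)^G$ consisting of elements that are homogeneous in the $S(V^*)$-degree, and let $J_{M^*}=\det(J_{ij})\in S(V^*)$, where $\theta_i=\sum_j J_{ij}\otimes m_j$ for a basis $m_1,\dots,m_r$ of $M$. (c) Let $\tilde\omega_1,\dots,\tilde\omega_r$ be a basis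 of the $S(V)^G$-module $(S(V)\otimes M^*)^G$ consisting of elements that are homogeneous in the $S(V)$-degree. For $s\in S(V)$ let $\partial_s$ be the constant coefficient differential operator on $S(V^*)$ given by $s$ (so $s\mapsto\partial_s$ is the algebra morphism for which $\partial_v$, $v\in V$, is the derivation with $\partial_v\lambda=\lambda(v)$ for $\lambda\in V^*$). Let $d_i^*$ be the operator on $S(V^*)\otimes\wedge M^*$ by which $\tilde\omega_i$ acts, where $s\otimes\mu\in S(V)\otimes M^*$ acts by $f\otimes\nu\mapsto\partial_s f\otimes(\mu\wedge\nu)$. (d) Let $\mathcal J_M\subset S(V)\otimes\wedge M$ and $\mathcal J_M^*\subset S(V^*)\otimes\wedge M^*$ be the (two-sided) ideals generated by the (bi)homogeneous $G$-invariants of positive degree. (e) Let $\langle-,-\rangle$ be the pairing of $S(V^*)\otimes\wedge M^*$ with $S(V)\otimes\wedge M$ given by $\langle f\otimes\nu,s\otimes\ell\rangle=\langle f,s\rangle\langle\nu,\ell\rangle$, where $\langle\lambda_1\cdots\lambda_k,v_1\cdots v_l\rangle=\delta_{kl}\,\mathrm{perm}(\lambda_i(v_j))$ and $\langle\mu_1\wedge\cdots\wedge\mu_k,m_1\wedge\cdots\wedge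 m_l\rangle=\delta_{kl}\det(\mu_i(m_j))$. The space of harmonics is $$\mathcal H(S(V^*)\otimes\wedge M^*)=\{\omega\in S(V^*)\otimes\wedge M^*:\langle\omega,\xi\rangle=0\text{ for all }\xi\in\mathcal J_M\}.$$ **Theorem.** Suppose that $J_{M^*}$ divides $\Delta_\chi$ in $S(V^*)$ and that $M^G=0$. Then the $2^r$ elements $$d_{i_1}^*\cdots d_{i_k}^*\Delta_\chi,\qquad 1\le i_1<\cdots<i_k\le r,\quad 0\le k\le r,$$ form an $F$-basis of $\mathcal H(S(V^*)\otimes\wedge M^*)^\chi$, and their images form an $F$-basis of $\big((S(V^*)\otimes\wedge M^*)/\mathcal J_M^*\big)^\chi$. -/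

import Mathlib

open scoped TensorProduct

noncomputable section

namespace SuperCoinvariant

/-! ### Symmetric algebras -/

section Sym

variable {F : Type*} [Field F]
variable {W : Type*} [AddCommGroup W] [Module F W]
variable {W' : Type*} [AddCommGroup W'] [Module F W']

/-- Functoriality of the symmetric algebra. -/
def symMap (f : W →ₗ[F] W') : SymmetricAlgebra F W →ₐ[F] SymmetricAlgebra F W' :=
  SymmetricAlgebra.lift (SymmetricAlgebra.ι F W' ∘ₗ f)

@[simp]
theorem symMap_ι (f : W →ₗ[F] W') (w : W) :
    symMap f (SymmetricAlgebra.ι F W w) = SymmetricAlgebra.ι F W' (f w) := by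
  simp [symMap]

/-- The homogeneous component of degree `k` of the symmetric algebra. -/
def symDeg (F W : Type*) [Field F] [AddCommGroup W] [Module F W] (k : ℕ) :
    Submodule F (SymmetricAlgebra F W) :=
  LinearMap.range (SymmetricAlgebra.ι F W) ^ k

/-- The algebra morphism `w ↦ w + φ(w) ε` into the dual numbers over the symmetric algebra,
that is, `f ↦ f + (∂_φ f) ε`. -/
def symDual (φ : Module.Dual F W) :
    SymmetricAlgebra F W →ₐ[F] TrivSqZeroExt (SymmetricAlgebra F W) (SymmetricAlgebra F W) :=
  SymmetricAlgebra.lift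
    (TrivSqZeroExt.inlAlgHom F (SymmetricAlgebra F W) (SymmetricAlgebra F W) ∘ₗ
        SymmetricAlgebra.ι F W +
      (TrivSqZeroExt.inrHom (SymmetricAlgebra F W) (SymmetricAlgebra F W)).restrictScalars F ∘ₗ
        Algebra.linearMap F (SymmetricAlgebra F W) ∘ₗ φ)

theorem symDual_fst (φ : Module.Dual F W) (f : SymmetricAlgebra F W) :
    (symDual φ f).fst = f := by
  induction f using SymmetricAlgebra.induction with
  | algebraMap r => simp [TrivSqZeroExt.algebraMap_eq_inl']
  | ι x => simp [symDual]
  | mul a b ha hb => simp [ha, hb]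
  | add a b ha hb => simp [ha, hb]

/-- The derivation of the symmetric algebra of `W` with `w ↦ φ(w)` for `w ∈ W`. -/
def symDerivAux (φ : Module.Dual F W) :
    Derivation F (SymmetricAlgebra F W) (SymmetricAlgebra F W) :=
  Derivation.mk'
    ((TrivSqZeroExt.sndHom (SymmetricAlgebra F W) (SymmetricAlgebra F W)).restrictScalars F ∘ₗ
      (symDual φ).toLinearMap)
    (fun a b => by simp [symDual_fst, mul_comm])

@[simp]
theorem symDerivAux_ι (φ : Module.Dual F W) (w : W) :
    symDerivAux φ (SymmetricAlgebra.ι F W w) = algebraMap F _ (φ w) := by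
  simp [symDerivAux, symDual, Algebra.algebraMap_eq_smul_one]

theorem symDeriv_ext {D E : Derivation F (SymmetricAlgebra F W) (SymmetricAlgebra F W)}
    (h : ∀ w, D (SymmetricAlgebra.ι F W w) = E (SymmetricAlgebra.ι F W w)) : D = E := by
  ext f
  induction f using SymmetricAlgebra.induction with
  | algebraMap r => simp
  | ι x => exact h x
  | mul a b ha hb => simp [ha, hb]
  | add a b ha hb => simp [ha, hb]

/-- The directional derivatives of the symmetric algebra of `W`, depending linearly on
the element of the dual space. -/
def symDeriv : Module.Dual F W →ₗ[F]
    Derivation F (SymmetricAlgebra F W) (SymmetricAlgebra F W) where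
  toFun := symDerivAux
  map_add' φ ψ := symDeriv_ext fun w => by simp
  map_smul' c φ := symDeriv_ext fun w => by simp [Algebra.smul_def]

@[simp]
theorem symDeriv_ι (φ : Module.Dual F W) (w : W) :
    symDeriv φ (SymmetricAlgebra.ι F W w) = algebraMap F _ (φ w) :=
  symDerivAux_ι φ w

theorem symDeriv_comm (φ ψ : Module.Dual F W) (f : SymmetricAlgebra F W) :
    symDeriv φ (symDeriv ψ f) = symDeriv ψ (symDeriv φ f) := by
  have h : ⁅symDeriv φ, symDeriv ψ⁆ = 0 := symDeriv_ext fun w => by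
    simp [Derivation.commutator_apply]
  have h' := congrArg (fun D => D f) h
  simpa [Derivation.commutator_apply, sub_eq_zero] using h'

end Sym

section Pairing

variable (F : Type*) [Field F]
variable (V : Type*) [AddCommGroup V] [Module F V]

/-- For `v ∈ V`, the operator `∂_v` on polynomial functions on `V`. -/
def partialV : V →ₗ[F] Module.End F (SymmetricAlgebra F (Module.Dual F V)) where
  toFun v := (symDeriv (Module.Dual.eval F V v)).toLinearMap
  map_add' v w := by ext f; simp
  map_smul' c v := by ext f; simp

theorem partialV_comm (v w : V) : Commute (partialV F V v) (partialV F V w) := by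
  ext f
  exact symDeriv_comm _ _ f

/-- The algebra of constant coefficient differential operators on polynomial functions on `V`. -/
def diffOps : Subalgebra F (Module.End F (SymmetricAlgebra F (Module.Dual F V))) :=
  Algebra.adjoin F (Set.range (partialV F V))

instance diffOps.instIsMulCommutative : IsMulCommutative (diffOps F V) :=
  Algebra.isMulCommutative_adjoin F (by
    rintro _ ⟨v, rfl⟩ _ ⟨w, rfl⟩
    exact partialV_comm F V v w)

open scoped IsMulCommutative in
/-- The action `s ↦ ∂_s` of the symmetric algebra of `V` on polynomial functions on `V`:
the algebra morphism extending `v ↦ ∂_v`. -/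
def symDiff : SymmetricAlgebra F V →ₐ[F] Module.End F (SymmetricAlgebra F (Module.Dual F V)) :=
  (diffOps F V).val.comp
    (SymmetricAlgebra.lift
      ((partialV F V).codRestrict (Subalgebra.toSubmodule (diffOps F V))
        (fun v => Algebra.subset_adjoin ⟨v, rfl⟩)))

open scoped IsMulCommutative in
@[simp]
theorem symDiff_ι (v : V) : symDiff F V (SymmetricAlgebra.ι F V v) = partialV F V v := by
  simp [symDiff]
  rfl

/-- The pairing of polynomial functions on `V` with the symmetric algebra of `V`:
`⟨f, s⟩ = (∂_s f)(0)`, so that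
`⟨λ₁ ⋯ λ_k, v₁ ⋯ v_l⟩ = δ_{kl} perm (λ_i (v_j))`. -/
def symPairing : SymmetricAlgebra F (Module.Dual F V) →ₗ[F] SymmetricAlgebra F V →ₗ[F] F :=
  ((symDiff F V).toLinearMap.compr₂
    (SymmetricAlgebra.algebraMapInv (R := F) (M := Module.Dual F V)).toLinearMap).flip

variable (M : Type*) [AddCommGroup M] [Module F M]

/-- For `m ∈ M`, the interior product `ι_m` on the exterior algebra of the dual of `M`. -/
def interior : M →ₗ[F] Module.End F (ExteriorAlgebra F (Module.Dual F M)) :=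
  CliffordAlgebra.contractLeft (Q := (0 : QuadraticForm F (Module.Dual F M))) ∘ₗ
    Module.Dual.eval F M

/-- The action `ℓ ↦ ι_ℓ` of the exterior algebra of `M` on the exterior algebra of the dual
of `M`, adjoint to left multiplication: `ι_{m ∧ ℓ} = ι_ℓ ∘ ι_m`. -/
def extContract : ExteriorAlgebra F M →ₐ[F]
    (Module.End F (ExteriorAlgebra F (Module.Dual F M)))ᵐᵒᵖ :=
  ExteriorAlgebra.lift F
    ⟨(MulOpposite.opLinearEquiv F).toLinearMap ∘ₗ interior F M, fun m =>
      congrArg MulOpposite.op (show interior F M m * interior F M m = 0 from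
        LinearMap.ext fun x => CliffordAlgebra.contractLeft_contractLeft _ x)⟩

/-- The pairing of the exterior algebras of the dual of `M` and of `M`: the value `⟨ν, ℓ⟩` is
the scalar component of `ι_ℓ ν`, so that
`⟨μ₁ ∧ ⋯ ∧ μ_k, m₁ ∧ ⋯ ∧ m_l⟩ = δ_{kl} det (μ_i (m_j))`. -/
def extPairing : ExteriorAlgebra F (Module.Dual F M) →ₗ[F] ExteriorAlgebra F M →ₗ[F] F :=
  (((MulOpposite.opLinearEquiv F
      (M := Module.End F (ExteriorAlgebra F (Module.Dual F M)))).symm.toLinearMap ∘ₗ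
    (extContract F M).toLinearMap).compr₂
    (ExteriorAlgebra.algebraMapInv (R := F) (M := Module.Dual F M)).toLinearMap).flip

/-- The algebra `S(V) ⊗ ∧M`. -/
abbrev SuperAlg : Type _ := SymmetricAlgebra F V ⊗[F] ExteriorAlgebra F M

/-- The pairing of `S(V*) ⊗ ∧M*` with `S(V) ⊗ ∧M`:
`⟨f ⊗ ν, s ⊗ ℓ⟩ = ⟨f, s⟩ ⟨ν, ℓ⟩`. -/
def superPairing :
    SuperAlg F (Module.Dual F V) (Module.Dual F M) →ₗ[F] SuperAlg F V M →ₗ[F] F :=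
  (TensorProduct.map₂ (symPairing F V) (extPairing F M)).compr₂
    (TensorProduct.lid F F).toLinearMap

/-- The action of `S(V) ⊗ ∧M*` on `S(V*) ⊗ ∧M*`:
`s ⊗ μ` acts by `∂_s ⊗ (μ ∧ ·)`. -/
def superAct : SuperAlg F V (Module.Dual F M) →ₗ[F]
    Module.End F (SuperAlg F (Module.Dual F V) (Module.Dual F M)) :=
  TensorProduct.homTensorHomMap (RingHom.id F) _ _ _ _ ∘ₗ
    TensorProduct.map (symDiff F V).toLinearMap
      (LinearMap.mul F (ExteriorAlgebra F (Module.Dual F M)))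

end Pairing

/-! ### Formulas for the pairings and the action

`symPairing_prod`, `symPairing_prod_of_ne`, `extPairing_ιMulti`, `extPairing_ιMulti_of_ne` and
`superPairing_tmul` say that the pairings are given by permanents and determinants. -/

section Formulas

open SymmetricAlgebra

variable (F : Type*) [Field F]
variable (V : Type*) [AddCommGroup V] [Module F V]
variable (M : Type*) [AddCommGroup M] [Module F M]

theorem symPairing_ι_mul (v : V) (f s) :
   symPairing F V f (ι F V v * s) = symPairing F V (partialV F V v f) s := by
  rw [mul_comm]; simp [symPairing]

theorem partialV_prod (v : V) {k : ℕ} (f : Fin (k+1) → Module.Dual F V) :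
    partialV F V v (∏ i, ι F _ (f i)) = ∑ i, (f i v) • ∏ j : Fin k, ι F _ (f (i.succAbove j)) := by
  induction k with
  | zero =>
    change symDeriv _ _ = _
    simp [Algebra.algebraMap_eq_smul_one]
  | succ k ih =>
    have h : ∀ a b, partialV F V v (a * b) = partialV F V v a * b + a * partialV F V v b := by
      intro a b
      change symDeriv _ _ = symDeriv _ _ * _ + _ * symDeriv _ _
      rw [Derivation.leibniz, smul_eq_mul, smul_eq_mul, add_comm, mul_comm b]
    have h1 : partialV F V v (ι F _ (f 0)) = f 0 v • 1 := by
      change symDeriv _ _ = _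
      simp [Algebra.algebraMap_eq_smul_one]
    rw [Fin.prod_univ_succ, h, ih, h1, Fin.sum_univ_succ (n := k+1), Finset.mul_sum]
    congr 1
    · simp
    · refine Finset.sum_congr rfl fun i _ => ?_
      rw [Fin.prod_univ_succ]
      simp

theorem permanent_succ_column_zero {k : ℕ} (A : Matrix (Fin (k+1)) (Fin (k+1)) F) :
    A.permanent = ∑ i, A i 0 * (A.submatrix i.succAbove Fin.succ).permanent := by
  rw [Matrix.permanent, ← Equiv.Perm.decomposeFin.symm.sum_comp, Fintype.sum_prod_type]
  refine Finset.sum_congr rfl fun p _ => ?_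
  have h : ∀ i : Fin k, ∃ z, p.succAbove z = Equiv.swap 0 p i.succ := fun i =>
    Fin.exists_succAbove_eq (by
      intro h
      have : i.succ = 0 := (Equiv.swap 0 p).injective (by rw [h]; simp)
      simp at this)
  choose e he using h
  have hinj : Function.Injective e := fun i j hij => by
    have := he i
    rw [hij, he j] at this
    simpa using this.symm
  let e' : Equiv.Perm (Fin k) := Equiv.ofBijective e (Finite.injective_iff_bijective.1 hinj)
  have h2 : (A.submatrix p.succAbove Fin.succ).permanent =
     ((A.submatrix p.succAbove Fin.succ).submatrix e' id).permanent := by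
    exact (Matrix.permanent_permute_cols e' _).symm
  rw [h2, Matrix.permanent, Finset.mul_sum]
  refine Finset.sum_congr rfl fun σ _ => ?_
  rw [Fin.prod_univ_succ]
  simp [e', he]

theorem symPairing_prod {k : ℕ} (f : Fin k → Module.Dual F V) (v : Fin k → V) :
    symPairing F V (∏ i, ι F _ (f i)) (∏ i, ι F _ (v i)) =
      (Matrix.of fun i j => f i (v j)).permanent := by
  induction k with
  | zero => simp [Matrix.permanent, symPairing]
  | succ k ih =>
    rw [Fin.prod_univ_succ (fun i => ι F V (v i)), symPairing_ι_mul, partialV_prod,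
      permanent_succ_column_zero]
    simp only [map_sum, LinearMap.sum_apply, map_smul, LinearMap.smul_apply, ih]
    rfl

theorem symPairing_prod_of_ne {k l : ℕ} (h : k ≠ l) (f : Fin k → Module.Dual F V) (v : Fin l → V) :
    symPairing F V (∏ i, ι F _ (f i)) (∏ i, ι F _ (v i)) = 0 := by
  induction l generalizing k with
  | zero =>
    obtain _ | k := k
    · simp at h
    simp [symPairing, Fin.prod_univ_succ, algebraMapInv_ι]
  | succ l ih =>
    rw [Fin.prod_univ_succ (fun i => ι F V (v i)), symPairing_ι_mul]
    obtain _ | k := k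
    · simp [partialV]
    rw [partialV_prod]
    simp only [map_sum, LinearMap.sum_apply, map_smul, LinearMap.smul_apply]
    simp [ih (k := k) (by omega)]

theorem extPairing_ι_mul (m : M) (ν s) :
   extPairing F M ν (ExteriorAlgebra.ι F m * s) = extPairing F M (interior F M m ν) s := by
  simp [extPairing, extContract]

theorem interior_ιMulti (v : M) {k : ℕ} (f : Fin (k+1) → Module.Dual F M) :
    interior F M v (ExteriorAlgebra.ιMulti F _ f) = ∑ i : Fin (k+1), ((-1 : F)^(i:ℕ) * f i v) •
       ExteriorAlgebra.ιMulti F _ (i.removeNth f) := by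
  induction k with
  | zero =>
    simp only [ExteriorAlgebra.ιMulti_apply, interior]
    simp
    exact Algebra.algebraMap_eq_smul_one _
  | succ k ih =>
    rw [ExteriorAlgebra.ιMulti_succ_apply]
    have : interior F M v
          (ExteriorAlgebra.ι F (f 0) * ExteriorAlgebra.ιMulti F _ (Matrix.vecTail f)) =
        f 0 v • ExteriorAlgebra.ιMulti F _ (Matrix.vecTail f) -
          ExteriorAlgebra.ι F (f 0) *
            interior F M v (ExteriorAlgebra.ιMulti F _ (Matrix.vecTail f)) :=
      CliffordAlgebra.contractLeft_ι_mul _ _ _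
    rw [this, ih, Fin.sum_univ_succ (n := k+1), Finset.mul_sum, sub_eq_add_neg,
      ← Finset.sum_neg_distrib]
    congr 1
    · simp; rfl
    · refine Finset.sum_congr rfl fun i _ => ?_
      rw [ExteriorAlgebra.ιMulti_succ_apply]
      have e : Matrix.vecTail (i.succ.removeNth f) = i.removeNth (Matrix.vecTail f) := by
        ext j; simp [Matrix.vecTail, Fin.removeNth]
      have e0 : i.succ.removeNth f 0 = f 0 := by simp [Fin.removeNth]
      rw [e, e0, mul_smul_comm, ← neg_smul]
      congr 1
      simp [pow_succ, Matrix.vecTail]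

theorem extPairing_ιMulti {k : ℕ} (f : Fin k → Module.Dual F M) (v : Fin k → M) :
    extPairing F M (ExteriorAlgebra.ιMulti F _ f) (ExteriorAlgebra.ιMulti F _ v) =
      (Matrix.of fun i j => f i (v j)).det := by
  induction k with
  | zero => simp [extPairing, ExteriorAlgebra.ιMulti_apply]
  | succ k ih =>
    rw [ExteriorAlgebra.ιMulti_succ_apply v, extPairing_ι_mul, interior_ιMulti,
      Matrix.det_succ_column_zero]
    rw [map_sum, LinearMap.sum_apply]
    refine Finset.sum_congr rfl fun i _ => ?_
    have := ih (i.removeNth f) (Matrix.vecTail v)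
    rw [map_smul, LinearMap.smul_apply, this]
    rfl

theorem extPairing_ιMulti_of_ne {k l : ℕ} (h : k ≠ l) (f : Fin k → Module.Dual F M) (v : Fin l → M) :
    extPairing F M (ExteriorAlgebra.ιMulti F _ f) (ExteriorAlgebra.ιMulti F _ v) = 0 := by
  induction l generalizing k with
  | zero =>
    obtain _ | k := k
    · simp at h
    rw [ExteriorAlgebra.ιMulti_succ_apply f]
    simp [extPairing, ExteriorAlgebra.algebraMapInv]
  | succ l ih =>
    rw [ExteriorAlgebra.ιMulti_succ_apply v, extPairing_ι_mul]
    obtain _ | k := k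
    · have h0 : interior F M (v 0) (ExteriorAlgebra.ιMulti F 0 f) = 0 := by
        rw [ExteriorAlgebra.ιMulti_zero_apply]
        exact CliffordAlgebra.contractLeft_one (Q := 0) _
      rw [h0, map_zero, LinearMap.zero_apply]
    rw [interior_ιMulti]
    simp only [map_sum, LinearMap.sum_apply, map_smul, LinearMap.smul_apply]
    simp [ih (k := k) (by omega)]

theorem superAct_tmul (s : SymmetricAlgebra F V) (μ) (f ν) :
  superAct F V M (s ⊗ₜ μ) (f ⊗ₜ ν) = symDiff F V s f ⊗ₜ (μ * ν) := by
  simp [superAct]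
theorem superPairing_tmul (s : SymmetricAlgebra F V) (μ) (f ν) :
  superPairing F V M (f ⊗ₜ ν) (s ⊗ₜ μ)  = symPairing F V f s * extPairing F M ν μ  := by
  simp [superPairing]

end Formulas

/-! ### Group actions -/

section Rep

variable {F : Type*} [Field F] {G : Type*} [Group G]
variable {V : Type*} [AddCommGroup V] [Module F V]
variable {M : Type*} [AddCommGroup M] [Module F M]

/-- The action of `G` on the symmetric algebra of `V`. -/
def symRep (ρ : Representation F G V) : Representation F G (SymmetricAlgebra F V) where
  toFun g := (symMap (ρ g)).toLinearMap
  map_one' := by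
    have h : symMap (ρ 1) = AlgHom.id F (SymmetricAlgebra F V) := by ext; simp
    rw [h]; rfl
  map_mul' g h := by
    have e : symMap (ρ (g * h)) = (symMap (ρ g)).comp (symMap (ρ h)) := by ext; simp
    rw [e]; rfl

/-- The action of `G` on the exterior algebra of `M`. -/
def extRep (σ : Representation F G M) : Representation F G (ExteriorAlgebra F M) where
  toFun g := (ExteriorAlgebra.map (σ g)).toLinearMap
  map_one' := by
    have h : ExteriorAlgebra.map (σ 1) = AlgHom.id F (ExteriorAlgebra F M) := by
      rw [map_one]; exact ExteriorAlgebra.map_id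
    rw [h]; rfl
  map_mul' g h := by
    rw [map_mul]
    have e : ExteriorAlgebra.map (σ g * σ h) =
        (ExteriorAlgebra.map (σ g)).comp (ExteriorAlgebra.map (σ h)) :=
      (ExteriorAlgebra.map_comp_map (σ h) (σ g)).symm
    rw [e]; rfl

/-- The diagonal action of `G` on `S(V) ⊗ ∧M`. -/
def superRep (ρ : Representation F G V) (σ : Representation F G M) :
    Representation F G (SuperAlg F V M) :=
  (symRep ρ).tprod (extRep σ)

/-- The subspace of all `w` with `g w = χ(g) w` for all `g ∈ G`. -/
def semiInvariants (ρ : Representation F G V) (χ : G →* Fˣ) : Submodule F V where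
  carrier := {w | ∀ g, ρ g w = (χ g : F) • w}
  add_mem' {v w} hv hw g := by rw [map_add, hv g, hw g, smul_add]
  zero_mem' g := by simp
  smul_mem' c w hw g := by rw [map_smul, hw g, smul_comm]

/-- The component of bidegree `(i, j)` of `S(V) ⊗ ∧M`. -/
def superDeg (F V M : Type*) [Field F] [AddCommGroup V] [Module F V] [AddCommGroup M]
    [Module F M] (i j : ℕ) : Submodule F (SuperAlg F V M) :=
  Submodule.map₂ (TensorProduct.mk F (SymmetricAlgebra F V) (ExteriorAlgebra F M))
    (symDeg F V i) (⋀[F]^j M)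

/-- The homogeneous invariants of positive degree in `S(V) ⊗ ∧M`. -/
def positiveInvariants (ρ : Representation F G V) (σ : Representation F G M) :
    Set (SuperAlg F V M) :=
  {x | x ∈ (superRep ρ σ).invariants ∧ ∃ i j, 0 < i + j ∧ x ∈ superDeg F V M i j}

/-- The (two-sided) coinvariant ideal of `S(V) ⊗ ∧M`, generated by the homogeneous invariants
of positive degree. -/
def coinvariantIdeal (ρ : Representation F G V) (σ : Representation F G M) :
    TwoSidedIdeal (SuperAlg F V M) :=
  TwoSidedIdeal.span (positiveInvariants ρ σ)

/-- The coinvariant ideal as a linear subspace. -/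
def coinvariantSubmodule (ρ : Representation F G V) (σ : Representation F G M) :
    Submodule F (SuperAlg F V M) :=
  (TwoSidedIdeal.asIdeal (coinvariantIdeal ρ σ)).restrictScalars F

theorem coinvariantSubmodule_le_comap (ρ : Representation F G V) (σ : Representation F G M)
    (g : G) :
    coinvariantSubmodule ρ σ ≤ (coinvariantSubmodule ρ σ).comap (superRep ρ σ g) := by
  let φ : SuperAlg F V M →ₐ[F] SuperAlg F V M :=
    Algebra.TensorProduct.map (symMap (ρ g)) (ExteriorAlgebra.map (σ g))
  have hφ : ∀ x, superRep ρ σ g x = φ x := fun x => rfl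
  have hle : coinvariantIdeal ρ σ ≤ (coinvariantIdeal ρ σ).comap φ := by
    refine TwoSidedIdeal.span_le.2 fun x hx => ?_
    have hx' : φ x = x := by rw [← hφ]; exact hx.1 g
    change x ∈ (coinvariantIdeal ρ σ).comap φ
    rw [TwoSidedIdeal.mem_comap, hx']
    exact TwoSidedIdeal.subset_span hx
  intro x hx
  have hx1 : x ∈ coinvariantIdeal ρ σ := hx
  have hx2 := hle hx1
  rw [TwoSidedIdeal.mem_comap] at hx2
  change superRep ρ σ g x ∈ coinvariantIdeal ρ σ
  rw [hφ]
  exact hx2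

/-- The super coinvariant algebra `S(V) ⊗ ∧M / J`, as a vector space. -/
abbrev SuperCoinv (ρ : Representation F G V) (σ : Representation F G M) : Type _ :=
  SuperAlg F V M ⧸ coinvariantSubmodule ρ σ

/-- The induced action of `G` on the super coinvariant algebra. -/
def superCoinvRep (ρ : Representation F G V) (σ : Representation F G M) :
    Representation F G (SuperCoinv ρ σ) :=
  (superRep ρ σ).quotient (coinvariantSubmodule ρ σ) (coinvariantSubmodule_le_comap ρ σ)

/-- The harmonic elements of `S(V*) ⊗ ∧M*`: the orthogonal complement of the coinvariant ideal
of `S(V) ⊗ ∧M`. -/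
def harmonics (ρ : Representation F G V) (σ : Representation F G M) :
    Submodule F (SuperAlg F (Module.Dual F V) (Module.Dual F M)) where
  carrier := {ω | ∀ ξ ∈ coinvariantIdeal ρ σ, superPairing F V M ω ξ = 0}
  add_mem' {a b} ha hb ξ hξ := by rw [map_add, LinearMap.add_apply, ha ξ hξ, hb ξ hξ, add_zero]
  zero_mem' ξ _ := by simp
  smul_mem' c a ha ξ hξ := by rw [map_smul, LinearMap.smul_apply, ha ξ hξ, smul_zero]

/-- `ω` is a homogeneous basis of the module of invariants of `S(V) ⊗ M` over the ring of
invariants of `S(V)`. -/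
structure IsBasicDerivations (ρ : Representation F G V) (σ : Representation F G M) {r : ℕ}
    (ω : Fin r → SymmetricAlgebra F V ⊗[F] M) : Prop where
  homogeneous : ∀ i, ∃ e : ℕ, ω i ∈
    Submodule.map₂ (TensorProduct.mk F (SymmetricAlgebra F V) M) (symDeg F V e) ⊤
  invariant : ∀ i, ω i ∈ ((symRep ρ).tprod σ).invariants
  basis : ∀ x ∈ ((symRep ρ).tprod σ).invariants, ∃! c : Fin r → SymmetricAlgebra F V,
    (∀ i, c i ∈ (symRep ρ).invariants) ∧ x = ∑ i, c i • ω i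

/-- The determinant of the matrix of coefficients of `ω` with respect to a basis of `M`. -/
def jacobian {r : ℕ} (b : Module.Basis (Fin r) F M)
    (ω : Fin r → SymmetricAlgebra F V ⊗[F] M) : SymmetricAlgebra F V :=
  Matrix.det (Matrix.of fun i j =>
    (Algebra.TensorProduct.basis (SymmetricAlgebra F V) b).repr (ω i) j)

/-- `Δ` is a Vandermondian for `χ` in `S(V)`: the `χ`-semi-invariants of `S(V)` are exactly the
multiples of `Δ` by invariants. -/
def IsVandermondian (ρ : Representation F G V) (χ : G →* Fˣ) (Δ : SymmetricAlgebra F V) : Prop :=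
  ∀ h, h ∈ semiInvariants (symRep ρ) χ ↔ ∃ f ∈ (symRep ρ).invariants, h = f * Δ

/-- The operator on `S(V*) ⊗ ∧M*` given by the action of `ω ∈ S(V) ⊗ M*`. -/
def dStar (ω : SymmetricAlgebra F V ⊗[F] Module.Dual F M) :
    Module.End F (SuperAlg F (Module.Dual F V) (Module.Dual F M)) :=
  superAct F V M (TensorProduct.map LinearMap.id (ExteriorAlgebra.ι F) ω)

/-- For `I = {i₁ < ⋯ < i_k}`, the element `d_{i₁} ⋯ d_{i_k} (Δ ⊗ 1)`, where `d_i` is the action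
of `ω i`. -/
def superAlternant {r : ℕ} (ω : Fin r → SymmetricAlgebra F V ⊗[F] Module.Dual F M)
    (Δ : SymmetricAlgebra F (Module.Dual F V)) (I : Finset (Fin r)) :
    SuperAlg F (Module.Dual F V) (Module.Dual F M) :=
  ((I.sort (· ≤ ·)).map fun i => dStar (ω i)).prod (Δ ⊗ₜ[F] 1)

end Rep

/-! ### Pseudo-reflection groups -/

section PseudoReflection

variable {F : Type*} [Field F] {V : Type*} [AddCommGroup V] [Module F V]

/-- A pseudo-reflection: the fixed space of `g` has codimension one. -/
def IsPseudoReflection (g : LinearMap.GeneralLinearGroup F V) : Prop :=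
  Module.finrank F (LinearMap.ker ((g : V →ₗ[F] V) - LinearMap.id)) + 1 = Module.finrank F V

/-- A finite subgroup of `GL(V)` generated by pseudo-reflections. -/
def IsPseudoReflectionGroup (G : Subgroup (LinearMap.GeneralLinearGroup F V)) : Prop :=
  Finite G ∧ Subgroup.closure {g | g ∈ G ∧ IsPseudoReflection g} = G

/-- The defining representation of a subgroup of `GL(V)`. -/
def defRep (G : Subgroup (LinearMap.GeneralLinearGroup F V)) : Representation F G V :=
  (Units.coeHom (V →ₗ[F] V)).comp G.subtype

end PseudoReflection

end SuperCoinvariant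

end

/-!
Write `A = S(V*) ⊗ ∧M*`, `B = S(V) ⊗ ∧M` and `R = S(V*)^G`, and let `J*` be the coinvariant ideal
of `A` and `H` the space of harmonics in `A`.

*Harmonics and coinvariants.* `H ∩ J* = 0`
(`eq_zero_of_mem_harmonics_of_mem_coinvariantIdeal`). Over `ℂ` this would follow from an invariant
Hermitian form. In general, `V` and `M` are quotients of permutation modules, so that `A` embeds into
the corresponding algebra for these, compatibly with `H` and `J*`. For permutation modules the ideal
is spanned by integral combinations of monomials, the monomials are orthogonal with positive integral
norms, and a Gram determinant that is nonzero over `ℤ` is nonzero in `F`.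

*The alternants are harmonic.* Being harmonic follows from being annihilated by the contractions by
all positive invariants of `B`. These contractions annihilate `Δ ⊗ 1`, because a semi-invariant of
smaller degree than `Δ` is zero. By a super Leibniz rule, the commutator of such a contraction with
`d_i*` is the contraction by another invariant, which is again positive because `M^G = 0` forces `ω_i`
to have positive degree (`superAlternant_mem_harmonics`).

*Upper bound.* If `x ∈ A` is a `χ`-semi-invariant, the scalar components of its iterated contractions
by the `θ_i` are `χ`-semi-invariants of `S(V*)`, hence of the form `f Δ` with `f ∈ R`. These
components determine `x`, since the jacobian of `θ` is not zero; and since it divides `Δ`, there is a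
family `η_I` in `A` whose components are `Δ` and zeros. So the semi-invariants lie in `∑ R η_I`, and
modulo `J*` they are spanned by `2 ^ r` elements (`exists_sub_mem_coinvariantIdeal`).

*Independence.* The operators `d_i*` anticommute and have square zero, so the alternants are linearly
independent as soon as `d_1* ⋯ d_r* (Δ ⊗ 1)`, which is `∂_{J'} Δ ⊗ vol` for the jacobian `J'` of
`ω`, is not zero (`linearIndependent_ordProd_apply`). The jacobian `J` of `θ` has the same degree as
`J'`, by comparison of Hilbert series (`sum_degrees_eq`), and they transform under inverse characters.
Write `Δ = J h`. An averaging argument gives a semi-invariant `h'` in `S(V)` of the degree and the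
inverse character of `h`; then `h' J'` has the degree and the inverse character of `Δ`, so it pairs
nontrivially with `Δ`, the only semi-invariant of this degree up to scalars
(`symDiff_jacobian_ne_zero`).

The `2 ^ r` alternants thus lie in `H^χ`, remain independent modulo `J*`, and span `(A / J*)^χ` by
the upper bound. Since `H ∩ J* = 0`, they also span `H^χ`.
-/

open scoped TensorProduct

noncomputable section

namespace SuperCoinvariant

/-! ### Functoriality of the pairings and of the operators -/

section Functoriality

variable {F : Type*} [Field F]
variable {V : Type*} [AddCommGroup V] [Module F V]
variable {V' : Type*} [AddCommGroup V'] [Module F V']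
variable {M : Type*} [AddCommGroup M] [Module F M]
variable {M' : Type*} [AddCommGroup M'] [Module F M']

/-- Functoriality of the algebra `S(V) ⊗ ∧M`. -/
def superMap (p : V →ₗ[F] V') (q : M →ₗ[F] M') : SuperAlg F V M →ₐ[F] SuperAlg F V' M' :=
  Algebra.TensorProduct.map (symMap p) (ExteriorAlgebra.map q)

@[simp]
theorem superMap_tmul (p : V →ₗ[F] V') (q : M →ₗ[F] M') (s : SymmetricAlgebra F V)
    (l : ExteriorAlgebra F M) :
    superMap p q (s ⊗ₜ l) = symMap p s ⊗ₜ ExteriorAlgebra.map q l := by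
  simp [superMap]

theorem symMap_comp {V'' : Type*} [AddCommGroup V''] [Module F V''] (p : V →ₗ[F] V')
    (p' : V' →ₗ[F] V'') (s : SymmetricAlgebra F V) :
    symMap p' (symMap p s) = symMap (p' ∘ₗ p) s := by
  have h : (symMap p').comp (symMap p) = symMap (p' ∘ₗ p) := by ext; simp
  exact congrArg (fun f => f s) h

theorem symMap_id (s : SymmetricAlgebra F V) : symMap (LinearMap.id : V →ₗ[F] V) s = s := by
  have h : symMap (LinearMap.id : V →ₗ[F] V) = AlgHom.id F _ := by ext; simp
  exact congrArg (fun f => f s) h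

theorem superMap_comp {V'' M'' : Type*} [AddCommGroup V''] [Module F V''] [AddCommGroup M'']
    [Module F M''] (p : V →ₗ[F] V') (p' : V' →ₗ[F] V'') (q : M →ₗ[F] M') (q' : M' →ₗ[F] M'')
    (x : SuperAlg F V M) :
    superMap p' q' (superMap p q x) = superMap (p' ∘ₗ p) (q' ∘ₗ q) x := by
  induction x using TensorProduct.induction_on with
  | zero => simp
  | tmul s l =>
    simp only [superMap_tmul, symMap_comp]
    congr 1
    exact congrArg (fun f => f l) (ExteriorAlgebra.map_comp_map q q')
  | add x y hx hy => simp [hx, hy]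

theorem superMap_id (x : SuperAlg F V M) : superMap LinearMap.id LinearMap.id x = x := by
  induction x using TensorProduct.induction_on with
  | zero => simp
  | tmul s l => simp [symMap_id]
  | add x y hx hy => simp [hx, hy]

theorem superMap_injective {p : V →ₗ[F] V'} {q : M →ₗ[F] M'} (hp : Function.Injective p)
    (hq : Function.Injective q) : Function.Injective (superMap p q) := by
  obtain ⟨p', hp'⟩ := p.exists_leftInverse_of_injective (LinearMap.ker_eq_bot.2 hp)
  obtain ⟨q', hq'⟩ := q.exists_leftInverse_of_injective (LinearMap.ker_eq_bot.2 hq)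
  refine Function.LeftInverse.injective (g := superMap p' q') fun x => ?_
  rw [superMap_comp, hp', hq', superMap_id]

theorem partialV_apply (v : V) (f : SymmetricAlgebra F (Module.Dual F V)) :
    partialV F V v f = symDeriv (Module.Dual.eval F V v) f := rfl

theorem partialV_symMap_dualMap (p : V →ₗ[F] V') (v : V)
    (f : SymmetricAlgebra F (Module.Dual F V')) :
    partialV F V v (symMap p.dualMap f) = symMap p.dualMap (partialV F V' (p v) f) := by
  simp only [partialV_apply]
  induction f using SymmetricAlgebra.induction with
  | algebraMap r => simp
  | ι x => simp
  | mul a b ha hb => simp [ha, hb]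
  | add a b ha hb => simp [ha, hb]

theorem symDiff_symMap_dualMap (p : V →ₗ[F] V') (s : SymmetricAlgebra F V)
    (f : SymmetricAlgebra F (Module.Dual F V')) :
    symDiff F V s (symMap p.dualMap f) = symMap p.dualMap (symDiff F V' (symMap p s) f) := by
  induction s using SymmetricAlgebra.induction generalizing f with
  | algebraMap r => simp [Algebra.algebraMap_eq_smul_one]
  | ι x => simp [partialV_symMap_dualMap]
  | mul a b ha hb => simp [ha, hb]
  | add a b ha hb => simp [ha, hb]

theorem algebraMapInv_symMap (p : V →ₗ[F] V') (s : SymmetricAlgebra F V) :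
    SymmetricAlgebra.algebraMapInv (symMap p s) = SymmetricAlgebra.algebraMapInv s := by
  have h : (SymmetricAlgebra.algebraMapInv (R := F)).comp (symMap p) =
      SymmetricAlgebra.algebraMapInv := by
    ext; simp [SymmetricAlgebra.algebraMapInv_ι]
  exact congrArg (fun f => f s) h

theorem symPairing_apply (f : SymmetricAlgebra F (Module.Dual F V)) (s : SymmetricAlgebra F V) :
    symPairing F V f s = SymmetricAlgebra.algebraMapInv (symDiff F V s f) := rfl

theorem symPairing_symMap (p : V →ₗ[F] V') (f : SymmetricAlgebra F (Module.Dual F V'))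
    (s : SymmetricAlgebra F V) :
    symPairing F V (symMap p.dualMap f) s = symPairing F V' f (symMap p s) := by
  simp only [symPairing_apply, symDiff_symMap_dualMap, algebraMapInv_symMap]

/-- The operator `ι_ℓ` on the exterior algebra of the dual of `M`. -/
def extInterior : ExteriorAlgebra F M →ₗ[F]
    Module.End F (ExteriorAlgebra F (Module.Dual F M)) :=
  (MulOpposite.opLinearEquiv F
      (M := Module.End F (ExteriorAlgebra F (Module.Dual F M)))).symm.toLinearMap ∘ₗ
    (extContract F M).toLinearMap

theorem extInterior_mul (l l' : ExteriorAlgebra F M) :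
    extInterior (l * l') = extInterior l' * extInterior l := by
  simp [extInterior]

theorem extInterior_one : extInterior (1 : ExteriorAlgebra F M) = 1 := by
  simp [extInterior]

theorem extInterior_ι (m : M) : extInterior (ExteriorAlgebra.ι F m) = interior F M m := by
  simp [extInterior, extContract]

theorem extInterior_algebraMap (c : F) :
    extInterior (algebraMap F (ExteriorAlgebra F M) c) = c • 1 := by
  rw [Algebra.algebraMap_eq_smul_one, map_smul, extInterior_one]

theorem extPairing_apply (ν : ExteriorAlgebra F (Module.Dual F M)) (l : ExteriorAlgebra F M) :
    extPairing F M ν l = ExteriorAlgebra.algebraMapInv (extInterior l ν) := rfl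

theorem interior_ι_mul (m : M) (μ : Module.Dual F M) (ν : ExteriorAlgebra F (Module.Dual F M)) :
    interior F M m (ExteriorAlgebra.ι F μ * ν) =
      μ m • ν - ExteriorAlgebra.ι F μ * interior F M m ν :=
  CliffordAlgebra.contractLeft_ι_mul _ _ _

theorem interior_algebraMap (m : M) (c : F) :
    interior F M m (algebraMap F _ c) = 0 :=
  CliffordAlgebra.contractLeft_algebraMap (Q := (0 : QuadraticForm F (Module.Dual F M))) _ c

theorem exteriorAlgebra_left_induction {P : ExteriorAlgebra F M → Prop}
    (algebraMap : ∀ r : F, P (algebraMap _ _ r)) (add : ∀ x y, P x → P y → P (x + y))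
    (ι_mul : ∀ m x, P x → P (ExteriorAlgebra.ι F m * x)) (x : ExteriorAlgebra F M) : P x :=
  CliffordAlgebra.left_induction (0 : QuadraticForm F M) algebraMap add
    (fun x m h => ι_mul m x h) x

theorem interior_map_dualMap (q : M →ₗ[F] M') (m : M)
    (ν : ExteriorAlgebra F (Module.Dual F M')) :
    interior F M m (ExteriorAlgebra.map q.dualMap ν) =
      ExteriorAlgebra.map q.dualMap (interior F M' (q m) ν) := by
  induction ν using exteriorAlgebra_left_induction with
  | algebraMap r =>
    simp only [AlgHom.commutes, interior_algebraMap, map_zero]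
  | ι_mul μ x hx => simp [interior_ι_mul, hx]
  | add a b ha hb => simp [ha, hb]

theorem extInterior_map_dualMap (q : M →ₗ[F] M') (l : ExteriorAlgebra F M)
    (ν : ExteriorAlgebra F (Module.Dual F M')) :
    extInterior l (ExteriorAlgebra.map q.dualMap ν) =
      ExteriorAlgebra.map q.dualMap (extInterior (ExteriorAlgebra.map q l) ν) := by
  induction l using ExteriorAlgebra.induction generalizing ν with
  | algebraMap r => simp [extInterior_algebraMap]
  | ι x => simp [extInterior_ι, interior_map_dualMap]
  | mul a b ha hb => simp [extInterior_mul, ha, hb]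
  | add a b ha hb => simp [ha, hb]

theorem extAlgebraMapInv_ι (m : M) :
    ExteriorAlgebra.algebraMapInv (ExteriorAlgebra.ι F m) = 0 := by
  simp [ExteriorAlgebra.algebraMapInv]

theorem algebraMapInv_extMap (q : M →ₗ[F] M') (l : ExteriorAlgebra F M) :
    ExteriorAlgebra.algebraMapInv (ExteriorAlgebra.map q l) =
      ExteriorAlgebra.algebraMapInv l := by
  have h : (ExteriorAlgebra.algebraMapInv (R := F)).comp (ExteriorAlgebra.map q) =
      ExteriorAlgebra.algebraMapInv := by
    ext; simp [extAlgebraMapInv_ι]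
  exact congrArg (fun f => f l) h

theorem extPairing_map (q : M →ₗ[F] M') (ν : ExteriorAlgebra F (Module.Dual F M'))
    (l : ExteriorAlgebra F M) :
    extPairing F M (ExteriorAlgebra.map q.dualMap ν) l =
      extPairing F M' ν (ExteriorAlgebra.map q l) := by
  simp only [extPairing_apply, extInterior_map_dualMap, algebraMapInv_extMap]

/-- The maps induced by `(p, q)` and by its transpose are adjoint for the pairings. -/
theorem superPairing_superMap (p : V →ₗ[F] V') (q : M →ₗ[F] M')
    (x : SuperAlg F (Module.Dual F V') (Module.Dual F M')) (y : SuperAlg F V M) :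
    superPairing F V M (superMap p.dualMap q.dualMap x) y =
      superPairing F V' M' x (superMap p q y) := by
  induction x using TensorProduct.induction_on with
  | zero => simp
  | add x x' hx hx' => simp [hx, hx']
  | tmul f ν =>
    induction y using TensorProduct.induction_on with
    | zero => simp
    | add y y' hy hy' => simp only [map_add, hy, hy']
    | tmul s l =>
      simp only [superMap_tmul, superPairing_tmul, symPairing_symMap, extPairing_map]

theorem superAct_mul (a b : SuperAlg F V (Module.Dual F M)) :
    superAct F V M (a * b) = superAct F V M a * superAct F V M b := by
  induction a using TensorProduct.induction_on with
  | zero => simp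
  | add x x' hx hx' => simp [add_mul, hx, hx']
  | tmul s μ =>
    induction b using TensorProduct.induction_on with
    | zero => simp
    | add y y' hy hy' => simp only [map_add, mul_add, hy, hy']
    | tmul s' μ' =>
      refine TensorProduct.ext' fun f ν => ?_
      simp [superAct_tmul, mul_assoc]

theorem superAct_one : superAct F V M 1 = 1 := by
  refine TensorProduct.ext' fun f ν => ?_
  simp [Algebra.TensorProduct.one_def, superAct_tmul]

/-- The operator on `S(V*) ⊗ ∧M*` adjoint to left multiplication by an element of
`S(V) ⊗ ∧M`: the tensor `s ⊗ ℓ` acts by `∂_s ⊗ ι_ℓ`. -/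
def superContract : SuperAlg F V M →ₗ[F]
    Module.End F (SuperAlg F (Module.Dual F V) (Module.Dual F M)) :=
  TensorProduct.homTensorHomMap (RingHom.id F) _ _ _ _ ∘ₗ
    TensorProduct.map (symDiff F V).toLinearMap extInterior

theorem superContract_tmul (s : SymmetricAlgebra F V) (l : ExteriorAlgebra F M)
    (f : SymmetricAlgebra F (Module.Dual F V)) (ν : ExteriorAlgebra F (Module.Dual F M)) :
    superContract (s ⊗ₜ l) (f ⊗ₜ ν) = symDiff F V s f ⊗ₜ extInterior l ν := by
  simp [superContract]

theorem superContract_mul (a b : SuperAlg F V M) :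
    superContract (a * b) = superContract b * superContract a := by
  induction a using TensorProduct.induction_on with
  | zero => simp
  | add x x' hx hx' => simp [add_mul, mul_add, hx, hx']
  | tmul s μ =>
    induction b using TensorProduct.induction_on with
    | zero => simp
    | add y y' hy hy' => simp only [map_add, mul_add, add_mul, hy, hy']
    | tmul s' μ' =>
      refine TensorProduct.ext' fun f ν => ?_
      rw [Algebra.TensorProduct.tmul_mul_tmul, mul_comm s]
      simp [superContract_tmul, extInterior_mul]

/-- The pairing of `x` and `y` is the scalar component of the contraction of `x` by `y`. -/
theorem superPairing_eq_zero_of_superContract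
    {x : SuperAlg F (Module.Dual F V) (Module.Dual F M)} {y : SuperAlg F V M}
    (h : superContract y x = 0) : superPairing F V M x y = 0 := by
  have key : superPairing F V M x y = Algebra.TensorProduct.lift
      (SymmetricAlgebra.algebraMapInv (R := F) (M := Module.Dual F V))
      (ExteriorAlgebra.algebraMapInv (R := F) (M := Module.Dual F M))
      (fun _ _ => Commute.all _ _) (superContract y x) := by
    clear h
    induction x using TensorProduct.induction_on with
    | zero => simp
    | add x x' hx hx' => simp [hx, hx']
    | tmul f ν =>
      induction y using TensorProduct.induction_on with
      | zero => simp
      | add y y' hy hy' => simp only [map_add, LinearMap.add_apply, hy, hy']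
      | tmul s l =>
        simp [superPairing_tmul, superContract_tmul, symPairing_apply, extPairing_apply]
  rw [key, h, map_zero]

end Functoriality

section Equivariance

variable {F : Type*} [Field F] {G : Type*} [Group G]
variable {V : Type*} [AddCommGroup V] [Module F V]
variable {M : Type*} [AddCommGroup M] [Module F M]
variable {V' : Type*} [AddCommGroup V'] [Module F V']
variable {M' : Type*} [AddCommGroup M'] [Module F M']

theorem superRep_apply (ρ : Representation F G V) (σ : Representation F G M) (g : G)
    (x : SuperAlg F V M) : superRep ρ σ g x = superMap (ρ g) (σ g) x := rfl

theorem symRep_apply (ρ : Representation F G V) (g : G)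
    (x : SymmetricAlgebra F V) : symRep ρ g x = symMap (ρ g) x := rfl

theorem symRep_mul (ρ : Representation F G V) (g : G)
    (x y : SymmetricAlgebra F V) :
    symRep ρ g (x * y) = symRep ρ g x * symRep ρ g y := by
  simp only [symRep_apply, map_mul]

theorem dual_apply_eq_dualMap (ρ : Representation F G V) (g : G) :
    ρ.dual g = (ρ g⁻¹).dualMap := rfl

theorem inv_comp_self (ρ : Representation F G V) (g : G) : ρ g⁻¹ ∘ₗ ρ g = LinearMap.id := by
  rw [← Module.End.mul_eq_comp, ← map_mul, inv_mul_cancel, map_one]; rfl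

theorem symDiff_equivariant (ρ : Representation F G V) (g : G) (s : SymmetricAlgebra F V)
    (f : SymmetricAlgebra F (Module.Dual F V)) :
    symRep ρ.dual g (symDiff F V s f) = symDiff F V (symRep ρ g s) (symRep ρ.dual g f) := by
  simp only [symRep_apply, dual_apply_eq_dualMap, symDiff_symMap_dualMap, symMap_comp,
    inv_comp_self, symMap_id]

theorem symPairing_equivariant (ρ : Representation F G V) (g : G) (s : SymmetricAlgebra F V)
    (f : SymmetricAlgebra F (Module.Dual F V)) :
    symPairing F V (symRep ρ.dual g f) (symRep ρ g s) = symPairing F V f s := by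
  simp only [symRep_apply, dual_apply_eq_dualMap, symPairing_symMap, symMap_comp,
    inv_comp_self, symMap_id]

theorem superAct_equivariant (ρ : Representation F G V) (σ : Representation F G M) (g : G)
    (a : SuperAlg F V (Module.Dual F M)) (x : SuperAlg F (Module.Dual F V) (Module.Dual F M)) :
    superRep ρ.dual σ.dual g (superAct F V M a x) =
      superAct F V M (superRep ρ σ.dual g a) (superRep ρ.dual σ.dual g x) := by
  induction a using TensorProduct.induction_on with
  | zero => simp
  | add a b ha hb => simp only [map_add, LinearMap.add_apply, ha, hb]
  | tmul s μ =>
    induction x using TensorProduct.induction_on with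
    | zero => simp
    | add x y hx hy => simp only [map_add, hx, hy]
    | tmul f ν =>
      simp only [superAct_tmul, superRep_apply, superMap_tmul, map_mul]
      rw [← symRep_apply ρ.dual, symDiff_equivariant]
      rfl

theorem superMap_mem_superDeg (p : V →ₗ[F] V') (q : M →ₗ[F] M') {i j : ℕ} {x : SuperAlg F V M}
    (hx : x ∈ superDeg F V M i j) : superMap p q x ∈ superDeg F V' M' i j := by
  have h1 : (symDeg F V i).map (symMap p).toLinearMap ≤ symDeg F V' i := by
    rw [symDeg, Submodule.map_pow]
    refine pow_le_pow_left' ?_ i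
    rintro _ ⟨_, ⟨v, rfl⟩, rfl⟩
    exact ⟨p v, by simp⟩
  have h2 : (⋀[F]^j M).map (ExteriorAlgebra.map q).toLinearMap ≤ ⋀[F]^j M' := by
    rw [ExteriorAlgebra.exteriorPower, Submodule.map_pow]
    refine pow_le_pow_left' ?_ j
    rintro _ ⟨_, ⟨v, rfl⟩, rfl⟩
    exact ⟨q v, by simp⟩
  have h3 : superDeg F V M i j ≤ (superDeg F V' M' i j).comap (superMap p q).toLinearMap := by
    refine Submodule.map₂_le.2 fun s hs l hl => ?_
    simp only [TensorProduct.mk_apply, Submodule.mem_comap, AlgHom.toLinearMap_apply,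
      superMap_tmul]
    exact Submodule.apply_mem_map₂ _ (h1 ⟨s, hs, rfl⟩) (h2 ⟨l, hl, rfl⟩)
  exact h3 hx

/-- Equivariant maps send the coinvariant ideal into the coinvariant ideal. -/
theorem superMap_mem_coinvariantIdeal {ρ : Representation F G V} {σ : Representation F G M}
    {ρ' : Representation F G V'} {σ' : Representation F G M'}
    {p : V →ₗ[F] V'} {q : M →ₗ[F] M'} (hp : ∀ g, p ∘ₗ ρ g = ρ' g ∘ₗ p)
    (hq : ∀ g, q ∘ₗ σ g = σ' g ∘ₗ q) {x : SuperAlg F V M} (hx : x ∈ coinvariantIdeal ρ σ) :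
    superMap p q x ∈ coinvariantIdeal ρ' σ' := by
  induction hx using TwoSidedIdeal.span_induction with
  | zero => simp
  | add x y _ _ hx hy => rw [map_add]; exact add_mem hx hy
  | neg x _ hx => rw [map_neg]; exact neg_mem hx
  | left_absorb a x _ hx => rw [map_mul]; exact TwoSidedIdeal.mul_mem_left _ _ _ hx
  | right_absorb a x _ hx => rw [map_mul]; exact TwoSidedIdeal.mul_mem_right _ _ _ hx
  | mem x h =>
    refine TwoSidedIdeal.subset_span ⟨fun g => ?_, ?_⟩
    · rw [superRep_apply, superMap_comp, ← hp, ← hq, ← superMap_comp, ← superRep_apply, h.1 g]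
    · obtain ⟨-, i, j, hij, hx⟩ := h
      exact ⟨i, j, hij, superMap_mem_superDeg p q hx⟩

end Equivariance

/-! ### Integral vectors and positive definite forms -/

section Lattice

variable {F : Type*} [Field F] [CharZero F] {A : Type*} [AddCommGroup A] [Module F A]

/-- Suppose that the family `v` is orthogonal for the bilinear form `β`, with positive integers
as norms. Then a subspace spanned by integral combinations of the `v a` meets its orthogonal
complement trivially: the Gram matrix of a basis consisting of integral vectors is an integral
positive definite matrix, and its determinant remains nonzero in `F`. -/
theorem eq_zero_of_mem_span_of_orthogonal {α : Type*} (v : α → A) (β : A →ₗ[F] A →ₗ[F] F)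
    (w : α → ℕ) (hw : ∀ a, 0 < w a) (hβ : ∀ a, β (v a) (v a) = w a)
    (hβ' : ∀ a a', a ≠ a' → β (v a) (v a') = 0) (Z : Set A)
    (hZ : ∀ z ∈ Z, z ∈ AddSubgroup.closure (Set.range v)) {x : A}
    (hx : x ∈ Submodule.span F Z) (hxZ : ∀ z ∈ Z, β x z = 0) : x = 0 := by
  classical
  let lc : (α →₀ ℤ) →+ A := Finsupp.liftAddHom fun a => (zmultiplesHom A (v a))
  have hlc : ∀ z ∈ Z, ∃ n, lc n = z := by
    intro z hz
    have h : AddSubgroup.closure (Set.range v) ≤ lc.range := by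
      rw [AddSubgroup.closure_le]
      rintro _ ⟨a, rfl⟩
      exact ⟨Finsupp.single a 1, by simp [lc]⟩
    exact h (hZ z hz)
  let gram : (α →₀ ℤ) → (α →₀ ℤ) → ℤ := fun m n => m.sum fun a k => k * n a * w a
  have hva : ∀ (a : α) (n : α →₀ ℤ), β (v a) (lc n) = (n a * w a : ℤ) := by
    intro a n
    induction n using Finsupp.induction_linear with
    | zero => simp
    | add f g hf hg => simp [hf, hg, add_mul]
    | single b k =>
      by_cases hab : a = b
      · subst hab; simp [lc, hβ]
      · simp [lc, hβ' a b hab, hab]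
  have hgram : ∀ m n, β (lc m) (lc n) = (gram m n : F) := by
    intro m n
    simp only [gram, Finsupp.sum]
    rw [Finsupp.liftAddHom_apply, Finsupp.sum, map_sum, LinearMap.sum_apply, Int.cast_sum]
    refine Finset.sum_congr rfl fun a _ => ?_
    have h1 : (zmultiplesHom A (v a)) (m a) = ((m a : ℤ) : F) • v a := by
      simp [Int.cast_smul_eq_zsmul]
    rw [h1, map_smul, LinearMap.smul_apply, hva]
    push_cast
    simp [mul_assoc]
  have hpos : ∀ n, β (lc n) (lc n) = 0 → lc n = 0 := by
    intro n hn
    rw [hgram] at hn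
    have h0 : gram n n = 0 := by exact_mod_cast hn
    have : n = 0 := by
      by_contra hne
      have : 0 < gram n n := by
        refine Finset.sum_pos (fun a ha => ?_) (Finsupp.support_nonempty_iff.2 hne)
        have h1 : n a ≠ 0 := Finsupp.mem_support_iff.1 ha
        have h2 : (0 : ℤ) < w a := by exact_mod_cast hw a
        have h3 : 0 < n a * n a := mul_self_pos.2 h1
        exact mul_pos h3 h2
      omega
    simp [this]
  obtain ⟨Y, hYZ, hYspan, hYind⟩ := exists_linearIndependent F Z
  rw [← hYspan] at hx
  obtain ⟨T, hTY, hxT⟩ := Submodule.mem_span_finite_of_mem_span hx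
  obtain ⟨c, -, hc⟩ := Submodule.mem_span_finset.1 hxT
  have hTind : LinearIndependent F (fun t : T => (t : A)) :=
    hYind.comp (fun t : T => (⟨t, hTY t.2⟩ : Y)) fun t t' h =>
      Subtype.ext (congrArg (fun y : Y => (y : A)) h)
  have hTZ : ∀ t : T, (t : A) ∈ Z := fun t => hYZ (hTY t.2)
  choose n hn using fun t : T => hlc t (hTZ t)
  let Gm : Matrix T T ℤ := Matrix.of fun s t => gram (n s) (n t)
  have hGm : ∀ s t : T, β (s : A) (t : A) = (Gm s t : F) := fun s t => by
    rw [← hn s, ← hn t, hgram]; rfl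
  have hdet : Gm.det ≠ 0 := by
    intro h0
    obtain ⟨u, hu0, hu⟩ := Matrix.exists_vecMul_eq_zero_iff.2 h0
    apply hu0
    have h1 : lc (∑ t, u t • n t) = ∑ t, (u t : F) • (t : A) := by
      simp [map_sum, hn, Int.cast_smul_eq_zsmul]
    have h2 : lc (∑ t, u t • n t) = 0 := by
      apply hpos
      rw [h1]
      simp only [map_sum, map_smul, LinearMap.sum_apply, LinearMap.smul_apply, hGm, smul_eq_mul]
      refine Finset.sum_eq_zero fun s _ => mul_eq_zero_of_right _ ?_
      have h3 := congrFun hu s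
      simp only [Matrix.vecMul, dotProduct, Pi.zero_apply] at h3
      exact_mod_cast congrArg (Int.cast : ℤ → F) h3
    rw [h1] at h2
    have h5 := Fintype.linearIndependent_iff.1 hTind _ h2
    funext t
    exact_mod_cast h5 t
  have hdetF : (Gm.map (Int.cast : ℤ → F)).det ≠ 0 := by
    have : (Gm.map (Int.cast : ℤ → F)).det = (Gm.det : F) := by
      simpa using (RingHom.map_det (Int.castRingHom F) Gm).symm
    rw [this]
    exact_mod_cast hdet
  have hx' : x = ∑ t : T, c t • (t : A) := by
    rw [← hc, ← Finset.sum_coe_sort]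
  have hvec : Matrix.vecMul (fun t : T => c t) (Gm.map (Int.cast : ℤ → F)) = 0 := by
    funext t
    have h1 := hxZ t (hTZ t)
    rw [hx'] at h1
    simpa [Matrix.vecMul, dotProduct, hGm] using h1
  have hc0 := Matrix.eq_zero_of_vecMul_eq_zero hdetF hvec
  rw [hx']
  refine Finset.sum_eq_zero fun t _ => ?_
  rw [show c t = 0 from congrFun hc0 t, zero_smul]

end Lattice

/-! ### Monomial bases -/

section Monomials

variable {F : Type*} [Field F]
variable {V : Type*} [AddCommGroup V] [Module F V]
variable {M : Type*} [AddCommGroup M] [Module F M]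
variable {κ : Type*} [Finite κ] [DecidableEq κ] (b : Module.Basis κ F V)
variable {τ : Type*} [Finite τ] [LinearOrder τ] (c : Module.Basis τ F M)

theorem symmetricAlgebra_basis_single {κ : Type*} (b : Module.Basis κ F V) (i : κ) :
    b.symmetricAlgebra (Finsupp.single i 1) = SymmetricAlgebra.ι F V (b i) := by
  rw [← SymmetricAlgebra.equivMvPolynomial_symm_X]
  simp [Module.Basis.symmetricAlgebra, MvPolynomial.X]

theorem symmetricAlgebra_basis_add {κ : Type*} (b : Module.Basis κ F V) (α β : κ →₀ ℕ) :
    b.symmetricAlgebra (α + β) = b.symmetricAlgebra α * b.symmetricAlgebra β := by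
  simp [Module.Basis.symmetricAlgebra, ← map_mul, MvPolynomial.monomial_mul]

theorem symmetricAlgebra_basis_zero {κ : Type*} (b : Module.Basis κ F V) :
    b.symmetricAlgebra 0 = 1 := by
  simp [Module.Basis.symmetricAlgebra]

theorem partialV_leibniz (v : V) (f g : SymmetricAlgebra F (Module.Dual F V)) :
    partialV F V v (f * g) = f * partialV F V v g + g * partialV F V v f := by
  simp only [partialV_apply, Derivation.leibniz, smul_eq_mul]

theorem partialV_basis (i : κ) (α : κ →₀ ℕ) :
    partialV F V (b i) (b.dualBasis.symmetricAlgebra α) =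
      (α i : F) • b.dualBasis.symmetricAlgebra (α - Finsupp.single i 1) := by
  induction α using Finsupp.induction_linear with
  | zero => simp [symmetricAlgebra_basis_zero, partialV_apply]
  | single j n =>
    induction n with
    | zero => simp [symmetricAlgebra_basis_zero, partialV_apply]
    | succ n ih =>
      rw [Finsupp.single_add, symmetricAlgebra_basis_add, partialV_leibniz, ih,
        symmetricAlgebra_basis_single]
      by_cases hij : j = i
      · subst hij
        rcases n with _ | n
        · simp [symmetricAlgebra_basis_zero, partialV_apply, Algebra.algebraMap_eq_smul_one]
        · have h1 : Finsupp.single j (n + 1) - Finsupp.single j 1 = Finsupp.single j n := by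
            ext k; by_cases hk : j = k <;> simp [hk]
          have h2 : Finsupp.single j (n + 1) + Finsupp.single j 1 - Finsupp.single j 1 =
            Finsupp.single j (n + 1) := by simp
          have h3 : b.dualBasis.symmetricAlgebra (Finsupp.single j (n + 1)) =
              SymmetricAlgebra.ι F _ (b.dualBasis j) *
                b.dualBasis.symmetricAlgebra (Finsupp.single j n) := by
            rw [Finsupp.single_add, symmetricAlgebra_basis_add, symmetricAlgebra_basis_single,
              mul_comm]
          rw [h2, h1, h3, partialV_apply]
          simp only [symDeriv_ι, Module.Dual.eval_apply, Module.Basis.dualBasis_apply_self,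
            Finsupp.single_eq_same, if_true, map_one, Finsupp.coe_add, Pi.add_apply, mul_one, Nat.cast_add, Nat.cast_one,
            mul_smul_comm]
          module
      · simp [hij, partialV_apply, Ne.symm hij]
  | add α β ha hb =>
    rw [symmetricAlgebra_basis_add, partialV_leibniz, ha, hb]
    have key : ∀ α β : κ →₀ ℕ, b.dualBasis.symmetricAlgebra β *
        ((α i : F) • b.dualBasis.symmetricAlgebra (α - Finsupp.single i 1)) =
        (α i : F) • b.dualBasis.symmetricAlgebra (α + β - Finsupp.single i 1) := by
      intro α β
      rcases Nat.eq_zero_or_pos (α i) with h | h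
      · simp [h]
      · rw [mul_smul_comm, ← symmetricAlgebra_basis_add]
        congr 2
        ext k
        by_cases hk : i = k
        · subst hk; simp; omega
        · simp [hk]; omega
    rw [key, key, add_comm β α, ← add_smul, add_comm (β i : F)]
    simp

/-- The monomials in a basis and in the dual basis are orthogonal for the pairing. -/
theorem symPairing_basis (α β : κ →₀ ℕ) :
    symPairing F V (b.dualBasis.symmetricAlgebra α) (b.symmetricAlgebra β) =
      if α = β then ((β.prod fun _ n => n.factorial : ℕ) : F) else 0 := by
  induction hd : β.degree generalizing α β with
  | zero =>
    obtain rfl : β = 0 := by simpa [Finsupp.degree_eq_zero_iff] using hd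
    rw [symmetricAlgebra_basis_zero]
    by_cases hα : α = 0
    · subst hα; simp [symmetricAlgebra_basis_zero, symPairing_apply]
    · obtain ⟨i, hi⟩ := Finsupp.ne_iff.1 hα
      have h1 : α = Finsupp.single i 1 + (α - Finsupp.single i 1) := by
        ext k
        by_cases hk : i = k
        · subst hk; simp at hi ⊢; omega
        · simp [hk]
      rw [if_neg hα, h1, symmetricAlgebra_basis_add, symmetricAlgebra_basis_single]
      simp [symPairing_apply, SymmetricAlgebra.algebraMapInv_ι]
  | succ d ih =>
    have hβ : β ≠ 0 := by rintro rfl; simp at hd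
    obtain ⟨i, hi⟩ := Finsupp.ne_iff.1 hβ
    simp only [Finsupp.coe_zero, Pi.zero_apply] at hi
    obtain ⟨γ, rfl⟩ : ∃ γ, β = Finsupp.single i 1 + γ := by
      refine ⟨β - Finsupp.single i 1, ?_⟩
      ext k
      by_cases hk : i = k
      · subst hk; simp; omega
      · simp [hk]
    have hγ : γ.degree = d := by simp at hd; omega
    rw [symmetricAlgebra_basis_add, symmetricAlgebra_basis_single, symPairing_ι_mul,
      partialV_basis, map_smul, LinearMap.smul_apply, ih _ _ hγ]
    rcases Nat.eq_zero_or_pos (α i) with h | h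
    · have : α ≠ Finsupp.single i 1 + γ := by
        rintro rfl; simp at h
      simp [h, this]
    · have hα : α = Finsupp.single i 1 + (α - Finsupp.single i 1) := by
        ext k
        by_cases hk : i = k
        · subst hk; simp; omega
        · simp [hk]
      by_cases heq : α - Finsupp.single i 1 = γ
      · have hα' : α = Finsupp.single i 1 + γ := by rw [← heq]; exact hα
        rw [if_pos heq, if_pos hα', hα']
        have : ((Finsupp.single i 1 + γ).prod fun _ n => n.factorial) =
            (γ i + 1) * γ.prod fun _ n => n.factorial := by
          have := Fintype.ofFinite κ
          rw [Finsupp.prod_fintype _ _ (by simp), Finsupp.prod_fintype _ _ (by simp),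
            ← Finset.mul_prod_erase _ _ (Finset.mem_univ i),
            ← Finset.mul_prod_erase _ _ (Finset.mem_univ i), ← mul_assoc]
          congr 1
          · simp [add_comm 1, Nat.factorial_succ]
          · refine Finset.prod_congr rfl fun j hj => ?_
            have : i ≠ j := (Finset.ne_of_mem_erase hj).symm
            simp [this]
        rw [this]
        push_cast
        simp [add_comm]
      · have : α ≠ Finsupp.single i 1 + γ := by
          rintro rfl; simp at heq
        simp [heq, this]

theorem extBasis_apply {τ : Type*} [LinearOrder τ] (c : Module.Basis τ F M) (I : Finset τ) :
    c.ExteriorAlgebra I =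
      ExteriorAlgebra.ιMulti F I.card (fun k => c (I.orderEmbOfFin rfl k)) := by
  rw [ExteriorAlgebra.basis_apply]
  rfl

theorem extPairing_basis (I J : Finset τ) :
    extPairing F M (c.dualBasis.ExteriorAlgebra I) (c.ExteriorAlgebra J) =
      if I = J then 1 else 0 := by
  rw [extBasis_apply, extBasis_apply]
  by_cases hc : I.card = J.card
  · by_cases hIJ : I = J
    · subst hIJ
      rw [extPairing_ιMulti, if_pos rfl]
      convert Matrix.det_one (n := Fin I.card) (R := F)
      ext i j
      simp [Matrix.one_apply, Finsupp.single_apply, eq_comm]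
    · rw [if_neg hIJ]
      obtain ⟨t, htI, htJ⟩ : ∃ t ∈ I, t ∉ J := by
        by_contra! h
        exact hIJ (Finset.eq_of_subset_of_card_le h hc.ge)
      have h1 : ExteriorAlgebra.ιMulti F J.card (fun k => c (J.orderEmbOfFin rfl k)) =
          ExteriorAlgebra.ιMulti F I.card (fun k => c (J.orderEmbOfFin hc.symm k)) := by
        have : ∀ n (h : J.card = n),
            ExteriorAlgebra.ιMulti F J.card (fun k => c (J.orderEmbOfFin rfl k)) =
            ExteriorAlgebra.ιMulti F n (fun k => c (J.orderEmbOfFin h k)) := by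
          rintro n rfl; rfl
        exact this _ _
      rw [h1, extPairing_ιMulti]
      obtain ⟨i, hi⟩ : ∃ i, I.orderEmbOfFin rfl i = t := by
        have : t ∈ Set.range (I.orderEmbOfFin rfl) := by simpa using htI
        exact this
      refine Matrix.det_eq_zero_of_row_eq_zero i fun j => ?_
      simp only [Matrix.of_apply, hi, Module.Basis.dualBasis_apply_self]
      refine if_neg fun h => htJ ?_
      rw [← h]
      exact Finset.orderEmbOfFin_mem _ _ _
  · rw [if_neg fun h => hc (by rw [h]), extPairing_ιMulti_of_ne F M hc]

theorem extPairing_ιMulti_dualBasis {r : ℕ} (b : Module.Basis (Fin r) F M) :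
    extPairing F M (ExteriorAlgebra.ιMulti F r b.dualBasis) (ExteriorAlgebra.ιMulti F r b) = 1 := by
  rw [extPairing_ιMulti]
  convert Matrix.det_one (n := Fin r) (R := F)
  ext i j
  simp [Matrix.one_apply, Finsupp.single_apply, eq_comm]

/-- The basis of `S(V) ⊗ ∧M` consisting of the monomials in a basis of `V` and a basis of `M`. -/
def superBasis {κ τ : Type*} [LinearOrder τ] (b : Module.Basis κ F V) (c : Module.Basis τ F M) :
    Module.Basis ((κ →₀ ℕ) × Finset τ) F (SuperAlg F V M) :=
  b.symmetricAlgebra.tensorProduct c.ExteriorAlgebra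

theorem superPairing_basis (x y : (κ →₀ ℕ) × Finset τ) :
    superPairing F V M (superBasis b.dualBasis c.dualBasis x) (superBasis b c y) =
      if x = y then ((y.1.prod fun _ n => n.factorial : ℕ) : F) else 0 := by
  obtain ⟨α, I⟩ := x
  obtain ⟨β, J⟩ := y
  simp only [superBasis, Module.Basis.tensorProduct_apply, superPairing_tmul, symPairing_basis,
    extPairing_basis, Prod.mk.injEq]
  by_cases h1 : α = β <;> by_cases h2 : I = J <;> simp [h1, h2]

end Monomials

/-! ### Harmonic elements and the coinvariant ideal intersect trivially -/

section IntegralForm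

variable {F : Type*} [Field F]
variable {V : Type*} [AddCommGroup V] [Module F V]
variable {M : Type*} [AddCommGroup M] [Module F M]
variable {V' : Type*} [AddCommGroup V'] [Module F V']
variable {M' : Type*} [AddCommGroup M'] [Module F M']
variable {κ : Type*} (b : Module.Basis κ F V)
variable {τ : Type*} (c : Module.Basis τ F M)

/-- The integral form of `S(V) ⊗ ∧M`: the subring generated by a basis of `V` and a basis
of `M`. -/
def integralForm : Subring (SuperAlg F V M) :=
  Subring.closure (Set.range (fun i => SymmetricAlgebra.ι F V (b i) ⊗ₜ[F] 1) ∪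
    Set.range (fun j => 1 ⊗ₜ[F] ExteriorAlgebra.ι F (c j)))

theorem ι_tmul_one_mem_integralForm (i : κ) :
    SymmetricAlgebra.ι F V (b i) ⊗ₜ[F] 1 ∈ integralForm b c :=
  Subring.subset_closure (Or.inl ⟨i, rfl⟩)

theorem one_tmul_ι_mem_integralForm (j : τ) :
    1 ⊗ₜ[F] ExteriorAlgebra.ι F (c j) ∈ integralForm b c :=
  Subring.subset_closure (Or.inr ⟨j, rfl⟩)

theorem extBasis_singleton [LinearOrder τ] (j : τ) :
    c.ExteriorAlgebra {j} = ExteriorAlgebra.ι F (c j) := by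
  have : ∀ n (h : ({j} : Finset τ).card = n) (hn : n = 1),
      ExteriorAlgebra.ιMulti F n (fun k => c (Finset.orderEmbOfFin {j} h k)) =
        ExteriorAlgebra.ι F (c j) := by
    rintro n h rfl
    rw [ExteriorAlgebra.ιMulti_apply]
    simp
  rw [extBasis_apply]
  exact this _ rfl (Finset.card_singleton j)

theorem extBasis_empty [LinearOrder τ] : c.ExteriorAlgebra ∅ = 1 := by
  rw [extBasis_apply]
  exact ExteriorAlgebra.ιMulti_zero_apply _

theorem extBasis_mul [LinearOrder τ] (I J : Finset τ) :
    c.ExteriorAlgebra I * c.ExteriorAlgebra J = 0 ∨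
      ∃ ε : ℤˣ, c.ExteriorAlgebra I * c.ExteriorAlgebra J = ε • c.ExteriorAlgebra (I ∪ J) := by
  let s : Set.powersetCard τ I.card := ⟨I, rfl⟩
  let t : Set.powersetCard τ J.card := ⟨J, rfl⟩
  by_cases h : Disjoint I J
  · exact Or.inr ⟨_, (ExteriorAlgebra.basis_mul_of_disjoint c s t h).trans
      (by congr 2; simp [Set.powersetCard.disjUnion, s, t])⟩
  · exact Or.inl (ExteriorAlgebra.basis_mul_of_not_disjoint c s t h)

theorem mul_mem_addSubgroup_closure {A : Type*} [Ring A] {s : Set A}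
    (hmul : ∀ x ∈ s, ∀ y ∈ s, x * y ∈ AddSubgroup.closure s) {x y : A}
    (hx : x ∈ AddSubgroup.closure s) (hy : y ∈ AddSubgroup.closure s) :
    x * y ∈ AddSubgroup.closure s := by
  induction hx, hy using AddSubgroup.closure_induction₂ with
  | mem x y hx hy => exact hmul x hx y hy
  | zero_left y _ => rw [zero_mul]; exact zero_mem _
  | zero_right x _ => rw [mul_zero]; exact zero_mem _
  | add_left x y z _ _ _ h h' => rw [add_mul]; exact add_mem h h'
  | add_right x y z _ _ _ h h' => rw [mul_add]; exact add_mem h h'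
  | neg_left x y _ _ h => rw [neg_mul]; exact neg_mem h
  | neg_right x y _ _ h => rw [mul_neg]; exact neg_mem h

/-- Integral elements are integral combinations of monomials. -/
theorem mem_closure_superBasis_of_mem_integralForm [LinearOrder τ] {x : SuperAlg F V M}
    (hx : x ∈ integralForm b c) : x ∈ AddSubgroup.closure (Set.range (superBasis b c)) := by
  have hb : ∀ α I, b.symmetricAlgebra α ⊗ₜ[F] c.ExteriorAlgebra I ∈
      AddSubgroup.closure (Set.range (superBasis b c)) := fun α I =>
    AddSubgroup.subset_closure ⟨(α, I), by simp [superBasis]⟩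
  have hmul : ∀ x ∈ Set.range (superBasis b c), ∀ y ∈ Set.range (superBasis b c),
      x * y ∈ AddSubgroup.closure (Set.range (superBasis b c)) := by
    rintro _ ⟨⟨α, I⟩, rfl⟩ _ ⟨⟨β, J⟩, rfl⟩
    simp only [superBasis, Module.Basis.tensorProduct_apply, Algebra.TensorProduct.tmul_mul_tmul,
      ← symmetricAlgebra_basis_add]
    obtain h | ⟨ε, h⟩ := extBasis_mul c I J
    · rw [h, TensorProduct.tmul_zero]; exact zero_mem _
    · rw [h]
      obtain rfl | rfl := Int.units_eq_one_or ε
      · rw [one_smul]; exact hb _ _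
      · rw [Units.neg_smul, one_smul, TensorProduct.tmul_neg]; exact neg_mem (hb _ _)
  induction hx using Subring.closure_induction with
  | mem x hx =>
    obtain ⟨i, rfl⟩ | ⟨j, rfl⟩ := hx
    · have := hb (Finsupp.single i 1) ∅
      rwa [extBasis_empty, symmetricAlgebra_basis_single] at this
    · have := hb 0 {j}
      rwa [extBasis_singleton, symmetricAlgebra_basis_zero] at this
  | zero => exact zero_mem _
  | one =>
    have := hb 0 ∅
    rwa [extBasis_empty, symmetricAlgebra_basis_zero] at this
  | add x y _ _ hx hy => exact add_mem hx hy
  | neg x _ hx => exact neg_mem hx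
  | mul x y _ _ hx hy =>
    exact mul_mem_addSubgroup_closure hmul hx hy

open scoped Pointwise in
theorem pow_subset_submonoid {A : Type*} [Monoid A] {s : Set A} {S : Submonoid A} (h : s ⊆ S)
    (n : ℕ) : s ^ n ⊆ S := by
  induction n with
  | zero => simp
  | succ n ih =>
    rw [pow_succ]
    rintro _ ⟨x, hx, y, hy, rfl⟩
    exact S.mul_mem (ih hx) (h hy)

open scoped Pointwise in
theorem superDeg_le_span_integralForm (i j : ℕ) :
    superDeg F V M i j ≤
      Submodule.span F {x | x ∈ integralForm b c ∧ x ∈ superDeg F V M i j} := by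
  have h1 : symDeg F V i = Submodule.span F (Set.range (SymmetricAlgebra.ι F V ∘ b) ^ i) := by
    rw [symDeg, ← Submodule.span_pow, Set.range_comp, Submodule.span_image, b.span_eq,
      Submodule.map_top]
  have h2 : ⋀[F]^j M = Submodule.span F (Set.range (ExteriorAlgebra.ι F ∘ c) ^ j) := by
    rw [ExteriorAlgebra.exteriorPower, ← Submodule.span_pow, Set.range_comp, Submodule.span_image,
      c.span_eq, Submodule.map_top]
  have h3 : superDeg F V M i j = Submodule.span F (Set.image2 (fun s l => s ⊗ₜ[F] l)
      (Set.range (SymmetricAlgebra.ι F V ∘ b) ^ i)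
      (Set.range (ExteriorAlgebra.ι F ∘ c) ^ j)) := by
    rw [superDeg, h1, h2, Submodule.map₂_span_span]
    rfl
  conv_lhs => rw [h3]
  refine Submodule.span_mono ?_
  rintro _ ⟨s, hs, l, hl, rfl⟩
  refine ⟨?_, by rw [h3]; exact Submodule.subset_span ⟨s, hs, l, hl, rfl⟩⟩
  have hs' : s ∈ (integralForm b c).toSubmonoid.comap
      (Algebra.TensorProduct.includeLeft : _ →ₐ[F] SuperAlg F V M) := by
    refine pow_subset_submonoid ?_ i hs
    rintro _ ⟨k, rfl⟩
    exact ι_tmul_one_mem_integralForm b c k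
  have hl' : l ∈ (integralForm b c).toSubmonoid.comap
      (Algebra.TensorProduct.includeRight : _ →ₐ[F] SuperAlg F V M) := by
    refine pow_subset_submonoid ?_ j hl
    rintro _ ⟨k, rfl⟩
    exact one_tmul_ι_mem_integralForm b c k
  have := (integralForm b c).mul_mem hs' hl'
  simpa using this

theorem symmetricAlgebra_basis_mem_symDeg (α : κ →₀ ℕ) :
    b.symmetricAlgebra α ∈ symDeg F V α.degree := by
  induction α using Finsupp.induction_linear with
  | zero => simp [symmetricAlgebra_basis_zero, symDeg]
  | single i n =>
    induction n with
    | zero => simp [symmetricAlgebra_basis_zero, symDeg]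
    | succ n ih =>
      rw [Finsupp.single_add, symmetricAlgebra_basis_add, map_add, symDeg, pow_add]
      refine Submodule.mul_mem_mul ih ?_
      rw [symmetricAlgebra_basis_single, Finsupp.degree_single, pow_one]
      exact ⟨_, rfl⟩
  | add α β hα hβ =>
    rw [symmetricAlgebra_basis_add, map_add, symDeg, pow_add]
    exact Submodule.mul_mem_mul hα hβ

theorem extBasis_mem_exteriorPower [LinearOrder τ] (I : Finset τ) :
    c.ExteriorAlgebra I ∈ ⋀[F]^I.card M := by
  rw [extBasis_apply]
  exact ExteriorAlgebra.ιMulti_range F _ ⟨_, rfl⟩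

theorem span_integralForm : Submodule.span F (integralForm b c : Set (SuperAlg F V M)) = ⊤ := by
  classical
  let := WellOrderingRel.isWellOrder.linearOrder (α := τ)
  rw [eq_top_iff, ← (superBasis b c).span_eq, Submodule.span_le]
  rintro _ ⟨⟨α, I⟩, rfl⟩
  have h : superBasis b c (α, I) ∈ superDeg F V M α.degree I.card := by
    simp only [superBasis, Module.Basis.tensorProduct_apply]
    exact Submodule.apply_mem_map₂ _ (symmetricAlgebra_basis_mem_symDeg b α)
      (extBasis_mem_exteriorPower c I)
  exact Submodule.span_mono (fun x hx => hx.1) (superDeg_le_span_integralForm b c _ _ h)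

theorem superMap_mem_integralForm {κ' τ' : Type*} {b : Module.Basis κ F V}
    {c : Module.Basis τ F M} {b' : Module.Basis κ' F V'} {c' : Module.Basis τ' F M'}
    {p : V →ₗ[F] V'} {q : M →ₗ[F] M'} {e : κ → κ'} {e' : τ → τ'} (hp : ∀ i, p (b i) = b' (e i))
    (hq : ∀ j, q (c j) = c' (e' j)) {x : SuperAlg F V M} (hx : x ∈ integralForm b c) :
    superMap p q x ∈ integralForm b' c' := by
  have : integralForm b c ≤ (integralForm b' c').comap (superMap p q : _ →+* SuperAlg F V' M') := by
    refine Subring.closure_le.2 ?_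
    rintro _ (⟨i, rfl⟩ | ⟨j, rfl⟩)
    · simpa [hp] using ι_tmul_one_mem_integralForm b' c' (e i)
    · simpa [hq] using one_tmul_ι_mem_integralForm b' c' (e' j)
  exact this hx

theorem symMap_symmetricAlgebra_basis {b' : Module.Basis κ F V'} {p : V →ₗ[F] V'}
    {b : Module.Basis κ F V} (hp : ∀ i, p (b i) = b' i) (α : κ →₀ ℕ) :
    symMap p (b.symmetricAlgebra α) = b'.symmetricAlgebra α := by
  induction α using Finsupp.induction_linear with
  | zero => simp [symmetricAlgebra_basis_zero]
  | single i n =>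
    induction n with
    | zero => simp [symmetricAlgebra_basis_zero]
    | succ n ih =>
      simp only [Finsupp.single_add, symmetricAlgebra_basis_add, map_mul, ih,
        symmetricAlgebra_basis_single, symMap_ι, hp]
  | add α β hα hβ => simp only [symmetricAlgebra_basis_add, map_mul, hα, hβ]

theorem superMap_superBasis [LinearOrder τ] {b : Module.Basis κ F V} {c : Module.Basis τ F M}
    {b' : Module.Basis κ F V'} {c' : Module.Basis τ F M'} {p : V →ₗ[F] V'} {q : M →ₗ[F] M'}
    (hp : ∀ i, p (b i) = b' i) (hq : ∀ j, q (c j) = c' j) (a : (κ →₀ ℕ) × Finset τ) :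
    superMap p q (superBasis b c a) = superBasis b' c' a := by
  simp only [superBasis, Module.Basis.tensorProduct_apply', superMap_tmul,
    symMap_symmetricAlgebra_basis hp]
  congr 1
  rw [extBasis_apply, extBasis_apply, ExteriorAlgebra.map_apply_ιMulti]
  congr 1
  funext k
  exact hq _

end IntegralForm

section Permutation

variable {F : Type*} [Field F] [CharZero F] {G : Type*} [Group G] [Finite G]
variable {V : Type*} [AddCommGroup V] [Module F V]
variable {M : Type*} [AddCommGroup M] [Module F M]

/-- The coinvariant ideal is spanned by integral elements if the group permutes bases. -/
theorem coinvariantIdeal_le_span {κ τ : Type*} {b : Module.Basis κ F V} {c : Module.Basis τ F M}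
    {ρ : Representation F G V} {σ : Representation F G M} {e : G → κ → κ} {e' : G → τ → τ}
    (hρ : ∀ g i, ρ g (b i) = b (e g i)) (hσ : ∀ g j, σ g (c j) = c (e' g j))
    {x : SuperAlg F V M} (hx : x ∈ coinvariantIdeal ρ σ) :
    x ∈ Submodule.span F {z | z ∈ coinvariantIdeal ρ σ ∧ z ∈ integralForm b c} := by
  have := Fintype.ofFinite G
  set Z := {z | z ∈ coinvariantIdeal ρ σ ∧ z ∈ integralForm b c} with hZ
  have htop := span_integralForm b c
  induction hx using TwoSidedIdeal.span_induction with
  | zero => exact zero_mem _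
  | add x y _ _ hx hy => exact add_mem hx hy
  | neg x _ hx => exact neg_mem hx
  | left_absorb a x _ hx =>
    have ha : a ∈ Submodule.span F (integralForm b c : Set (SuperAlg F V M)) := by
      rw [htop]; trivial
    have := Submodule.mul_mem_mul ha hx
    rw [Submodule.span_mul_span] at this
    refine Submodule.span_mono ?_ this
    rintro _ ⟨y, hy, z, hz, rfl⟩
    exact ⟨TwoSidedIdeal.mul_mem_left _ _ _ hz.1, mul_mem hy hz.2⟩
  | right_absorb a x _ hx =>
    have ha : a ∈ Submodule.span F (integralForm b c : Set (SuperAlg F V M)) := by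
      rw [htop]; trivial
    have := Submodule.mul_mem_mul hx ha
    rw [Submodule.span_mul_span] at this
    refine Submodule.span_mono ?_ this
    rintro _ ⟨y, hy, z, hz, rfl⟩
    exact ⟨TwoSidedIdeal.mul_mem_right _ _ _ hy.1, mul_mem hy.2 hz⟩
  | mem x hx =>
    obtain ⟨hinv, i, j, hij, hx⟩ := hx
    let N : SuperAlg F V M →ₗ[F] SuperAlg F V M := ∑ g, superRep ρ σ g
    have hN : ∀ y, N y = ∑ g, superRep ρ σ g y := fun y => by simp [N]
    have h1 : N x = (Fintype.card G : F) • x := by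
      rw [hN, Finset.sum_congr rfl fun g _ => hinv g]
      simp [Nat.cast_smul_eq_nsmul]
    have h2 : N x ∈ Submodule.span F Z := by
      have := Submodule.mem_map_of_mem (f := N) (superDeg_le_span_integralForm b c i j hx)
      rw [Submodule.map_span] at this
      refine Submodule.span_mono ?_ this
      rintro _ ⟨y, ⟨hy, hydeg⟩, rfl⟩
      rw [hN]
      refine ⟨TwoSidedIdeal.subset_span ⟨fun g => ?_, i, j, hij, ?_⟩, ?_⟩
      · rw [map_sum]
        refine Fintype.sum_equiv (Equiv.mulLeft g) _ _ fun h => ?_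
        simp
      · exact sum_mem fun g _ => superMap_mem_superDeg _ _ hydeg
      · exact sum_mem fun g _ => superMap_mem_integralForm (hρ g) (hσ g) hy
    rw [h1] at h2
    exact (Submodule.smul_mem_iff _ (Nat.cast_ne_zero.2 Fintype.card_ne_zero)).1 h2

omit [CharZero F] [Finite G] in
theorem dual_apply_dualBasis {κ : Type*} [Finite κ] [DecidableEq κ] (b : Module.Basis κ F V)
    (ρ : Representation F G V) {e : G → κ → κ} (hρ : ∀ g i, ρ g (b i) = b (e g i)) (g : G) (i : κ) :
    ρ.dual g (b.dualBasis i) = b.dualBasis (e g i) := by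
  have he : ∀ j, e g (e g⁻¹ j) = j := fun j => b.injective (by
    rw [← hρ, ← hρ, ← Module.End.mul_apply, ← map_mul]; simp)
  have he' : ∀ j, e g⁻¹ (e g j) = j := fun j => b.injective (by
    rw [← hρ, ← hρ, ← Module.End.mul_apply, ← map_mul]; simp)
  refine b.ext fun j => ?_
  rw [dual_apply_eq_dualMap, LinearMap.dualMap_apply, hρ, Module.Basis.dualBasis_apply_self,
    Module.Basis.dualBasis_apply_self]
  refine if_congr ⟨fun h => ?_, fun h => ?_⟩ rfl rfl
  · rw [← h, he]
  · rw [h, he']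

theorem harmonics_inf_coinvariantIdeal_of_permutation {κ τ : Type*} [Finite κ] [Finite τ]
    {b : Module.Basis κ F V} {c : Module.Basis τ F M}
    {ρ : Representation F G V} {σ : Representation F G M} {e : G → κ → κ} {e' : G → τ → τ}
    (hρ : ∀ g i, ρ g (b i) = b (e g i)) (hσ : ∀ g j, σ g (c j) = c (e' g j))
    {x : SuperAlg F (Module.Dual F V) (Module.Dual F M)} (hx : x ∈ harmonics ρ σ)
    (hx' : x ∈ coinvariantIdeal ρ.dual σ.dual) : x = 0 := by
  classical
  let := WellOrderingRel.isWellOrder.linearOrder (α := τ)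
  have hρd := dual_apply_dualBasis b ρ hρ
  have hσd := dual_apply_dualBasis c σ hσ
  let p : Module.Dual F V →ₗ[F] V := (b.dualBasis.equiv b (Equiv.refl κ)).toLinearMap
  let q : Module.Dual F M →ₗ[F] M := (c.dualBasis.equiv c (Equiv.refl τ)).toLinearMap
  have hp : ∀ i, p (b.dualBasis i) = b i := fun i => by
    simp only [p, LinearEquiv.coe_coe, Module.Basis.equiv_apply, Equiv.refl_apply]
  have hq : ∀ i, q (c.dualBasis i) = c i := fun i => by
    simp only [q, LinearEquiv.coe_coe, Module.Basis.equiv_apply, Equiv.refl_apply]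
  have hpe : ∀ g, p ∘ₗ ρ.dual g = ρ g ∘ₗ p := fun g => b.dualBasis.ext fun i => by
    rw [LinearMap.comp_apply, LinearMap.comp_apply, hρd, hp, hp, hρ]
  have hqe : ∀ g, q ∘ₗ σ.dual g = σ g ∘ₗ q := fun g => c.dualBasis.ext fun i => by
    rw [LinearMap.comp_apply, LinearMap.comp_apply, hσd, hq, hq, hσ]
  refine eq_zero_of_mem_span_of_orthogonal (superBasis b.dualBasis c.dualBasis)
    ((superPairing F V M).compl₂ (superMap p q).toLinearMap)
    (fun a => a.1.prod fun _ n => n.factorial)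
    (fun a => Finset.prod_pos fun _ _ => Nat.factorial_pos _) (fun a => ?_) (fun a a' h => ?_) _
    (fun z hz => mem_closure_superBasis_of_mem_integralForm b.dualBasis c.dualBasis hz.2)
    (coinvariantIdeal_le_span hρd hσd hx') (fun z hz => ?_)
  · rw [LinearMap.compl₂_apply, AlgHom.toLinearMap_apply, superMap_superBasis hp hq,
      superPairing_basis, if_pos rfl]
  · rw [LinearMap.compl₂_apply, AlgHom.toLinearMap_apply, superMap_superBasis hp hq,
      superPairing_basis, if_neg h]
  · rw [LinearMap.compl₂_apply, AlgHom.toLinearMap_apply]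
    exact hx _ (superMap_mem_coinvariantIdeal hpe hqe hz.1)

/-- The permutation representation on a free `F[G]`-module of rank `n`. -/
def freeRep (F G : Type*) [Field F] [Group G] (n : ℕ) :
    Representation F G (Fin n × G →₀ F) where
  toFun g := Finsupp.lmapDomain F F fun k => (k.1, g * k.2)
  map_one' := by ext; simp
  map_mul' g h := by ext; simp [mul_assoc]

/-- The equivariant surjection of a free `F[G]`-module onto a representation that is given by
a basis of the latter. -/
def freeRepMap (ρ : Representation F G V) {n : ℕ} (b : Module.Basis (Fin n) F V) :
    (Fin n × G →₀ F) →ₗ[F] V :=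
  Finsupp.linearCombination F fun k => ρ k.2 (b k.1)

omit [CharZero F] [Finite G] in
theorem freeRepMap_comp (ρ : Representation F G V) {n : ℕ} (b : Module.Basis (Fin n) F V) (g : G) :
    freeRepMap ρ b ∘ₗ freeRep F G n g = ρ g ∘ₗ freeRepMap ρ b := by
  ext k
  simp [freeRepMap, freeRep]

omit [CharZero F] [Finite G] in
theorem freeRepMap_surjective (ρ : Representation F G V) {n : ℕ} (b : Module.Basis (Fin n) F V) :
    Function.Surjective (freeRepMap ρ b) := by
  rw [← LinearMap.range_eq_top, eq_top_iff, ← b.span_eq, Submodule.span_le]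
  rintro _ ⟨i, rfl⟩
  exact ⟨Finsupp.single (i, 1) 1, by simp [freeRepMap]⟩

omit [CharZero F] [Finite G] in
theorem dualMap_comp_dual {W : Type*} [AddCommGroup W] [Module F W] {p : W →ₗ[F] V}
    {ρ' : Representation F G W} {ρ : Representation F G V} (h : ∀ g, p ∘ₗ ρ' g = ρ g ∘ₗ p) (g : G) :
    p.dualMap ∘ₗ ρ.dual g = ρ'.dual g ∘ₗ p.dualMap := by
  rw [dual_apply_eq_dualMap, dual_apply_eq_dualMap]
  refine LinearMap.ext fun x => LinearMap.ext fun v => ?_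
  exact congrArg x (LinearMap.congr_fun (h g⁻¹) v).symm

/-- A harmonic element of the coinvariant ideal vanishes. Over `ℂ` this is the positivity of
an invariant Hermitian form; in general, the representations are quotients of permutation
representations, for which the invariant symmetric form is positive on integral elements. -/
theorem eq_zero_of_mem_harmonics_of_mem_coinvariantIdeal [FiniteDimensional F V]
    [FiniteDimensional F M] (ρ : Representation F G V) (σ : Representation F G M)
    {x : SuperAlg F (Module.Dual F V) (Module.Dual F M)} (hx : x ∈ harmonics ρ σ)
    (hx' : x ∈ coinvariantIdeal ρ.dual σ.dual) : x = 0 := by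
  let b := Module.finBasis F V
  let c := Module.finBasis F M
  have hp := freeRepMap_comp ρ b
  have hq := freeRepMap_comp σ c
  have hinj := superMap_injective (LinearMap.dualMap_injective_of_surjective
    (freeRepMap_surjective ρ b)) (LinearMap.dualMap_injective_of_surjective
    (freeRepMap_surjective σ c))
  refine hinj ?_
  rw [map_zero]
  refine harmonics_inf_coinvariantIdeal_of_permutation (ρ := freeRep F G _) (σ := freeRep F G _)
    (b := Finsupp.basisSingleOne) (c := Finsupp.basisSingleOne)
    (e := fun g k => (k.1, g * k.2)) (e' := fun g k => (k.1, g * k.2))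
    (fun g i => by simp [freeRep]) (fun g i => by simp [freeRep]) (fun ξ hξ => ?_)
    (superMap_mem_coinvariantIdeal (dualMap_comp_dual hp) (dualMap_comp_dual hq) hx')
  rw [superPairing_superMap]
  exact hx _ (superMap_mem_coinvariantIdeal hp hq hξ)

end Permutation

/-! ### The grading of the symmetric algebra -/

section Grading

open Polynomial

variable {F : Type*} [Field F]
variable {W : Type*} [AddCommGroup W] [Module F W]
variable {W' : Type*} [AddCommGroup W'] [Module F W']

/-- The algebra morphism `w ↦ w X` from the symmetric algebra of `W` into the polynomials over
it. The coefficient of `X ^ d` in the image of `f` is the homogeneous component of `f` of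
degree `d`. -/
def symGrad : SymmetricAlgebra F W →ₐ[F] (SymmetricAlgebra F W)[X] :=
  SymmetricAlgebra.lift
    ((LinearMap.mulRight F (X : (SymmetricAlgebra F W)[X])) ∘ₗ
      (CAlgHom (R := F) (A := SymmetricAlgebra F W)).toLinearMap ∘ₗ SymmetricAlgebra.ι F W)

theorem symGrad_ι (w : W) :
    symGrad (SymmetricAlgebra.ι F W w) = C (SymmetricAlgebra.ι F W w) * X := by
  simp [symGrad]

theorem symDeg_succ (d : ℕ) :
    symDeg F W (d + 1) = LinearMap.range (SymmetricAlgebra.ι F W) * symDeg F W d :=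
  pow_succ' _ _

theorem mul_mem_symDeg {d e : ℕ} {f g : SymmetricAlgebra F W} (hf : f ∈ symDeg F W d)
    (hg : g ∈ symDeg F W e) : f * g ∈ symDeg F W (d + e) := by
  rw [symDeg, pow_add]; exact Submodule.mul_mem_mul hf hg

theorem mem_symDeg_zero {f : SymmetricAlgebra F W} :
    f ∈ symDeg F W 0 ↔ ∃ c : F, algebraMap F _ c = f := by
  rw [symDeg, pow_zero, Submodule.mem_one]

theorem symGrad_of_mem {d : ℕ} {f : SymmetricAlgebra F W} (hf : f ∈ symDeg F W d) :
    symGrad f = C f * X ^ d := by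
  induction d generalizing f with
  | zero =>
    obtain ⟨c, rfl⟩ := mem_symDeg_zero.1 hf
    simp [Polynomial.algebraMap_apply]
  | succ d ih =>
    rw [symDeg_succ] at hf
    refine Submodule.mul_induction_on hf (fun m hm n hn => ?_) (fun x y hx hy => ?_)
    · obtain ⟨w, rfl⟩ := hm
      rw [map_mul, symGrad_ι, ih hn, C_mul]; ring
    · rw [map_add, hx, hy, C_add, add_mul]

/-- The homogeneous component of degree `d` of an element of the symmetric algebra. -/
def symComp (d : ℕ) : SymmetricAlgebra F W →ₗ[F] SymmetricAlgebra F W :=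
  ((lcoeff (SymmetricAlgebra F W) d).restrictScalars F) ∘ₗ symGrad.toLinearMap

theorem symComp_apply (d : ℕ) (f : SymmetricAlgebra F W) :
    symComp d f = (symGrad f).coeff d := rfl

theorem symComp_mem (d : ℕ) (f : SymmetricAlgebra F W) : symComp d f ∈ symDeg F W d := by
  induction f using SymmetricAlgebra.induction generalizing d with
  | algebraMap r =>
    rw [symComp_apply, AlgHom.commutes, Polynomial.algebraMap_apply, coeff_C]
    split_ifs with h
    · subst h; exact mem_symDeg_zero.2 ⟨r, rfl⟩
    · exact zero_mem _
  | ι x =>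
    rw [symComp_apply, symGrad_ι, coeff_C_mul_X]
    split_ifs with h
    · subst h; rw [symDeg, pow_one]; exact ⟨x, rfl⟩
    · exact zero_mem _
  | mul a b ha hb =>
    rw [symComp_apply, map_mul, coeff_mul]
    refine sum_mem fun k hk => ?_
    rw [← Finset.HasAntidiagonal.mem_antidiagonal.1 hk]
    exact mul_mem_symDeg (ha _) (hb _)
  | add a b ha hb => rw [map_add]; exact add_mem (ha d) (hb d)

theorem eval_one_symGrad (f : SymmetricAlgebra F W) : (symGrad f).eval 1 = f := by
  induction f using SymmetricAlgebra.induction with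
  | algebraMap r => simp [Polynomial.algebraMap_apply]
  | ι x => simp [symGrad_ι]
  | mul a b ha hb => simp [ha, hb]
  | add a b ha hb => simp [ha, hb]

theorem symGrad_injective : Function.Injective (symGrad (F := F) (W := W)) :=
  Function.LeftInverse.injective eval_one_symGrad

/-- The degree of an element of the symmetric algebra (zero for the zero element). -/
def symNatDegree (f : SymmetricAlgebra F W) : ℕ := (symGrad f).natDegree

theorem sum_symComp (f : SymmetricAlgebra F W) :
    ∑ d ∈ Finset.range (symNatDegree f + 1), symComp d f = f := by
  conv_rhs => rw [← eval_one_symGrad f, eval_eq_sum_range]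
  simp [symComp_apply, symNatDegree]

theorem symNatDegree_mul {f g : SymmetricAlgebra F W} (hf : f ≠ 0) (hg : g ≠ 0) :
    symNatDegree (f * g) = symNatDegree f + symNatDegree g := by
  rw [symNatDegree, map_mul, natDegree_mul]
  · rfl
  · rwa [Ne, map_eq_zero_iff _ symGrad_injective]
  · rwa [Ne, map_eq_zero_iff _ symGrad_injective]

theorem symNatDegree_of_mem {d : ℕ} {f : SymmetricAlgebra F W} (hf : f ∈ symDeg F W d)
    (h0 : f ≠ 0) : symNatDegree f = d := by
  rw [symNatDegree, symGrad_of_mem hf, natDegree_C_mul_X_pow _ _ h0]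

theorem symComp_natDegree_ne_zero {f : SymmetricAlgebra F W} (hf : f ≠ 0) :
    symComp (symNatDegree f) f ≠ 0 := by
  rw [symComp_apply, symNatDegree, coeff_natDegree, Ne, leadingCoeff_eq_zero]
  rwa [map_eq_zero_iff _ symGrad_injective]

theorem symComp_of_mem {d : ℕ} {f : SymmetricAlgebra F W} (hf : f ∈ symDeg F W d) (e : ℕ) :
    symComp e f = if e = d then f else 0 := by
  rw [symComp_apply, symGrad_of_mem hf, coeff_C_mul_X_pow]

theorem symComp_mul_of_mem {d : ℕ} {g : SymmetricAlgebra F W} (hg : g ∈ symDeg F W d)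
    (f : SymmetricAlgebra F W) (e : ℕ) :
    symComp e (f * g) = if d ≤ e then symComp (e - d) f * g else 0 := by
  rw [symComp_apply, map_mul, symGrad_of_mem hg, ← mul_assoc, coeff_mul_X_pow', coeff_mul_C]
  rfl

theorem symComp_symMap (p : W →ₗ[F] W') (d : ℕ) (f : SymmetricAlgebra F W) :
    symComp d (symMap p f) = symMap p (symComp d f) := by
  have h : symGrad (symMap p f) = (symGrad f).map (symMap p : _ →+* SymmetricAlgebra F W') := by
    induction f using SymmetricAlgebra.induction with
    | algebraMap r => simp [Polynomial.algebraMap_apply]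
    | ι x => simp [symGrad_ι]
    | mul a b ha hb => simp [ha, hb]
    | add a b ha hb => simp [ha, hb]
  rw [symComp_apply, h, coeff_map]
  rfl

theorem symComp_zero_apply (f : SymmetricAlgebra F W) :
    symComp 0 f = algebraMap F _ (SymmetricAlgebra.algebraMapInv f) := by
  rw [symComp_apply]
  induction f using SymmetricAlgebra.induction with
  | algebraMap r => simp [Polynomial.algebraMap_apply]
  | ι x => simp [symGrad_ι, SymmetricAlgebra.algebraMapInv_ι]
  | mul a b ha hb => simp [ha, hb, mul_coeff_zero]
  | add a b ha hb => simp [ha, hb]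

variable {V : Type*} [AddCommGroup V] [Module F V]

theorem partialV_mem_symDeg (v : V) {d : ℕ} {f : SymmetricAlgebra F (Module.Dual F V)}
    (hf : f ∈ symDeg F (Module.Dual F V) (d + 1)) :
    partialV F V v f ∈ symDeg F (Module.Dual F V) d := by
  induction d generalizing f with
  | zero =>
    rw [symDeg, pow_one] at hf
    obtain ⟨w, rfl⟩ := hf
    rw [partialV_apply, symDeriv_ι]
    exact mem_symDeg_zero.2 ⟨_, rfl⟩
  | succ d ih =>
    rw [symDeg_succ] at hf
    refine Submodule.mul_induction_on hf (fun m hm n hn => ?_) (fun x y hx hy => ?_)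
    · obtain ⟨w, rfl⟩ := hm
      rw [partialV_leibniz]
      refine add_mem ?_ ?_
      · rw [symDeg_succ]
        exact Submodule.mul_mem_mul ⟨w, rfl⟩ (ih hn)
      · rw [partialV_apply, symDeriv_ι, mul_comm, ← Algebra.smul_def]
        exact Submodule.smul_mem _ _ hn
    · rw [map_add]; exact add_mem hx hy

theorem symDiff_mem_symDeg {a d : ℕ} {s : SymmetricAlgebra F V} (hs : s ∈ symDeg F V a)
    {f : SymmetricAlgebra F (Module.Dual F V)} (hf : f ∈ symDeg F (Module.Dual F V) (d + a)) :
    symDiff F V s f ∈ symDeg F (Module.Dual F V) d := by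
  induction a generalizing s d with
  | zero =>
    obtain ⟨c, rfl⟩ := mem_symDeg_zero.1 hs
    simpa [Algebra.algebraMap_eq_smul_one] using Submodule.smul_mem _ _ hf
  | succ a ih =>
    rw [symDeg_succ] at hs
    refine Submodule.mul_induction_on hs (fun m hm n hn => ?_) (fun x y hx hy => ?_)
    · obtain ⟨w, rfl⟩ := hm
      rw [map_mul, Module.End.mul_apply, symDiff_ι]
      refine partialV_mem_symDeg w (ih hn ?_)
      rwa [add_right_comm]
    · rw [map_add, LinearMap.add_apply]; exact add_mem hx hy

theorem symDiff_eq_zero {a d : ℕ} (had : d < a) {s : SymmetricAlgebra F V} (hs : s ∈ symDeg F V a)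
    {f : SymmetricAlgebra F (Module.Dual F V)} (hf : f ∈ symDeg F (Module.Dual F V) d) :
    symDiff F V s f = 0 := by
  obtain ⟨k, rfl⟩ := Nat.exists_eq_add_of_lt had
  rw [symDeg, show d + k + 1 = (k + 1) + d by ring, pow_add] at hs
  refine Submodule.mul_induction_on hs (fun m hm n hn => ?_) (fun x y hx hy => ?_)
  · rw [map_mul, Module.End.mul_apply]
    obtain ⟨c, hc⟩ := mem_symDeg_zero.1 (symDiff_mem_symDeg hn (d := 0) (by simpa using hf))
    rw [← hc]
    rw [pow_succ] at hm
    refine Submodule.mul_induction_on hm (fun x hx y hy => ?_) (fun x y hx hy => ?_)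
    · obtain ⟨w, rfl⟩ := hy
      rw [map_mul, Module.End.mul_apply, symDiff_ι, partialV_apply, Derivation.map_algebraMap,
        map_zero]
    · rw [map_add, LinearMap.add_apply, hx, hy, add_zero]
  · rw [map_add, LinearMap.add_apply, hx, hy, add_zero]

/-- Differential operators without constant term lower the degree. -/
theorem symNatDegree_symDiff_lt {a : ℕ} (ha : 0 < a) {s : SymmetricAlgebra F V}
    (hs : s ∈ symDeg F V a) {f : SymmetricAlgebra F (Module.Dual F V)}
    (h0 : symDiff F V s f ≠ 0) : symNatDegree (symDiff F V s f) < symNatDegree f := by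
  have h : symGrad (symDiff F V s f) ∈ degreeLT (SymmetricAlgebra F (Module.Dual F V))
      (symNatDegree f) := by
    have h1 : symGrad (symDiff F V s f) = ∑ d ∈ Finset.range (symNatDegree f + 1),
        symGrad (symDiff F V s (symComp d f)) := by
      conv_lhs => rw [← sum_symComp f]
      rw [map_sum, map_sum]
    rw [h1]
    refine sum_mem fun d hd => ?_
    have hd' := Finset.mem_range.1 hd
    rcases lt_or_ge d a with h | h
    · rw [symDiff_eq_zero h hs (symComp_mem d f), map_zero]; exact zero_mem _
    · obtain ⟨e, rfl⟩ := Nat.exists_eq_add_of_le' h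
      rw [symGrad_of_mem (symDiff_mem_symDeg hs (symComp_mem _ f)), mem_degreeLT]
      refine (degree_C_mul_X_pow_le _ _).trans_lt ?_
      exact_mod_cast (by omega : e < symNatDegree f)
  rw [mem_degreeLT] at h
  exact (natDegree_lt_iff_degree_lt (by rwa [Ne, map_eq_zero_iff _ symGrad_injective])).2 h

end Grading

/-! ### Contractions -/

section Contraction

variable {F : Type*} [Field F]
variable {S : Type*} [CommRing S] [Algebra F S]
variable {N : Type*} [AddCommGroup N] [Module F N]
variable {N' : Type*} [AddCommGroup N'] [Module F N']

/-- The contraction operator on `∧N'` given by a functional on `N'`. -/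
def contractExt : Module.Dual F N' →ₗ[F] Module.End F (ExteriorAlgebra F N') :=
  CliffordAlgebra.contractLeft (Q := (0 : QuadraticForm F N'))

theorem contractExt_ι_mul (d : Module.Dual F N') (m : N') (l : ExteriorAlgebra F N') :
    contractExt d (ExteriorAlgebra.ι F m * l) = d m • l - ExteriorAlgebra.ι F m * contractExt d l :=
  CliffordAlgebra.contractLeft_ι_mul _ _ _

theorem contractExt_algebraMap (d : Module.Dual F N') (c : F) :
    contractExt d (algebraMap F (ExteriorAlgebra F N') c) = 0 :=
  CliffordAlgebra.contractLeft_algebraMap (Q := (0 : QuadraticForm F N')) d c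

theorem contractExt_contractExt (d : Module.Dual F N') (l : ExteriorAlgebra F N') :
    contractExt d (contractExt d l) = 0 :=
  CliffordAlgebra.contractLeft_contractLeft _ _

theorem interior_eq_contractExt (M : Type*) [AddCommGroup M] [Module F M] (m : M) :
    interior F M m = contractExt (Module.Dual.eval F M m) := rfl

/-- The `S`-linear action of `S ⊗ N` on `S ⊗ ∧N'` by contractions, for a pairing `ev` of `N`
and `N'`. -/
def tensorContract (S : Type*) [CommRing S] [Algebra F S] (ev : N →ₗ[F] Module.Dual F N') :
    S ⊗[F] N →ₗ[S] Module.End S (S ⊗[F] ExteriorAlgebra F N') :=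
  LinearMap.liftBaseChange S
    (LinearMap.baseChangeHom F S _ _ ∘ₗ contractExt ∘ₗ ev)

theorem tensorContract_tmul (ev : N →ₗ[F] Module.Dual F N') (s t : S) (n : N)
    (l : ExteriorAlgebra F N') :
    tensorContract S ev (s ⊗ₜ n) (t ⊗ₜ l) = (s * t) ⊗ₜ contractExt (ev n) l := by
  simp [tensorContract, TensorProduct.smul_tmul']

theorem extMap_contractExt {N'' : Type*} [AddCommGroup N''] [Module F N''] (q : N' →ₗ[F] N'')
    (d : Module.Dual F N'') (l : ExteriorAlgebra F N') :
    ExteriorAlgebra.map q (contractExt (d ∘ₗ q) l) = contractExt d (ExteriorAlgebra.map q l) := by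
  induction l using exteriorAlgebra_left_induction with
  | algebraMap r => simp only [contractExt_algebraMap, AlgHom.commutes, map_zero]
  | ι_mul μ x hx => simp [contractExt_ι_mul, hx]
  | add a b ha hb => simp [ha, hb]

theorem tensorContract_equivariant {G : Type*} [Group G] {V : Type*} [AddCommGroup V] [Module F V]
    {ρ : Representation F G V} {τ : Representation F G N} {τ' : Representation F G N'}
    {ev : N →ₗ[F] Module.Dual F N'} (hev : ∀ g n n', ev (τ g n) (τ' g n') = ev n n') (g : G)
    (a : SymmetricAlgebra F V ⊗[F] N) (x : SuperAlg F V N') :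
    superRep ρ τ' g (tensorContract _ ev a x) =
      tensorContract _ ev (((symRep ρ).tprod τ) g a) (superRep ρ τ' g x) := by
  induction a using TensorProduct.induction_on with
  | zero => simp
  | add a b ha hb => simp only [map_add, LinearMap.add_apply, ha, hb]
  | tmul s n =>
    induction x using TensorProduct.induction_on with
    | zero => simp
    | add x y hx hy => simp only [map_add, hx, hy]
    | tmul t l =>
      rw [tensorContract_tmul, superRep_apply, superRep_apply, superMap_tmul, superMap_tmul,
        Representation.tprod_apply, TensorProduct.map_tmul, tensorContract_tmul, map_mul,
        symRep_apply, ← extMap_contractExt]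
      congr 4
      ext n'
      exact (hev g n n').symm

end Contraction

/-! ### The alternants are harmonic -/

section Harmonic

variable {F : Type*} [Field F]
variable {V : Type*} [AddCommGroup V] [Module F V]
variable {M : Type*} [AddCommGroup M] [Module F M]

@[elab_as_elim]
theorem map₂_induction {A B C : Type*} [AddCommGroup A] [Module F A] [AddCommGroup B] [Module F B]
    [AddCommGroup C] [Module F C] {f : A →ₗ[F] B →ₗ[F] C} {p : Submodule F A} {q : Submodule F B}
    {P : C → Prop} (mem : ∀ a ∈ p, ∀ b ∈ q, P (f a b)) (add : ∀ x y, P x → P y → P (x + y)) {x : C}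
    (hx : x ∈ Submodule.map₂ f p q) : P x := by
  rw [Submodule.map₂_eq_span_image2] at hx
  induction hx using Submodule.closure_induction with
  | zero => simpa using mem 0 (zero_mem _) 0 (zero_mem _)
  | add x y _ _ hx hy => exact add x y hx hy
  | smul_mem c x hx =>
    obtain ⟨a, ha, b, hb, rfl⟩ := hx
    simpa using mem (c • a) (Submodule.smul_mem _ _ ha) b hb

/-- The grading involution of the exterior algebra. -/
def extInvolute : ExteriorAlgebra F M →ₐ[F] ExteriorAlgebra F M :=
  CliffordAlgebra.involute (Q := (0 : QuadraticForm F M))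

theorem extInvolute_ι (m : M) :
    extInvolute (ExteriorAlgebra.ι F m) = -ExteriorAlgebra.ι F m :=
  CliffordAlgebra.involute_ι (Q := (0 : QuadraticForm F M)) m

theorem exteriorPower_succ (j : ℕ) :
    ⋀[F]^(j + 1) M = LinearMap.range (ExteriorAlgebra.ι F (M := M)) * ⋀[F]^j M :=
  pow_succ' _ _

theorem mem_exteriorPower_zero {l : ExteriorAlgebra F M} :
    l ∈ ⋀[F]^0 M ↔ ∃ c : F, algebraMap F _ c = l := by
  rw [ExteriorAlgebra.exteriorPower, pow_zero, Submodule.mem_one]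

theorem extInvolute_of_mem {j : ℕ} {l : ExteriorAlgebra F M} (hl : l ∈ ⋀[F]^j M) :
    extInvolute l = (-1 : F) ^ j • l := by
  induction j generalizing l with
  | zero =>
    obtain ⟨c, rfl⟩ := mem_exteriorPower_zero.1 hl
    simp
  | succ j ih =>
    rw [exteriorPower_succ] at hl
    refine Submodule.mul_induction_on hl (fun m hm n hn => ?_) (fun x y hx hy => ?_)
    · obtain ⟨m, rfl⟩ := hm
      rw [map_mul, extInvolute_ι, ih hn, pow_succ]
      simp
    · rw [map_add, hx, hy, smul_add]

theorem mul_ι_eq (m : M) (l : ExteriorAlgebra F M) :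
    l * ExteriorAlgebra.ι F m = ExteriorAlgebra.ι F m * extInvolute l := by
  induction l using exteriorAlgebra_left_induction with
  | algebraMap r => rw [AlgHom.commutes, Algebra.commutes]
  | add x y hx hy => rw [add_mul, hx, hy, map_add, mul_add]
  | ι_mul n x hx =>
    rw [mul_assoc, hx, map_mul, extInvolute_ι, ← mul_assoc, ← mul_assoc, mul_neg,
      eq_neg_of_add_eq_zero_left (ExteriorAlgebra.ι_add_mul_swap n m)]

theorem mul_eq_mul_iterate_extInvolute {j : ℕ} {l : ExteriorAlgebra F M} (hl : l ∈ ⋀[F]^j M)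
    (x : ExteriorAlgebra F M) : x * l = l * extInvolute^[j] x := by
  induction j generalizing l x with
  | zero =>
    obtain ⟨c, rfl⟩ := mem_exteriorPower_zero.1 hl
    rw [Function.iterate_zero, id, Algebra.commutes]
  | succ j ih =>
    rw [exteriorPower_succ] at hl
    refine Submodule.mul_induction_on hl (fun m hm n hn => ?_) (fun a b ha hb => ?_)
    · obtain ⟨m, rfl⟩ := hm
      rw [← mul_assoc, mul_ι_eq, mul_assoc, ih hn, mul_assoc, Function.iterate_succ_apply]
    · rw [mul_add, ha, hb, add_mul]

theorem contractExt_mem_exteriorPower (d : Module.Dual F M) {j : ℕ} {l : ExteriorAlgebra F M}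
    (hl : l ∈ ⋀[F]^(j + 1) M) : contractExt d l ∈ ⋀[F]^j M := by
  induction j generalizing l with
  | zero =>
    rw [ExteriorAlgebra.exteriorPower, pow_one] at hl
    obtain ⟨m, rfl⟩ := hl
    have := contractExt_ι_mul d m 1
    rw [mul_one, ← map_one (algebraMap F (ExteriorAlgebra F M)), contractExt_algebraMap, mul_zero,
      sub_zero] at this
    rw [this, mem_exteriorPower_zero]
    exact ⟨d m, by rw [map_one, Algebra.algebraMap_eq_smul_one]⟩
  | succ j ih =>
    rw [exteriorPower_succ] at hl
    refine Submodule.mul_induction_on hl (fun m hm n hn => ?_) (fun a b ha hb => ?_)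
    · obtain ⟨m, rfl⟩ := hm
      rw [contractExt_ι_mul]
      refine sub_mem (Submodule.smul_mem _ _ hn) ?_
      rw [exteriorPower_succ]
      exact Submodule.mul_mem_mul ⟨m, rfl⟩ (ih hn)
    · rw [map_add]; exact add_mem ha hb

/-- The super Leibniz rule for the contraction of `μ ∧ ν` by `ℓ`. -/
theorem extInterior_ι_mul (l : ExteriorAlgebra F M) (μ : Module.Dual F M)
    (ν : ExteriorAlgebra F (Module.Dual F M)) :
    extInterior l (ExteriorAlgebra.ι F μ * ν) =
      extInterior (contractExt μ l) ν + ExteriorAlgebra.ι F μ * extInterior (extInvolute l) ν := by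
  induction l using exteriorAlgebra_left_induction generalizing ν with
  | algebraMap r =>
    rw [contractExt_algebraMap, AlgHom.commutes, extInterior_algebraMap, map_zero]
    simp
  | add x y hx hy => simp only [map_add, LinearMap.add_apply, hx, hy, mul_add]; abel
  | ι_mul m l hl =>
    simp only [extInterior_mul, extInterior_ι, Module.End.mul_apply, interior_ι_mul, map_sub,
      map_smul, hl, contractExt_ι_mul, map_mul, extInvolute_ι, LinearMap.sub_apply,
      LinearMap.smul_apply, map_neg, neg_mul, LinearMap.neg_apply, Module.End.mul_apply, mul_neg]
    abel

theorem dStar_tmul (s : SymmetricAlgebra F V) (μ : Module.Dual F M)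
    (f : SymmetricAlgebra F (Module.Dual F V)) (ν : ExteriorAlgebra F (Module.Dual F M)) :
    dStar (s ⊗ₜ μ) (f ⊗ₜ ν) = symDiff F V s f ⊗ₜ (ExteriorAlgebra.ι F μ * ν) := by
  simp [dStar, superAct_tmul]

theorem dStar_add (a b : SymmetricAlgebra F V ⊗[F] Module.Dual F M) :
    dStar (a + b) = dStar a + dStar b := by
  simp [dStar]

/-- The super commutation rule between the operators `d*` and the contractions. -/
theorem superContract_dStar (a : SymmetricAlgebra F V ⊗[F] Module.Dual F M) (p : SuperAlg F V M)
    (x : SuperAlg F (Module.Dual F V) (Module.Dual F M)) :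
    superContract p (dStar a x) =
      superContract (tensorContract _ LinearMap.id a p) x +
        dStar a (superContract (Algebra.TensorProduct.map (AlgHom.id F _) extInvolute p) x) := by
  induction a using TensorProduct.induction_on with
  | zero => simp [dStar]
  | add a b ha hb =>
    simp only [map_add, dStar_add, LinearMap.add_apply, ha, hb]; abel
  | tmul s μ =>
    induction p using TensorProduct.induction_on with
    | zero => simp
    | add p q hp hq => simp only [map_add, LinearMap.add_apply, hp, hq]; abel
    | tmul t l =>
      induction x using TensorProduct.induction_on with
      | zero => simp
      | add x y hx hy => simp only [map_add, hx, hy]; abel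
      | tmul f ν =>
        simp only [dStar_tmul, superContract_tmul, tensorContract_tmul, extInterior_ι_mul,
          Algebra.TensorProduct.map_tmul, AlgHom.coe_id, id, LinearMap.id_apply,
          TensorProduct.tmul_add]
        rw [← Module.End.mul_apply, ← Module.End.mul_apply, ← map_mul, ← map_mul, mul_comm t s]

variable {G : Type*} [Group G]

/-- The elements of `S(V*) ⊗ ∧M*` that are killed by the contractions by homogeneous invariants
of positive degree. -/
def contractAnnihilator (ρ : Representation F G V) (σ : Representation F G M) :
    Submodule F (SuperAlg F (Module.Dual F V) (Module.Dual F M)) :=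
  ⨅ p ∈ positiveInvariants ρ σ, LinearMap.ker (superContract p)

theorem mem_contractAnnihilator {ρ : Representation F G V} {σ : Representation F G M}
    {x : SuperAlg F (Module.Dual F V) (Module.Dual F M)} :
    x ∈ contractAnnihilator ρ σ ↔ ∀ p ∈ positiveInvariants ρ σ, superContract p x = 0 := by
  simp [contractAnnihilator, Submodule.mem_iInf]

theorem tmul_mul_eq_of_mem_superDeg {i j : ℕ} {p : SuperAlg F V M} (hp : p ∈ superDeg F V M i j)
    (s : SymmetricAlgebra F V) (l : ExteriorAlgebra F M) :
    (s ⊗ₜ l) * p = p * (s ⊗ₜ extInvolute^[j] l) := by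
  refine map₂_induction (fun t _ k hk => ?_) (fun a b ha hb => ?_) hp
  · rw [TensorProduct.mk_apply, Algebra.TensorProduct.tmul_mul_tmul,
      Algebra.TensorProduct.tmul_mul_tmul, mul_comm, mul_eq_mul_iterate_extInvolute hk]
  · rw [mul_add, ha, hb, add_mul]

theorem superContract_mem_contractAnnihilator {ρ : Representation F G V}
    {σ : Representation F G M} {x : SuperAlg F (Module.Dual F V) (Module.Dual F M)}
    (hx : x ∈ contractAnnihilator ρ σ) (y : SuperAlg F V M) :
    superContract y x ∈ contractAnnihilator ρ σ := by
  induction y using TensorProduct.induction_on with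
  | zero => simp
  | add y z hy hz => rw [map_add, LinearMap.add_apply]; exact add_mem hy hz
  | tmul s l =>
    refine mem_contractAnnihilator.2 fun p hp => ?_
    obtain ⟨i, j, -, hdeg⟩ := hp.2
    rw [← Module.End.mul_apply, ← superContract_mul, tmul_mul_eq_of_mem_superDeg hdeg,
      superContract_mul, Module.End.mul_apply, mem_contractAnnihilator.1 hx p hp, map_zero]

theorem contractAnnihilator_le_harmonics (ρ : Representation F G V) (σ : Representation F G M) :
    contractAnnihilator ρ σ ≤ harmonics ρ σ := by
  have key : ∀ ξ ∈ coinvariantIdeal ρ σ, ∀ x ∈ contractAnnihilator ρ σ,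
      superContract ξ x = 0 := by
    intro ξ hξ
    induction hξ using TwoSidedIdeal.span_induction with
    | zero => simp
    | add a b _ _ ha hb => intro x hx; rw [map_add, LinearMap.add_apply, ha x hx, hb x hx, add_zero]
    | neg a _ ha => intro x hx; rw [map_neg, LinearMap.neg_apply, ha x hx, neg_zero]
    | left_absorb a b _ hb =>
      intro x hx
      rw [superContract_mul, Module.End.mul_apply]
      exact hb _ (superContract_mem_contractAnnihilator hx a)
    | right_absorb a b _ hb =>
      intro x hx
      rw [superContract_mul, Module.End.mul_apply, hb x hx, map_zero]
    | mem a ha => intro x hx; exact mem_contractAnnihilator.1 hx a ha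
  exact fun x hx ξ hξ => superPairing_eq_zero_of_superContract (key ξ hξ x hx)

theorem tensorContract_mem_superDeg {e i j : ℕ} {a : SymmetricAlgebra F V ⊗[F] Module.Dual F M}
    (ha : a ∈ Submodule.map₂ (TensorProduct.mk F (SymmetricAlgebra F V) (Module.Dual F M))
      (symDeg F V e) ⊤) {p : SuperAlg F V M} (hp : p ∈ superDeg F V M i (j + 1)) :
    tensorContract _ LinearMap.id a p ∈ superDeg F V M (e + i) j := by
  refine map₂_induction (fun s hs μ _ => ?_) (fun a b ha hb => ?_) ha
  · refine map₂_induction (fun t ht l hl => ?_) (fun a b ha hb => ?_) hp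
    · rw [TensorProduct.mk_apply, TensorProduct.mk_apply, tensorContract_tmul]
      exact Submodule.apply_mem_map₂ _ (mul_mem_symDeg hs ht) (contractExt_mem_exteriorPower _ hl)
    · rw [map_add]; exact add_mem ha hb
  · rw [map_add, LinearMap.add_apply]; exact add_mem ha hb

theorem tensorContract_eq_zero_of_mem_superDeg {N : Type*} [AddCommGroup N] [Module F N]
    {ev : N →ₗ[F] Module.Dual F M} {i : ℕ} (a : SymmetricAlgebra F V ⊗[F] N)
    {p : SuperAlg F V M} (hp : p ∈ superDeg F V M i 0) : tensorContract _ ev a p = 0 := by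
  refine map₂_induction (fun t ht l hl => ?_) (fun x y hx hy => ?_) hp
  · obtain ⟨c, rfl⟩ := mem_exteriorPower_zero.1 hl
    induction a using TensorProduct.induction_on with
    | zero => simp
    | add a b ha hb => rw [map_add, LinearMap.add_apply, ha, hb, add_zero]
    | tmul s n =>
      rw [TensorProduct.mk_apply, tensorContract_tmul, contractExt_algebraMap,
        TensorProduct.tmul_zero]
  · rw [map_add, hx, hy, add_zero]

theorem map_extInvolute_of_mem_superDeg {i j : ℕ} {p : SuperAlg F V M}
    (hp : p ∈ superDeg F V M i j) :
    Algebra.TensorProduct.map (AlgHom.id F _) extInvolute p = (-1 : F) ^ j • p := by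
  refine map₂_induction (fun t ht l hl => ?_) (fun x y hx hy => ?_) hp
  · rw [TensorProduct.mk_apply, Algebra.TensorProduct.map_tmul, extInvolute_of_mem hl,
      TensorProduct.tmul_smul]
    rfl
  · rw [map_add, hx, hy, smul_add]

/-- The operator `d*` given by an invariant of positive degree preserves the elements that are
killed by the contractions by positive invariants. -/
theorem dStar_mem_contractAnnihilator {ρ : Representation F G V} {σ : Representation F G M}
    {a : SymmetricAlgebra F V ⊗[F] Module.Dual F M} {e : ℕ} (he : 0 < e)
    (ha : a ∈ Submodule.map₂ (TensorProduct.mk F (SymmetricAlgebra F V) (Module.Dual F M))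
      (symDeg F V e) ⊤) (hinv : a ∈ ((symRep ρ).tprod σ.dual).invariants)
    {x : SuperAlg F (Module.Dual F V) (Module.Dual F M)} (hx : x ∈ contractAnnihilator ρ σ) :
    dStar a x ∈ contractAnnihilator ρ σ := by
  refine mem_contractAnnihilator.2 fun p hp => ?_
  have hp' := hp
  obtain ⟨hpinv, i, j, hij, hdeg⟩ := hp
  rw [superContract_dStar, map_extInvolute_of_mem_superDeg hdeg, map_smul, LinearMap.smul_apply,
    mem_contractAnnihilator.1 hx p hp', smul_zero, map_zero, add_zero]
  rcases j with _ | j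
  · rw [tensorContract_eq_zero_of_mem_superDeg a hdeg, map_zero, LinearMap.zero_apply]
  · refine mem_contractAnnihilator.1 hx _ ⟨fun g => ?_, e + i, j, by omega,
      tensorContract_mem_superDeg ha hdeg⟩
    rw [tensorContract_equivariant (τ := σ.dual) (ev := LinearMap.id) ?_, hinv g, hpinv g]
    intro g n n'
    rw [LinearMap.id_apply, LinearMap.id_apply, dual_apply_eq_dualMap, LinearMap.dualMap_apply,
      ← LinearMap.comp_apply (σ g⁻¹), inv_comp_self, LinearMap.id_apply]

theorem IsVandermondian.mem_semiInvariants {ρ : Representation F G V} {χ : G →* Fˣ}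
    {Δ : SymmetricAlgebra F V} (hΔ : IsVandermondian ρ χ Δ) : Δ ∈ semiInvariants (symRep ρ) χ :=
  (hΔ Δ).2 ⟨1, fun g => by simp [symRep_apply], by simp⟩

/-- The contractions by positive invariants annihilate `Δ ⊗ 1`, since they lower the degree and a
nonzero `χ`-semi-invariant has at least the degree of `Δ`. -/
theorem tmul_one_mem_contractAnnihilator {ρ : Representation F G V} {σ : Representation F G M}
    {χ : G →* Fˣ} {Δ : SymmetricAlgebra F (Module.Dual F V)} (hΔ : IsVandermondian ρ.dual χ Δ) :
    Δ ⊗ₜ 1 ∈ contractAnnihilator ρ σ := by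
  refine mem_contractAnnihilator.2 fun p hp => ?_
  obtain ⟨hpinv, i, j, hij, hdeg⟩ := hp
  rcases j with _ | j
  -- An element of bidegree `(i, 0)` is of the form `s ⊗ 1`.
  · obtain ⟨s, hs, rfl⟩ : ∃ s ∈ symDeg F V i, s ⊗ₜ 1 = p := by
      refine map₂_induction (fun t ht l hl => ?_) (fun x y hx hy => ?_) hdeg
      · obtain ⟨c, rfl⟩ := mem_exteriorPower_zero.1 hl
        exact ⟨c • t, Submodule.smul_mem _ _ ht, by
          rw [TensorProduct.mk_apply, Algebra.algebraMap_eq_smul_one, TensorProduct.tmul_smul,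
            TensorProduct.smul_tmul']⟩
      · obtain ⟨s, hs, rfl⟩ := hx
        obtain ⟨t, ht, rfl⟩ := hy
        exact ⟨s + t, add_mem hs ht, TensorProduct.add_tmul _ _ _⟩
    have hsinv : ∀ g, symRep ρ g s = s := fun g => by
      have h := congrArg (fun z => TensorProduct.rid F _ (TensorProduct.map LinearMap.id
        (ExteriorAlgebra.algebraMapInv (R := F) (M := M)).toLinearMap z)) (hpinv g)
      rw [superRep_apply, superMap_tmul, map_one] at h
      exact (by simpa using h : symMap (ρ g) s = s)
    have hsemi : symDiff F V s Δ ∈ semiInvariants (symRep ρ.dual) χ := fun g => by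
      rw [symDiff_equivariant, hsinv, hΔ.mem_semiInvariants g, map_smul]
    obtain ⟨f, -, hf⟩ := (hΔ _).1 hsemi
    have h0 : symDiff F V s Δ = 0 := by
      by_contra h0
      have hlt := symNatDegree_symDiff_lt (by omega) hs h0
      rw [hf] at h0 hlt
      rw [symNatDegree_mul (left_ne_zero_of_mul h0) (right_ne_zero_of_mul h0)] at hlt
      omega
    rw [superContract_tmul, h0, TensorProduct.zero_tmul]
  · refine map₂_induction (fun t ht l hl => ?_) (fun x y hx hy => ?_) hdeg
    · have : extInterior l (1 : ExteriorAlgebra F (Module.Dual F M)) = 0 := by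
        rw [exteriorPower_succ] at hl
        refine Submodule.mul_induction_on hl (fun m hm n hn => ?_) (fun x y hx hy => ?_)
        · obtain ⟨m, rfl⟩ := hm
          rw [extInterior_mul, Module.End.mul_apply, extInterior_ι,
            ← map_one (algebraMap F (ExteriorAlgebra F (Module.Dual F M))), interior_algebraMap,
            map_zero]
        · rw [map_add, LinearMap.add_apply, hx, hy, add_zero]
      rw [TensorProduct.mk_apply, superContract_tmul, this, TensorProduct.tmul_zero]
    · rw [map_add, LinearMap.add_apply, hx, hy, add_zero]

theorem dual_invariants_eq_bot [CharZero F] [Finite G] {σ : Representation F G M}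
    (hM : σ.invariants = ⊥) : σ.dual.invariants = ⊥ := by
  have := Fintype.ofFinite G
  rw [eq_bot_iff]
  intro μ hμ
  rw [Submodule.mem_bot]
  ext m
  have h1 : ∑ g, σ g m ∈ σ.invariants := fun h => by
    rw [map_sum]
    refine Fintype.sum_equiv (Equiv.mulLeft h) _ _ fun g => ?_
    simp
  rw [hM, Submodule.mem_bot] at h1
  have h2 : ∀ g, μ (σ g m) = μ m := fun g => by
    have := LinearMap.congr_fun (hμ g⁻¹) m
    rwa [dual_apply_eq_dualMap, inv_inv] at this
  have h3 := congrArg μ h1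
  rw [map_sum, Finset.sum_congr rfl fun g _ => h2 g] at h3
  simpa using h3

/-- In the absence of invariants in `M`, basic derivations have positive degree. -/
theorem IsBasicDerivations.pos_of_mem {ρ : Representation F G V} {σ : Representation F G M}
    {r : ℕ} {θ : Fin r → SymmetricAlgebra F V ⊗[F] M} (hθ : IsBasicDerivations ρ σ θ)
    (hM : σ.invariants = ⊥) {i : Fin r} {e : ℕ}
    (he : θ i ∈ Submodule.map₂ (TensorProduct.mk F (SymmetricAlgebra F V) M) (symDeg F V e) ⊤) :
    0 < e := by
  rcases Nat.eq_zero_or_pos e with rfl | h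
  · exfalso
    obtain ⟨m, hm⟩ : ∃ m : M, 1 ⊗ₜ m = θ i := by
      refine map₂_induction (fun t ht m _ => ?_) (fun x y hx hy => ?_) he
      · obtain ⟨c, rfl⟩ := mem_symDeg_zero.1 ht
        exact ⟨c • m, by rw [TensorProduct.mk_apply, Algebra.algebraMap_eq_smul_one,
          TensorProduct.tmul_smul, TensorProduct.smul_tmul']⟩
      · obtain ⟨m, hm⟩ := hx
        obtain ⟨n, hn⟩ := hy
        exact ⟨m + n, by rw [TensorProduct.tmul_add, hm, hn]⟩
    have hinv : m ∈ σ.invariants := fun g => by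
      have h := hθ.invariant i g
      rw [← hm, Representation.tprod_apply, TensorProduct.map_tmul, symRep_apply, map_one] at h
      have h' := congrArg (fun z => TensorProduct.lid F _ (TensorProduct.map
        (SymmetricAlgebra.algebraMapInv (R := F) (M := V)).toLinearMap LinearMap.id z)) h
      simpa using h'
    rw [hM, Submodule.mem_bot] at hinv
    have h0 : θ i = 0 := by rw [← hm, hinv, TensorProduct.tmul_zero]
    obtain ⟨c, -, hc⟩ := hθ.basis 0 (zero_mem _)
    have h1 := hc 0 ⟨fun i => zero_mem _, by simp⟩
    have h2 := hc (Pi.single i 1) ⟨fun j => ?_, ?_⟩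
    · have := congrFun (h2.trans h1.symm) i
      simp at this
    · intro g
      by_cases hj : j = i
      · subst hj; simp [symRep_apply]
      · simp [hj]
    · rw [Finset.sum_eq_single i] <;> simp +contextual [h0]
  · exact h

variable {ρ : Representation F G V} {σ : Representation F G M} {χ : G →* Fˣ} {r : ℕ}
  {ω : Fin r → SymmetricAlgebra F V ⊗[F] Module.Dual F M}
  {Δ : SymmetricAlgebra F (Module.Dual F V)}

theorem superAlternant_mem_harmonics [CharZero F] [Finite G] (hω : IsBasicDerivations ρ σ.dual ω)
    (hΔ : IsVandermondian ρ.dual χ Δ) (hM : σ.invariants = ⊥) (I : Finset (Fin r)) :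
    superAlternant ω Δ I ∈ harmonics ρ σ := by
  refine contractAnnihilator_le_harmonics ρ σ ?_
  rw [superAlternant]
  induction I.sort (· ≤ ·) with
  | nil => simpa using tmul_one_mem_contractAnnihilator hΔ
  | cons i l ih =>
    obtain ⟨e, he⟩ := hω.homogeneous i
    rw [List.map_cons, List.prod_cons, Module.End.mul_apply]
    exact dStar_mem_contractAnnihilator (hω.pos_of_mem (dual_invariants_eq_bot hM) he) he
      (hω.invariant i) ih

theorem dStar_equivariant (g : G) (a : SymmetricAlgebra F V ⊗[F] Module.Dual F M)
    (x : SuperAlg F (Module.Dual F V) (Module.Dual F M)) :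
    superRep ρ.dual σ.dual g (dStar a x) =
      dStar (((symRep ρ).tprod σ.dual) g a) (superRep ρ.dual σ.dual g x) := by
  rw [dStar, superAct_equivariant, dStar]
  congr 2
  induction a using TensorProduct.induction_on with
  | zero => simp
  | add a b ha hb => simp only [map_add, ha, hb]
  | tmul s μ =>
    rw [superRep_apply, TensorProduct.map_tmul, superMap_tmul, ExteriorAlgebra.map_apply_ι]
    rfl

theorem superAlternant_mem_semiInvariants (hω : IsBasicDerivations ρ σ.dual ω)
    (hΔ : IsVandermondian ρ.dual χ Δ) (I : Finset (Fin r)) :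
    superAlternant ω Δ I ∈ semiInvariants (superRep ρ.dual σ.dual) χ := by
  rw [superAlternant]
  intro g
  induction I.sort (· ≤ ·) with
  | nil =>
    rw [List.map_nil, List.prod_nil, Module.End.one_apply, superRep_apply, superMap_tmul,
      ← symRep_apply, hΔ.mem_semiInvariants g, map_one, TensorProduct.smul_tmul']
  | cons i l ih =>
    rw [List.map_cons, List.prod_cons, Module.End.mul_apply, dStar_equivariant, hω.invariant i g,
      ih, map_smul]

end Harmonic

/-! ### Products of anticommuting families -/

section Anticommute

variable {A : Type*} [Ring A] {α : Type*} {a : α → A}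

theorem exists_units_smul_prod_of_perm (h : ∀ i j, a i * a j = -(a j * a i)) {l l' : List α}
    (hl : l.Perm l') : ∃ ε : ℤˣ, (l'.map a).prod = ε • (l.map a).prod := by
  induction hl with
  | nil => exact ⟨1, by simp⟩
  | cons x _ ih =>
    obtain ⟨ε, hε⟩ := ih
    exact ⟨ε, by rw [List.map_cons, List.map_cons, List.prod_cons, List.prod_cons, hε,
      mul_smul_comm]⟩
  | swap x y l =>
    refine ⟨-1, ?_⟩
    simp only [List.map_cons, List.prod_cons, ← mul_assoc, h x y, Units.neg_smul, one_smul, neg_mul]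
  | trans _ _ ih ih' =>
    obtain ⟨ε, hε⟩ := ih
    obtain ⟨ε', hε'⟩ := ih'
    exact ⟨ε' * ε, by rw [hε', hε, mul_smul]⟩

theorem prod_eq_zero_of_not_nodup (h : ∀ i j, a i * a j = -(a j * a i)) (h0 : ∀ i, a i * a i = 0)
    {l : List α} (hl : ¬ l.Nodup) : (l.map a).prod = 0 := by
  rw [List.nodup_iff_sublist] at hl
  push Not at hl
  obtain ⟨i, hi⟩ := hl
  obtain ⟨l', hl'⟩ := hi.exists_perm_append
  obtain ⟨ε, hε⟩ := exists_units_smul_prod_of_perm h hl'.symm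
  rw [hε]
  simp [← mul_assoc, h0]

/-- The product of an anticommuting family over a finite set of indices, in increasing order. -/
def ordProd {r : ℕ} (a : Fin r → A) (I : Finset (Fin r)) : A :=
  ((I.sort (· ≤ ·)).map a).prod

variable {r : ℕ} {a : Fin r → A}

theorem ordProd_mul_of_not_disjoint (h : ∀ i j, a i * a j = -(a j * a i))
    (h0 : ∀ i, a i * a i = 0) {I J : Finset (Fin r)} (hIJ : ¬ Disjoint I J) :
    ordProd a I * ordProd a J = 0 := by
  rw [ordProd, ordProd, ← List.prod_append, ← List.map_append]
  refine prod_eq_zero_of_not_nodup h h0 fun hn => hIJ ?_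
  rw [Finset.disjoint_left]
  intro i hi hj
  exact (List.nodup_append.1 hn).2.2 i (by simpa using hi) i (by simpa using hj) rfl

theorem exists_ordProd_mul_compl (h : ∀ i j, a i * a j = -(a j * a i)) (I : Finset (Fin r)) :
    ∃ ε : ℤˣ, ordProd a I * ordProd a Iᶜ = ε • ((List.finRange r).map a).prod := by
  rw [ordProd, ordProd, ← List.prod_append, ← List.map_append]
  refine exists_units_smul_prod_of_perm h ?_
  refine (List.perm_ext_iff_of_nodup (List.nodup_finRange r) ?_).2 fun i => ?_
  · refine List.nodup_append.2 ⟨Finset.sort_nodup _ _, Finset.sort_nodup _ _, ?_⟩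
    rintro i hi _ hj rfl
    simp at hi hj
    exact hj hi
  · simp [em]

theorem exists_prod_eq_ordProd (h : ∀ i j, a i * a j = -(a j * a i)) {l : List (Fin r)}
    (hl : l.Nodup) : ∃ ε : ℤˣ, (l.map a).prod = ε • ordProd a l.toFinset := by
  refine exists_units_smul_prod_of_perm h ?_
  exact (List.perm_ext_iff_of_nodup (Finset.sort_nodup _ _) hl).2 fun i => by simp

end Anticommute

section Determinant

variable {S : Type*} [CommRing S] {A : Type*} [Ring A] [Algebra S A]
variable {N : Type*} [AddCommGroup N] [Module S N]

/-- The product of the `f (v i)` is alternating in `v` if `f` takes values with square zero. -/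
theorem prod_eq_det_smul {r : ℕ} (f : N →ₗ[S] A) (hf : ∀ x, f x * f x = 0)
    (e : Module.Basis (Fin r) S N) (v : Fin r → N) :
    ((List.finRange r).map fun i => f (v i)).prod =
      e.det v • ((List.finRange r).map fun i => f (e i)).prod := by
  let φ : N [⋀^Fin r]→ₗ[S] A :=
    (ExteriorAlgebra.lift S ⟨f, hf⟩).toLinearMap.compAlternatingMap (ExteriorAlgebra.ιMulti S r)
  have hφ : ∀ v, φ v = ((List.finRange r).map fun i => f (v i)).prod := fun v => by
    simp only [φ, LinearMap.compAlternatingMap_apply, ExteriorAlgebra.ιMulti_apply,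
      AlgHom.toLinearMap_apply, map_list_prod, List.ofFn_eq_map, List.map_map]
    congr 2
    funext i
    simp
  have key : φ = (LinearMap.toSpanSingleton S A (φ e)).compAlternatingMap e.det := by
    refine Module.Basis.ext_alternating e fun v hv => ?_
    let π : Equiv.Perm (Fin r) := Equiv.ofBijective v (Finite.injective_iff_bijective.1 hv)
    have h2 : (e.det fun i => e (π i)) = Equiv.Perm.sign π • e.det e := e.det.map_perm e π
    have h3 : (φ fun i => e (π i)) = Equiv.Perm.sign π • φ e := φ.map_perm e π
    change (φ fun i => e (π i)) = (e.det fun i => e (π i)) • φ e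
    rw [h3, h2, e.det_self]
    rcases Int.units_eq_one_or (Equiv.Perm.sign π) with h | h <;> simp [h]
  rw [← hφ, ← hφ, key]
  simp [e.det_self]

end Determinant

/-! ### Generators of the semi-invariants -/

section Separation

variable {F : Type*} [Field F]
variable {S : Type*} [CommRing S] [Algebra F S]
variable {M : Type*} [AddCommGroup M] [Module F M]
variable {N : Type*} [AddCommGroup N] [Module F N]
variable {N' : Type*} [AddCommGroup N'] [Module F N']

/-- Contractions anticommute and have square zero. -/
theorem tensorContract_sq (ev : N →ₗ[F] Module.Dual F N') (a : S ⊗[F] N) :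
    tensorContract S ev a * tensorContract S ev a = 0 ∧
      ∀ b : S ⊗[F] N, tensorContract S ev a * tensorContract S ev b =
        -(tensorContract S ev b * tensorContract S ev a) := by
  have anti : ∀ a b : S ⊗[F] N, tensorContract S ev a * tensorContract S ev b =
        -(tensorContract S ev b * tensorContract S ev a) := by
    intro a b
    induction a using TensorProduct.induction_on with
    | zero => simp
    | add a a' ha ha' => rw [map_add, add_mul, ha, ha', mul_add, neg_add]
    | tmul s n =>
      induction b using TensorProduct.induction_on with
      | zero => simp
      | add b b' hb hb' => rw [map_add, mul_add, hb, hb', add_mul, neg_add]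
      | tmul t n' =>
        refine LinearMap.ext fun x => ?_
        induction x using TensorProduct.induction_on with
        | zero => simp
        | add x y hx hy => rw [map_add, map_add, hx, hy]
        | tmul u l =>
          simp only [Module.End.mul_apply, LinearMap.neg_apply, tensorContract_tmul]
          rw [show contractExt (ev n) (contractExt (ev n') l) =
            -contractExt (ev n') (contractExt (ev n) l) from
              CliffordAlgebra.contractLeft_comm _ _ _, TensorProduct.tmul_neg, mul_left_comm]
  refine ⟨?_, anti a⟩
  induction a using TensorProduct.induction_on with
  | zero => simp
  | add a b ha hb => rw [map_add, add_mul, mul_add, mul_add, ha, hb, anti a b]; abel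
  | tmul s n =>
    refine LinearMap.ext fun x => ?_
    induction x using TensorProduct.induction_on with
    | zero => simp
    | add x y hx hy => rw [map_add, hx, hy]; simp
    | tmul u l =>
      rw [Module.End.mul_apply, tensorContract_tmul, tensorContract_tmul, contractExt_contractExt,
        TensorProduct.tmul_zero, LinearMap.zero_apply]

/-- The component of exterior degree zero of an element of `S ⊗ ∧N`. -/
def extScalar (S : Type*) [CommRing S] [Algebra F S] (N : Type*) [AddCommGroup N] [Module F N] :
    S ⊗[F] ExteriorAlgebra F N →ₗ[S] S :=
  LinearMap.liftBaseChange S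
    (Algebra.linearMap F S ∘ₗ (ExteriorAlgebra.algebraMapInv (R := F) (M := N)).toLinearMap)

theorem extScalar_tmul (s : S) (l : ExteriorAlgebra F N) :
    extScalar S N (s ⊗ₜ l) = ExteriorAlgebra.algebraMapInv (R := F) l • s := by
  simp [extScalar, Algebra.smul_def, mul_comm]

/-- The part of exterior degree `j` of `S ⊗ ∧N`. -/
def extPart (F S N : Type*) [Field F] [CommRing S] [Algebra F S] [AddCommGroup N] [Module F N]
    (j : ℕ) : Submodule F (S ⊗[F] ExteriorAlgebra F N) :=
  Submodule.map₂ (TensorProduct.mk F S (ExteriorAlgebra F N)) ⊤ (⋀[F]^j N)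

theorem tensorContract_mem_extPart (ev : N →ₗ[F] Module.Dual F N') (a : S ⊗[F] N) {j : ℕ}
    {x : S ⊗[F] ExteriorAlgebra F N'} (hx : x ∈ extPart F S N' (j + 1)) :
    tensorContract S ev a x ∈ extPart F S N' j := by
  induction a using TensorProduct.induction_on with
  | zero => simp
  | add a b ha hb => rw [map_add, LinearMap.add_apply]; exact add_mem ha hb
  | tmul s n =>
    refine map₂_induction (fun t ht l hl => ?_) (fun x y hx hy => ?_) hx
    · rw [TensorProduct.mk_apply, tensorContract_tmul]
      exact Submodule.apply_mem_map₂ _ trivial (contractExt_mem_exteriorPower _ hl)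
    · rw [map_add]; exact add_mem hx hy

theorem extScalar_eq_zero {j : ℕ} {x : S ⊗[F] ExteriorAlgebra F N}
    (hx : x ∈ extPart F S N (j + 1)) : extScalar S N x = 0 := by
  refine map₂_induction (fun t ht l hl => ?_) (fun x y hx hy => ?_) hx
  · rw [exteriorPower_succ] at hl
    have : ExteriorAlgebra.algebraMapInv (R := F) l = 0 := by
      refine Submodule.mul_induction_on hl (fun m hm n hn => ?_) (fun x y hx hy => ?_)
      · obtain ⟨m, rfl⟩ := hm
        rw [map_mul, extAlgebraMapInv_ι, zero_mul]
      · rw [map_add, hx, hy, add_zero]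
    rw [TensorProduct.mk_apply, extScalar_tmul, this, zero_smul]
  · rw [map_add, hx, hy, add_zero]

theorem extScalar_prod_eq_zero (ev : N →ₗ[F] Module.Dual F N') {α : Type*} (a : α → S ⊗[F] N)
    (l : List α) {j : ℕ} (hj : l.length < j) {x : S ⊗[F] ExteriorAlgebra F N'}
    (hx : x ∈ extPart F S N' j) :
    extScalar S N' ((l.map fun i => tensorContract S ev (a i)).prod x) = 0 := by
  have key : ∀ k, x ∈ extPart F S N' (l.length + k) →
      (l.map fun i => tensorContract S ev (a i)).prod x ∈ extPart F S N' k := by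
    induction l generalizing x with
    | nil => intro k hk; simpa using hk
    | cons i l ih =>
      intro k hk
      rw [List.map_cons, List.prod_cons, Module.End.mul_apply]
      refine tensorContract_mem_extPart ev _ (ih (by simp at hj; omega) hx _ ?_)
      rwa [List.length_cons, add_right_comm, add_assoc] at hk
  obtain ⟨k, rfl⟩ := Nat.exists_eq_add_of_lt hj
  exact extScalar_eq_zero (key _ (by rwa [← add_assoc]))

theorem prod_tensorContract_one_tmul {α : Type*} (m : α → M) (l : List α) (s : S)
    (ν : ExteriorAlgebra F (Module.Dual F M)) :
    (l.map fun i => tensorContract S (Module.Dual.eval F M) (1 ⊗ₜ m i)).prod (s ⊗ₜ ν) =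
      s ⊗ₜ extInterior ((l.reverse.map fun i => ExteriorAlgebra.ι F (m i)).prod) ν := by
  induction l with
  | nil => simp [extInterior_one]
  | cons i l ih =>
    rw [List.map_cons, List.prod_cons, Module.End.mul_apply, ih, tensorContract_tmul, one_mul,
      List.reverse_cons, List.map_append, List.prod_append, extInterior_mul, List.map_singleton,
      List.prod_singleton, extInterior_ι, Module.End.mul_apply, interior_eq_contractExt]

variable {r : ℕ} (b : Module.Basis (Fin r) F M)

theorem sum_extPairing_smul (ν : ExteriorAlgebra F (Module.Dual F M)) :
    ∑ I, extPairing F M ν (b.ExteriorAlgebra I) • b.dualBasis.ExteriorAlgebra I = ν := by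
  have h : ∑ I, ((extPairing F M).flip (b.ExteriorAlgebra I)).smulRight
      (b.dualBasis.ExteriorAlgebra I) = LinearMap.id := by
    refine b.dualBasis.ExteriorAlgebra.ext fun J => ?_
    simp [LinearMap.sum_apply, extPairing_basis]
  simpa [LinearMap.sum_apply] using LinearMap.congr_fun h ν

/-- An element of `S ⊗ ∧M*` vanishes if all scalar components of its contractions do. -/
theorem eq_zero_of_extScalar_prod {y : S ⊗[F] ExteriorAlgebra F (Module.Dual F M)}
    (hy : ∀ l : List (Fin r), extScalar S _
      ((l.map fun i => tensorContract S (Module.Dual.eval F M) (1 ⊗ₜ b i)).prod y) = 0) :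
    y = 0 := by
  let L : Finset (Fin r) → List (Fin r) := fun I => List.ofFn (I.orderEmbOfFin rfl)
  have hL : ∀ I, ((L I).map fun i => ExteriorAlgebra.ι F (b i)).prod = b.ExteriorAlgebra I := by
    intro I
    rw [extBasis_apply, ExteriorAlgebra.ιMulti_apply, List.map_ofFn]
    rfl
  have key : ∀ y : S ⊗[F] ExteriorAlgebra F (Module.Dual F M), ∑ I, extScalar S _
      (((L I).reverse.map fun i => tensorContract S (Module.Dual.eval F M) (1 ⊗ₜ b i)).prod y) ⊗ₜ
        b.dualBasis.ExteriorAlgebra I = y := by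
    intro y
    induction y using TensorProduct.induction_on with
    | zero => simp
    | add x y hx hy =>
      simp only [map_add, TensorProduct.add_tmul, Finset.sum_add_distrib]
      rw [hx, hy]
    | tmul s ν =>
      simp only [prod_tensorContract_one_tmul, List.reverse_reverse, hL, extScalar_tmul,
        ← extPairing_apply, TensorProduct.smul_tmul]
      rw [← TensorProduct.tmul_sum, sum_extPairing_smul]
  rw [← key y]
  refine Finset.sum_eq_zero fun I _ => ?_
  rw [hy, TensorProduct.zero_tmul]

theorem ι_anticomm (i j : Fin r) : ExteriorAlgebra.ι F (b i) * ExteriorAlgebra.ι F (b j) =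
    -(ExteriorAlgebra.ι F (b j) * ExteriorAlgebra.ι F (b i)) :=
  eq_neg_of_add_eq_zero_left (ExteriorAlgebra.ι_add_mul_swap _ _)

/-- The volume form given by the dual basis; the sign compensates for the reversal of the order
under contraction. -/
theorem exists_volume : ∃ vol ∈ ⋀[F]^r (Module.Dual F M), extScalar S _
    (((List.finRange r).map fun i =>
      tensorContract S (Module.Dual.eval F M) (1 ⊗ₜ b i)).prod (1 ⊗ₜ vol)) = 1 := by
  have hperm : (List.finRange r).Perm (List.finRange r).reverse := (List.reverse_perm _).symm
  obtain ⟨ε, hε⟩ := exists_units_smul_prod_of_perm (ι_anticomm b) hperm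
  refine ⟨ε • ExteriorAlgebra.ιMulti F r b.dualBasis, ?_, ?_⟩
  · have h := ExteriorAlgebra.ιMulti_range F r ⟨b.dualBasis, rfl⟩
    rcases Int.units_eq_one_or ε with rfl | rfl
    · simpa using h
    · simpa using h
  · have h1 : ((List.finRange r).map fun i => ExteriorAlgebra.ι F (b i)).prod =
        ExteriorAlgebra.ιMulti F r b := by
      rw [ExteriorAlgebra.ιMulti_apply, List.ofFn_eq_map]
    rw [prod_tensorContract_one_tmul, extScalar_tmul, ← extPairing_apply, hε, h1]
    rcases Int.units_eq_one_or ε with rfl | rfl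
    · rw [one_smul, one_smul, extPairing_ιMulti_dualBasis, one_smul]
    · rw [Units.neg_smul, one_smul, Units.neg_smul, one_smul, map_neg, map_neg,
        LinearMap.neg_apply, neg_neg, extPairing_ιMulti_dualBasis, one_smul]

/-- The elements `1 ⊗ b i` may be replaced by the `θ i` in `eq_zero_of_extScalar_prod`, since their
multiples by the determinant of `θ` are combinations of the `θ i`. -/
theorem eq_zero_of_extScalar_prod_of_det [IsDomain S] (θ : Fin r → S ⊗[F] M)
    (hdet : (Algebra.TensorProduct.basis S b).det θ ≠ 0)
    {y : S ⊗[F] ExteriorAlgebra F (Module.Dual F M)}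
    (hy : ∀ l : List (Fin r), extScalar S _
      ((l.map fun i => tensorContract S (Module.Dual.eval F M) (θ i)).prod y) = 0) :
    y = 0 := by
  set e := Algebra.TensorProduct.basis S b
  set D := e.det θ
  let Y : Submodule S (S ⊗[F] ExteriorAlgebra F (Module.Dual F M)) :=
    ⨅ l : List (Fin r), LinearMap.ker (extScalar S _ ∘ₗ
      (l.map fun i => tensorContract S (Module.Dual.eval F M) (θ i)).prod)
  have hY : ∀ z, z ∈ Y ↔ ∀ l : List (Fin r), extScalar S _
      ((l.map fun i => tensorContract S (Module.Dual.eval F M) (θ i)).prod z) = 0 := fun z => by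
    simp [Y, Submodule.mem_iInf]
  have hθY : ∀ i, ∀ z ∈ Y, tensorContract S (Module.Dual.eval F M) (θ i) z ∈ Y := by
    intro i z hz
    refine (hY _).2 fun l => ?_
    have := (hY z).1 hz (l ++ [i])
    simpa using this
  have hspan : ∀ j, D • e j ∈ Submodule.span S (Set.range θ) := by
    intro j
    have h1 : ∑ i, (e.toMatrix θ).adjugate i j • θ i = D • e j := by
      apply e.repr.injective
      ext k
      have h2 : (e.toMatrix θ * (e.toMatrix θ).adjugate) k j =
          (D • (1 : Matrix (Fin r) (Fin r) S)) k j := by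
        rw [Matrix.mul_adjugate]
        rfl
      rw [Matrix.mul_apply] at h2
      simp only [map_sum, map_smul, Finsupp.coe_finsetSum, Finset.sum_apply, Finsupp.smul_apply,
        smul_eq_mul, Module.Basis.repr_self, Finsupp.single_apply]
      simp only [Module.Basis.toMatrix_apply, Matrix.smul_apply, Matrix.one_apply,
        smul_eq_mul] at h2
      rw [Finset.sum_congr rfl fun i _ => mul_comm _ _, h2]
      simp [eq_comm]
    rw [← h1]
    exact sum_mem fun i _ => Submodule.smul_mem _ _ (Submodule.subset_span ⟨i, rfl⟩)
  have hspanY : ∀ a ∈ Submodule.span S (Set.range θ), ∀ z ∈ Y,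
      tensorContract S (Module.Dual.eval F M) a z ∈ Y := by
    intro a ha z hz
    induction ha using Submodule.span_induction with
    | mem a ha => obtain ⟨i, rfl⟩ := ha; exact hθY i z hz
    | zero => simp
    | add a b _ _ ha hb => rw [map_add, LinearMap.add_apply]; exact add_mem ha hb
    | smul s a _ ha => rw [map_smul, LinearMap.smul_apply]; exact Submodule.smul_mem _ _ ha
  have hl : ∀ (l : List (Fin r)), D ^ l.length •
      (l.map fun i => tensorContract S (Module.Dual.eval F M) (1 ⊗ₜ b i)).prod y ∈ Y := by
    intro l
    induction l with
    | nil => simpa using (hY y).2 hy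
    | cons j l ih =>
      have h1 := hspanY _ (hspan j) _ ih
      rw [map_smul, map_smul, LinearMap.smul_apply, smul_smul, ← pow_succ] at h1
      rw [List.map_cons, List.prod_cons, Module.End.mul_apply, List.length_cons]
      rwa [Algebra.TensorProduct.basis_apply] at h1
  refine eq_zero_of_extScalar_prod b fun l => ?_
  have h1 := (hY _).1 (hl l) []
  rw [List.map_nil, List.prod_nil, Module.End.one_apply, map_smul, smul_eq_mul] at h1
  exact (mul_eq_zero.1 h1).resolve_left (pow_ne_zero _ hdet)

/-- If the determinant of the family `θ` divides `Δ`, then there are elements dual to the ordered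
products of the `θ i` up to the factor `Δ`. -/
theorem exists_dual_family (θ : Fin r → S ⊗[F] M) {Δ : S}
    (hdvd : (Algebra.TensorProduct.basis S b).det θ ∣ Δ) :
    ∃ η : Finset (Fin r) → S ⊗[F] ExteriorAlgebra F (Module.Dual F M), ∀ I J,
      extScalar S _ (ordProd (fun i => tensorContract S (Module.Dual.eval F M) (θ i)) J (η I)) =
        if J = I then Δ else 0 := by
  classical
  obtain ⟨h, rfl⟩ := hdvd
  obtain ⟨vol, hvol, hvol1⟩ := exists_volume (S := S) b
  set e := Algebra.TensorProduct.basis S b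
  set T := fun i => tensorContract S (Module.Dual.eval F M) (θ i)
  have hanti : ∀ i j, T i * T j = -(T j * T i) := fun i j => (tensorContract_sq _ _).2 _
  have hsq : ∀ i, T i * T i = 0 := fun i => (tensorContract_sq _ _).1
  have htop : extScalar S _ (((List.finRange r).map T).prod (1 ⊗ₜ vol)) = e.det θ := by
    have := prod_eq_det_smul (tensorContract S (Module.Dual.eval F M))
      (fun x => (tensorContract_sq _ x).1) e θ
    rw [this, LinearMap.smul_apply, map_smul]
    simp only [e, Algebra.TensorProduct.basis_apply]
    rw [hvol1, smul_eq_mul, mul_one]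
  have hvolpart : (1 : S) ⊗ₜ[F] vol ∈ extPart F S (Module.Dual F M) r :=
    Submodule.apply_mem_map₂ _ trivial hvol
  choose ε hε using fun I => exists_ordProd_mul_compl hanti I
  -- The contractions of the volume form by the complementary products, up to the factor `h`.
  refine ⟨fun I => ε I • h • ordProd T Iᶜ (1 ⊗ₜ vol), fun I J => ?_⟩
  have hpull : extScalar S _ (ordProd T J (ε I • h • ordProd T Iᶜ (1 ⊗ₜ vol))) =
      ε I • (h * extScalar S _ ((ordProd T J * ordProd T Iᶜ) (1 ⊗ₜ vol))) := by
    rcases Int.units_eq_one_or (ε I) with h1 | h1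
    · simp [h1, Module.End.mul_apply]
    · simp [h1, Module.End.mul_apply]
  rw [hpull]
  split_ifs with hIJ
  · subst hIJ
    rw [hε]
    have : extScalar S _ ((ε J • ((List.finRange r).map T).prod) (1 ⊗ₜ vol)) =
        ε J • e.det θ := by
      rw [← htop]
      rcases Int.units_eq_one_or (ε J) with h1 | h1 <;> simp [h1]
    rw [this, mul_smul_comm, smul_smul, Int.units_mul_self, one_smul, mul_comm]
  · by_cases hd : Disjoint J Iᶜ
    · have hcard : J.card + Iᶜ.card < r := by
        rw [← Finset.card_union_of_disjoint hd]
        refine lt_of_lt_of_eq (Finset.card_lt_univ_of_notMem (x := ?_) ?_) (Fintype.card_fin r)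
        · have hsub : J ⊂ I := lt_of_le_of_ne (by rwa [disjoint_compl_right_iff] at hd) hIJ
          exact (Finset.exists_of_ssubset hsub).choose
        · have hsub : J ⊂ I := lt_of_le_of_ne (by rwa [disjoint_compl_right_iff] at hd) hIJ
          have := (Finset.exists_of_ssubset hsub).choose_spec
          simpa using ⟨this.2, this.1⟩
      have : ordProd T J * ordProd T Iᶜ =
          ((J.sort (· ≤ ·) ++ Iᶜ.sort (· ≤ ·)).map T).prod := by
        rw [ordProd, ordProd, List.map_append, List.prod_append]
      rw [this, extScalar_prod_eq_zero _ _ _ (by simpa using hcard) hvolpart, mul_zero, smul_zero]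
    · rw [ordProd_mul_of_not_disjoint hanti hsq hd, LinearMap.zero_apply, map_zero, mul_zero,
        smul_zero]

end Separation

section UpperBound

variable {F : Type*} [Field F] {G : Type*} [Group G]
variable {V : Type*} [AddCommGroup V] [Module F V]
variable {M : Type*} [AddCommGroup M] [Module F M]

theorem jacobian_eq_det {r : ℕ} (b : Module.Basis (Fin r) F M)
    (ω : Fin r → SymmetricAlgebra F V ⊗[F] M) :
    jacobian b ω = (Algebra.TensorProduct.basis (SymmetricAlgebra F V) b).det ω := by
  rw [Module.Basis.det_apply, ← Matrix.det_transpose]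
  rfl

theorem extScalar_equivariant (ρ : Representation F G V) (σ : Representation F G M) (g : G)
    (x : SuperAlg F V M) :
    extScalar _ _ (superRep ρ σ g x) = symRep ρ g (extScalar _ _ x) := by
  induction x using TensorProduct.induction_on with
  | zero => simp
  | add x y hx hy => simp only [map_add, hx, hy]
  | tmul s l =>
    rw [superRep_apply, superMap_tmul, extScalar_tmul, extScalar_tmul, algebraMapInv_extMap,
      map_smul, symRep_apply]

theorem symRep_symComp (ρ : Representation F G V) (g : G) (d : ℕ) (f : SymmetricAlgebra F V) :
    symRep ρ g (symComp d f) = symComp d (symRep ρ g f) :=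
  (symComp_symMap _ _ _).symm

/-- An invariant acts on the quotient by the coinvariant ideal as its constant term. -/
theorem smul_mem_coinvariantIdeal {ρ : Representation F G V} (σ : Representation F G M)
    {f : SymmetricAlgebra F V} (hf : f ∈ (symRep ρ).invariants) (x : SuperAlg F V M) :
    (f - algebraMap F _ (SymmetricAlgebra.algebraMapInv f)) • x ∈ coinvariantIdeal ρ σ := by
  have h1 : f - algebraMap F _ (SymmetricAlgebra.algebraMapInv f) =
      ∑ d ∈ Finset.range (symNatDegree f), symComp (d + 1) f := by
    conv_lhs => rw [← symComp_zero_apply]; enter [1]; rw [← sum_symComp f]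
    rw [Finset.sum_range_succ', add_sub_cancel_right]
  rw [h1, Finset.sum_smul]
  refine sum_mem fun d _ => ?_
  have h2 : symComp (d + 1) f • x = (symComp (d + 1) f ⊗ₜ 1) * x := by
    induction x using TensorProduct.induction_on with
    | zero => simp
    | add x y hx hy => rw [smul_add, hx, hy, mul_add]
    | tmul s l => rw [TensorProduct.smul_tmul', Algebra.TensorProduct.tmul_mul_tmul, one_mul,
        smul_eq_mul]
  rw [h2]
  refine TwoSidedIdeal.mul_mem_right _ _ _ (TwoSidedIdeal.subset_span ⟨fun g => ?_, d + 1, 0,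
    by omega, Submodule.apply_mem_map₂ _ (symComp_mem _ _) ?_⟩)
  · have h3 : symMap (ρ g) (symComp (d + 1) f) = symComp (d + 1) f := by
      rw [← symRep_apply, symRep_symComp, hf g]
    rw [superRep_apply, superMap_tmul, map_one, h3]
  · exact mem_exteriorPower_zero.2 ⟨1, map_one _⟩

/-- Modulo the coinvariant ideal, the `χ`-semi-invariants of `S(V*) ⊗ ∧M*` are spanned by `2 ^ r`
elements, since they are combinations of a family dual to the products of the `θ i`. -/
theorem exists_sub_mem_coinvariantIdeal {ρ : Representation F G V} {σ : Representation F G M}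
    {χ : G →* Fˣ} {r : ℕ} (b : Module.Basis (Fin r) F M)
    {θ : Fin r → SymmetricAlgebra F (Module.Dual F V) ⊗[F] M}
    (hθ : ∀ i, θ i ∈ ((symRep ρ.dual).tprod σ).invariants)
    {Δ : SymmetricAlgebra F (Module.Dual F V)} (hΔ : IsVandermondian ρ.dual χ Δ)
    (hJ : jacobian b θ ∣ Δ) (hJ0 : jacobian b θ ≠ 0) :
    ∃ η : Finset (Fin r) → SuperAlg F (Module.Dual F V) (Module.Dual F M),
      ∀ x ∈ semiInvariants (superRep ρ.dual σ.dual) χ, ∃ c : Finset (Fin r) → F,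
        x - ∑ I, c I • η I ∈ coinvariantIdeal ρ.dual σ.dual := by
  classical
  rw [jacobian_eq_det] at hJ hJ0
  obtain ⟨η, hη⟩ := exists_dual_family b θ hJ
  refine ⟨η, fun x hx => ?_⟩
  set T := fun i => tensorContract (SymmetricAlgebra F (Module.Dual F V))
    (Module.Dual.eval F M) (θ i)
  have hanti : ∀ i j, T i * T j = -(T j * T i) := fun i j => (tensorContract_sq _ _).2 _
  have hsq : ∀ i, T i * T i = 0 := fun i => (tensorContract_sq _ _).1
  have hTsemi : ∀ (l : List (Fin r)) (g : G), superRep ρ.dual σ.dual g ((l.map T).prod x) =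
      (χ g : F) • (l.map T).prod x := by
    intro l g
    induction l with
    | nil => simpa using hx g
    | cons i l ih =>
      rw [List.map_cons, List.prod_cons, Module.End.mul_apply,
        tensorContract_equivariant (τ := σ) (ev := Module.Dual.eval F M) ?_, hθ i g, ih,
        LinearMap.map_smul_of_tower]
      intro g n n'
      rw [Module.Dual.eval_apply, Module.Dual.eval_apply, dual_apply_eq_dualMap,
        LinearMap.dualMap_apply, ← LinearMap.comp_apply (σ g⁻¹), inv_comp_self, LinearMap.id_apply]
  have hf : ∀ I, ∃ f ∈ (symRep ρ.dual).invariants, extScalar _ _ (ordProd T I x) = f * Δ := by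
    intro I
    refine (hΔ _).1 fun g => ?_
    rw [← extScalar_equivariant ρ.dual σ.dual, ordProd, hTsemi, LinearMap.map_smul_of_tower]
  choose f hfinv hf using hf
  have hsum : x = ∑ I, f I • η I := by
    rw [← sub_eq_zero]
    refine eq_zero_of_extScalar_prod_of_det b θ hJ0 fun l => ?_
    change extScalar _ _ ((l.map T).prod _) = 0
    by_cases hl : l.Nodup
    · obtain ⟨ε, hε⟩ := exists_prod_eq_ordProd hanti hl
      have h0 : extScalar _ _ (ordProd T l.toFinset (x - ∑ I, f I • η I)) = 0 := by
        rw [map_sub, map_sub, hf, map_sum, map_sum]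
        simp only [map_smul, T, hη, smul_eq_mul]
        simp
      rw [hε]
      rcases Int.units_eq_one_or ε with h1 | h1
      · rw [h1, one_smul, h0]
      · rw [h1, Units.neg_smul, one_smul, LinearMap.neg_apply, map_neg, h0, neg_zero]
    · rw [prod_eq_zero_of_not_nodup hanti hsq hl, LinearMap.zero_apply, map_zero]
  refine ⟨fun I => SymmetricAlgebra.algebraMapInv (f I), ?_⟩
  have : x - ∑ I, SymmetricAlgebra.algebraMapInv (f I) • η I =
      ∑ I, (f I - algebraMap F _ (SymmetricAlgebra.algebraMapInv (f I))) • η I := by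
    conv_lhs => rw [hsum]
    rw [← Finset.sum_sub_distrib]
    refine Finset.sum_congr rfl fun I _ => ?_
    rw [sub_smul, algebraMap_smul]
  rw [this]
  exact sum_mem fun I _ => smul_mem_coinvariantIdeal _ (hfinv I) _

end UpperBound

/-! ### Averaging -/

section Averaging

variable {F : Type*} [Field F] {G : Type*} [Group G] [Fintype G]
variable {A : Type*} [AddCommGroup A] [Module F A]
variable {B : Type*} [AddCommGroup B] [Module F B]

/-- The sum of `χ(g)⁻¹ g x` over `g ∈ G`. -/
def semiTrace (τ : Representation F G A) (χ : G →* Fˣ) : A →ₗ[F] A :=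
  ∑ g, ((χ g)⁻¹ : Fˣ) • τ g

theorem semiTrace_apply (τ : Representation F G A) (χ : G →* Fˣ) (x : A) :
    semiTrace τ χ x = ∑ g, (((χ g)⁻¹ : Fˣ) : F) • τ g x := by
  simp [semiTrace, LinearMap.sum_apply, Units.smul_def]

theorem semiTrace_mem (τ : Representation F G A) (χ : G →* Fˣ) (x : A) :
    semiTrace τ χ x ∈ semiInvariants τ χ := by
  intro h
  rw [semiTrace_apply, map_sum, Finset.smul_sum]
  refine Fintype.sum_equiv (Equiv.mulLeft h) _ _ fun g => ?_
  simp only [map_smul, Equiv.coe_mulLeft, map_mul, Module.End.mul_apply, smul_smul, mul_inv,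
    Units.val_mul, Units.mul_inv_cancel_left]

theorem semiTrace_of_mem {τ : Representation F G A} {χ : G →* Fˣ} {x : A}
    (hx : x ∈ semiInvariants τ χ) : semiTrace τ χ x = (Fintype.card G : F) • x := by
  rw [semiTrace_apply, Finset.sum_congr rfl fun g _ => by
    rw [hx g, smul_smul, Units.inv_mul, one_smul]]
  simp [Nat.cast_smul_eq_nsmul]

omit [Fintype G] in
theorem semiInvariants_one (τ : Representation F G A) : semiInvariants τ 1 = τ.invariants := by
  ext x
  exact forall_congr' fun g => by simp

theorem pairing_semiTrace {τ : Representation F G A} {τ' : Representation F G B}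
    {β : A →ₗ[F] B →ₗ[F] F} (hβ : ∀ g x y, β (τ g x) (τ' g y) = β x y) {χ : G →* Fˣ} {x : A}
    (hx : x ∈ semiInvariants τ χ) (y : B) :
    β x (semiTrace τ' χ⁻¹ y) = (Fintype.card G : F) * β x y := by
  have h : ∀ g, β x (τ' g y) = (((χ g)⁻¹ : Fˣ) : F) * β x y := fun g => by
    rw [← hβ g x y, hx g, map_smul, LinearMap.smul_apply, smul_eq_mul, Units.inv_mul_cancel_left]
  rw [semiTrace_apply, map_sum, Finset.sum_congr rfl fun g _ => by
    rw [map_smul, h, MonoidHom.inv_apply, inv_inv, smul_eq_mul, Units.mul_inv_cancel_left]]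
  simp

end Averaging

/-! ### Consequences of faithfulness -/

section Faithful

variable {F : Type*} [Field F] {G : Type*} [Group G]
variable {V : Type*} [AddCommGroup V] [Module F V]
variable {M : Type*} [AddCommGroup M] [Module F M]
variable {ρ : Representation F G V}

theorem eq_of_symMap_eq {p q : V →ₗ[F] V} (h : symMap p = symMap q) : p = q := by
  ext v
  rw [← sub_eq_zero, ← Module.forall_dual_apply_eq_zero_iff F]
  intro φ
  have h1 := congrArg (fun f => SymmetricAlgebra.algebraMapInv (R := F) (M := V)
    (symDeriv φ (f (SymmetricAlgebra.ι F V v)))) h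
  simp only [symMap_ι, symDeriv_ι, AlgHom.commutes, Algebra.algebraMap_self, RingHom.id_apply] at h1
  rw [map_sub, h1, sub_self]

/-- The automorphisms of the symmetric algebra given by a faithful representation are linearly
independent over the symmetric algebra. -/
theorem eq_zero_of_sum_mul_symRep_eq_zero [Fintype G] (hρ : Function.Injective ρ)
    {c : G → SymmetricAlgebra F V} (hc : ∀ f, ∑ g, c g * symRep ρ g f = 0) (g : G) : c g = 0 := by
  let φ : G → SymmetricAlgebra F V →* SymmetricAlgebra F V := fun g => symMap (ρ g)
  have h1 : Function.Injective φ := fun g h hgh =>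
    hρ (eq_of_symMap_eq (AlgHom.ext fun f => DFunLike.congr_fun hgh f))
  have h2 := (linearIndependent_monoidHom (SymmetricAlgebra F V) (SymmetricAlgebra F V)).comp _ h1
  refine Fintype.linearIndependent_iff.1 h2 c ?_ g
  funext f
  simpa [symRep_apply, φ] using hc f

/-- A Vandermondian is not zero, since there are nonzero semi-invariants for every character: the
map `semiTrace` is not zero on the symmetric algebra. -/
theorem IsVandermondian.ne_zero [Finite G] (hρ : Function.Injective ρ) {χ : G →* Fˣ}
    {Δ : SymmetricAlgebra F V} (hΔ : IsVandermondian ρ χ Δ) : Δ ≠ 0 := by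
  have := Fintype.ofFinite G
  rintro rfl
  have h : ∀ f, semiTrace (symRep ρ) χ f = 0 := fun f => by
    obtain ⟨u, -, hu⟩ := (hΔ _).1 (semiTrace_mem (symRep ρ) χ f)
    rw [hu, mul_zero]
  have h1 := eq_zero_of_sum_mul_symRep_eq_zero hρ
    (c := fun g => algebraMap F _ (((χ g)⁻¹ : Fˣ) : F))
    (fun f => by simpa only [semiTrace_apply, Algebra.smul_def] using h f) 1
  simp at h1

theorem tprod_smul (σ : Representation F G M) (g : G) (f : SymmetricAlgebra F V)
    (x : SymmetricAlgebra F V ⊗[F] M) :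
    ((symRep ρ).tprod σ) g (f • x) = symRep ρ g f • ((symRep ρ).tprod σ) g x := by
  induction x using TensorProduct.induction_on with
  | zero => simp
  | add x y hx hy => rw [smul_add, map_add, hx, hy, map_add, smul_add]
  | tmul s m =>
    rw [TensorProduct.smul_tmul', Representation.tprod_apply, TensorProduct.map_tmul,
      TensorProduct.map_tmul, TensorProduct.smul_tmul', smul_eq_mul, smul_eq_mul, symRep_mul]

/-- Basic derivations are linearly independent over the whole symmetric algebra. -/
theorem IsBasicDerivations.jacobian_ne_zero [Finite G] (hρ : Function.Injective ρ)
    {σ : Representation F G M} {r : ℕ} {θ : Fin r → SymmetricAlgebra F V ⊗[F] M}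
    (hθ : IsBasicDerivations ρ σ θ) (b : Module.Basis (Fin r) F M) : jacobian b θ ≠ 0 := by
  have := Fintype.ofFinite G
  intro h0
  obtain ⟨s, hs0, hs⟩ := Matrix.exists_vecMul_eq_zero_iff.2 h0
  have hsum : ∑ i, s i • θ i = 0 := by
    apply (Algebra.TensorProduct.basis (SymmetricAlgebra F V) b).repr.injective
    ext j
    simpa [Matrix.vecMul, dotProduct, Finsupp.coe_finsetSum] using congrFun hs j
  apply hs0
  -- The traces of all `t * s i` vanish, as they are the coefficients of an invariant relation.
  have htrace : ∀ t i, semiTrace (symRep ρ) 1 (s i * t) = 0 := by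
    intro t
    have h1 : ∑ i, semiTrace (symRep ρ) 1 (s i * t) • θ i = 0 := by
      have h2 : ∀ g i, symRep ρ g (s i * t) • θ i =
          symRep ρ g t • ((symRep ρ).tprod σ) g (s i • θ i) := fun g i => by
        rw [tprod_smul, hθ.invariant i g, smul_smul, ← symRep_mul, mul_comm]
      simp only [semiTrace_apply, MonoidHom.one_apply, inv_one, Units.val_one, one_smul,
        Finset.sum_smul, h2]
      rw [Finset.sum_comm]
      refine Finset.sum_eq_zero fun g _ => ?_
      rw [← Finset.smul_sum, ← map_sum, hsum, map_zero, smul_zero]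
    obtain ⟨c, -, hc⟩ := hθ.basis 0 (zero_mem _)
    have h3 := (hc (fun i => semiTrace (symRep ρ) 1 (s i * t))
      ⟨fun i => by rw [← semiInvariants_one]; exact semiTrace_mem _ _ _, h1.symm⟩).trans
      (hc 0 ⟨fun i => zero_mem _, by simp⟩).symm
    exact fun i => congrFun h3 i
  funext i
  have h4 := eq_zero_of_sum_mul_symRep_eq_zero hρ (c := fun g => symRep ρ g (s i))
    (fun t => by simpa [semiTrace_apply, symRep_mul] using htrace t i) 1
  simpa using h4

end Faithful

/-! ### Graded duality and Hilbert series -/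

section Duality

variable {F : Type*} [Field F] {G : Type*} [Group G]
variable {A : Type*} [AddCommGroup A] [Module F A]
variable {B : Type*} [AddCommGroup B] [Module F B]
variable {τ : Representation F G A} {τ' : Representation F G B} {β : A →ₗ[F] B →ₗ[F] F}

/-- An invariant pairing that separates the points of `X` by those of a stable subspace `Y` also
separates the `χ`-semi-invariants in `X` by the `χ⁻¹`-semi-invariants in `Y`. -/
theorem exists_semiInvariant_pairing_ne_zero [CharZero F] [Finite G]
    (hβ : ∀ g x y, β (τ g x) (τ' g y) = β x y) {X : Submodule F A} {Y : Submodule F B}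
    (hY : ∀ g, ∀ y ∈ Y, τ' g y ∈ Y) (hXY : ∀ x ∈ X, (∀ y ∈ Y, β x y = 0) → x = 0)
    {χ : G →* Fˣ} {x : A} (hx : x ∈ X) (hxχ : x ∈ semiInvariants τ χ) (h0 : x ≠ 0) :
    ∃ y ∈ Y, y ∈ semiInvariants τ' χ⁻¹ ∧ β x y ≠ 0 := by
  have := Fintype.ofFinite G
  by_contra! h
  refine h0 (hXY x hx fun y hy => ?_)
  have h1 := h (semiTrace τ' χ⁻¹ y) ?_ (semiTrace_mem _ _ _)
  · rw [pairing_semiTrace hβ hxχ] at h1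
    exact (mul_eq_zero.1 h1).resolve_left (by simp)
  · rw [semiTrace_apply]
    exact sum_mem fun g _ => Submodule.smul_mem _ _ (hY g y hy)

theorem finrank_inf_invariants_le [CharZero F] [Finite G]
    (hβ : ∀ g x y, β (τ g x) (τ' g y) = β x y) {X : Submodule F A} {Y : Submodule F B}
    [FiniteDimensional F Y] (hY : ∀ g, ∀ y ∈ Y, τ' g y ∈ Y)
    (hXY : ∀ x ∈ X, (∀ y ∈ Y, β x y = 0) → x = 0) :
    Module.finrank F ↥(X ⊓ τ.invariants) ≤ Module.finrank F ↥(Y ⊓ τ'.invariants) := by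
  let φ : ↥(X ⊓ τ.invariants) →ₗ[F] Module.Dual F ↥(Y ⊓ τ'.invariants) :=
    β.domRestrict₁₂ (X ⊓ τ.invariants) (Y ⊓ τ'.invariants)
  have hφ : Function.Injective φ := by
    rw [injective_iff_map_eq_zero]
    intro x hx
    by_contra h0
    obtain ⟨y, hyY, hy, hxy⟩ := exists_semiInvariant_pairing_ne_zero hβ hY hXY (χ := 1) x.2.1
      (by rw [semiInvariants_one]; exact x.2.2) (fun h => h0 (Subtype.ext h))
    have hy' : y ∈ τ'.invariants := by
      have h1 : (1 : G →* Fˣ)⁻¹ = 1 := by ext; simp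
      rwa [← semiInvariants_one, ← h1]
    exact hxy (LinearMap.congr_fun hx ⟨y, hyY, hy'⟩)
  have : FiniteDimensional F ↥(Y ⊓ τ'.invariants) :=
    Submodule.finiteDimensional_of_le inf_le_left
  exact (LinearMap.finrank_le_finrank_of_injective hφ).trans Subspace.dual_finrank_eq.le

end Duality

section TensorDegree

variable {F : Type*} [Field F]
variable {W : Type*} [AddCommGroup W] [Module F W]
variable {W' : Type*} [AddCommGroup W'] [Module F W']
variable {N : Type*} [AddCommGroup N] [Module F N]
variable {N' : Type*} [AddCommGroup N'] [Module F N']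

/-- The component of degree `d` of `S(W) ⊗ N`. -/
def tensorDeg (F W N : Type*) [Field F] [AddCommGroup W] [Module F W] [AddCommGroup N]
    [Module F N] (d : ℕ) : Submodule F (SymmetricAlgebra F W ⊗[F] N) :=
  Submodule.map₂ (TensorProduct.mk F (SymmetricAlgebra F W) N) (symDeg F W d) ⊤

instance [FiniteDimensional F W] (d : ℕ) : FiniteDimensional F (symDeg F W d) := by
  rw [symDeg]
  exact Module.Finite.iff_fg.2 (Submodule.FG.pow (Module.Finite.iff_fg.1 inferInstance) d)

instance [FiniteDimensional F W] [FiniteDimensional F N] (d : ℕ) :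
    FiniteDimensional F (tensorDeg F W N d) :=
  Module.Finite.iff_fg.2 (Submodule.FG.map₂ _ (Module.Finite.iff_fg.1 inferInstance)
    (Module.Finite.fg_top))

theorem symMap_mem_symDeg (p : W →ₗ[F] W') {d : ℕ} {f : SymmetricAlgebra F W}
    (hf : f ∈ symDeg F W d) : symMap p f ∈ symDeg F W' d := by
  have h := symComp_mem d (symMap p f)
  rwa [symComp_symMap, symComp_of_mem hf, if_pos rfl] at h

theorem smul_mem_tensorDeg {a d : ℕ} {f : SymmetricAlgebra F W} (hf : f ∈ symDeg F W a)
    {x : SymmetricAlgebra F W ⊗[F] N} (hx : x ∈ tensorDeg F W N d) :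
    f • x ∈ tensorDeg F W N (a + d) := by
  refine map₂_induction (fun s hs n _ => ?_) (fun x y hx hy => ?_) hx
  · rw [TensorProduct.mk_apply, TensorProduct.smul_tmul']
    exact Submodule.apply_mem_map₂ _ (mul_mem_symDeg hf hs) trivial
  · rw [smul_add]; exact add_mem hx hy

theorem map_mem_tensorDeg (p : W →ₗ[F] W') (q : N →ₗ[F] N') {d : ℕ}
    {x : SymmetricAlgebra F W ⊗[F] N} (hx : x ∈ tensorDeg F W N d) :
    TensorProduct.map (symMap p).toLinearMap q x ∈ tensorDeg F W' N' d := by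
  refine map₂_induction (fun s hs n _ => ?_) (fun x y hx hy => ?_) hx
  · rw [TensorProduct.mk_apply, TensorProduct.map_tmul]
    exact Submodule.apply_mem_map₂ _ (symMap_mem_symDeg p hs) trivial
  · rw [map_add]; exact add_mem hx hy

theorem rTensor_symComp_smul {e : ℕ} {x : SymmetricAlgebra F W ⊗[F] N}
    (hx : x ∈ tensorDeg F W N e) (d : ℕ) (f : SymmetricAlgebra F W) :
    (symComp d).rTensor N (f • x) = (if e ≤ d then symComp (d - e) f else 0) • x := by
  refine map₂_induction (fun s hs n _ => ?_) (fun x y hx hy => ?_) hx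
  · rw [TensorProduct.mk_apply, TensorProduct.smul_tmul', LinearMap.rTensor_tmul, smul_eq_mul,
      symComp_mul_of_mem hs, TensorProduct.smul_tmul']
    split_ifs <;> simp
  · rw [smul_add, map_add, hx, hy, smul_add]

theorem rTensor_symComp_of_mem {d : ℕ} {x : SymmetricAlgebra F W ⊗[F] N}
    (hx : x ∈ tensorDeg F W N d) : (symComp d).rTensor N x = x := by
  refine map₂_induction (fun s hs n _ => ?_) (fun x y hx hy => ?_) hx
  · rw [TensorProduct.mk_apply, LinearMap.rTensor_tmul, symComp_of_mem hs, if_pos rfl]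
  · rw [map_add, hx, hy]

variable {ι : Type*}

theorem repr_tmul (c : Module.Basis ι F N) (s : SymmetricAlgebra F W) (n : N) (i : ι) :
    (Algebra.TensorProduct.basis (SymmetricAlgebra F W) c).repr (s ⊗ₜ n) i = c.repr n i • s := by
  rw [Algebra.TensorProduct.basis_repr_tmul]
  simp [Algebra.smul_def, mul_comm]

theorem repr_mem_symDeg (c : Module.Basis ι F N) {d : ℕ} {x : SymmetricAlgebra F W ⊗[F] N}
    (hx : x ∈ tensorDeg F W N d) (i : ι) :
    (Algebra.TensorProduct.basis (SymmetricAlgebra F W) c).repr x i ∈ symDeg F W d := by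
  refine map₂_induction (fun s hs n _ => ?_) (fun x y hx hy => ?_) hx
  · rw [TensorProduct.mk_apply, repr_tmul]
    exact Submodule.smul_mem _ _ hs
  · rw [map_add, Finsupp.add_apply]; exact add_mem hx hy

/-- The pairing of `S(W) ⊗ N` and `S(W') ⊗ N'` given by pairings of the factors. -/
def tensorPairing (β : SymmetricAlgebra F W →ₗ[F] SymmetricAlgebra F W' →ₗ[F] F)
    (ev : N →ₗ[F] N' →ₗ[F] F) :
    SymmetricAlgebra F W ⊗[F] N →ₗ[F] SymmetricAlgebra F W' ⊗[F] N' →ₗ[F] F :=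
  (TensorProduct.map₂ β ev).compr₂ (TensorProduct.lid F F).toLinearMap

theorem tensorPairing_tmul (β : SymmetricAlgebra F W →ₗ[F] SymmetricAlgebra F W' →ₗ[F] F)
    (ev : N →ₗ[F] N' →ₗ[F] F) (f : SymmetricAlgebra F W) (n : N) (s : SymmetricAlgebra F W')
    (n' : N') : tensorPairing β ev (f ⊗ₜ n) (s ⊗ₜ n') = β f s * ev n n' := by
  simp [tensorPairing]

theorem tensorPairing_equivariant {G : Type*} [Group G] {ρ : Representation F G W}
    {ρ' : Representation F G W'} {σ : Representation F G N} {σ' : Representation F G N'}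
    {β : SymmetricAlgebra F W →ₗ[F] SymmetricAlgebra F W' →ₗ[F] F} {ev : N →ₗ[F] N' →ₗ[F] F}
    (hβ : ∀ g f s, β (symRep ρ g f) (symRep ρ' g s) = β f s)
    (hev : ∀ g n n', ev (σ g n) (σ' g n') = ev n n') (g : G) (x : SymmetricAlgebra F W ⊗[F] N)
    (y : SymmetricAlgebra F W' ⊗[F] N') :
    tensorPairing β ev (((symRep ρ).tprod σ) g x) (((symRep ρ').tprod σ') g y) =
      tensorPairing β ev x y := by
  induction x using TensorProduct.induction_on with
  | zero => simp
  | add x x' hx hx' => rw [map_add, map_add, map_add, LinearMap.add_apply, hx, hx']; rfl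
  | tmul f m =>
    induction y using TensorProduct.induction_on with
    | zero => simp
    | add y y' hy hy' => rw [map_add, map_add, map_add, hy, hy']
    | tmul s μ =>
      rw [Representation.tprod_apply, Representation.tprod_apply, TensorProduct.map_tmul,
        TensorProduct.map_tmul, tensorPairing_tmul, tensorPairing_tmul, hβ, hev]

theorem tensorPairing_separating {β : SymmetricAlgebra F W →ₗ[F] SymmetricAlgebra F W' →ₗ[F] F}
    {ev : N →ₗ[F] N' →ₗ[F] F} {d : ℕ}
    (hβ : ∀ f ∈ symDeg F W d, (∀ s ∈ symDeg F W' d, β f s = 0) → f = 0)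
    (c : Module.Basis ι F N) {c' : ι → N'} (hc : ∀ n i, ev n (c' i) = c.repr n i)
    {x : SymmetricAlgebra F W ⊗[F] N} (hx : x ∈ tensorDeg F W N d)
    (h : ∀ y ∈ tensorDeg F W' N' d, tensorPairing β ev x y = 0) : x = 0 := by
  have key : ∀ (x : SymmetricAlgebra F W ⊗[F] N) s i, tensorPairing β ev x (s ⊗ₜ c' i) =
      β ((Algebra.TensorProduct.basis (SymmetricAlgebra F W) c).repr x i) s := by
    intro x s i
    induction x using TensorProduct.induction_on with
    | zero => simp
    | add x y hx hy => simp [hx, hy]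
    | tmul f n =>
      rw [tensorPairing_tmul, hc, repr_tmul, map_smul, LinearMap.smul_apply, smul_eq_mul, mul_comm]
  apply (Algebra.TensorProduct.basis (SymmetricAlgebra F W) c).repr.injective
  ext i
  rw [map_zero, Finsupp.zero_apply]
  refine hβ _ (repr_mem_symDeg c hx i) fun s hs => ?_
  rw [← key]
  exact h _ (Submodule.apply_mem_map₂ _ hs trivial)

end TensorDegree

section PairingSeparating

variable {F : Type*} [Field F]
variable {V : Type*} [AddCommGroup V] [Module F V]

theorem symPairing_eq_zero_of_ne {a d : ℕ} (had : a ≠ d) {s : SymmetricAlgebra F V}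
    (hs : s ∈ symDeg F V a) {f : SymmetricAlgebra F (Module.Dual F V)}
    (hf : f ∈ symDeg F (Module.Dual F V) d) : symPairing F V f s = 0 := by
  rw [symPairing_apply]
  rcases lt_or_gt_of_ne had with h | h
  · obtain ⟨k, rfl⟩ := Nat.exists_eq_add_of_lt h
    have h1 := symDiff_mem_symDeg hs (d := k + 1) (by rwa [show k + 1 + a = a + k + 1 by ring])
    have h2 := symComp_of_mem h1 0
    rw [if_neg (by omega), symComp_zero_apply] at h2
    simpa using h2
  · rw [symDiff_eq_zero h hs hf, map_zero]

variable [CharZero F] [FiniteDimensional F V]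

theorem symPairing_separating_left {d : ℕ} {f : SymmetricAlgebra F (Module.Dual F V)}
    (hf : f ∈ symDeg F (Module.Dual F V) d)
    (h : ∀ s ∈ symDeg F V d, symPairing F V f s = 0) : f = 0 := by
  classical
  let b := Module.finBasis F V
  have h1 : ∀ α, symPairing F V f (b.symmetricAlgebra α) = 0 := fun α => by
    by_cases hα : α.degree = d
    · exact h _ (hα ▸ symmetricAlgebra_basis_mem_symDeg b α)
    · exact symPairing_eq_zero_of_ne hα (symmetricAlgebra_basis_mem_symDeg b α) hf
  apply b.dualBasis.symmetricAlgebra.repr.injective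
  ext α
  have h2 : symPairing F V f (b.symmetricAlgebra α) =
      b.dualBasis.symmetricAlgebra.repr f α * (α.prod fun _ n => n.factorial : ℕ) := by
    conv_lhs => rw [← b.dualBasis.symmetricAlgebra.linearCombination_repr f]
    rw [Finsupp.linearCombination_apply, Finsupp.sum, map_sum, LinearMap.sum_apply]
    simp only [map_smul, LinearMap.smul_apply, symPairing_basis, smul_eq_mul, mul_ite, mul_zero]
    rw [Finset.sum_ite_eq']
    split_ifs with h3
    · rfl
    · rw [Finsupp.notMem_support_iff.1 h3, zero_mul]
  rw [h1] at h2
  rw [map_zero, Finsupp.zero_apply]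
  refine (mul_eq_zero.1 h2.symm).resolve_right ?_
  exact_mod_cast Finset.prod_ne_zero_iff.2 fun i _ => Nat.factorial_ne_zero _

theorem symPairing_separating_right {d : ℕ} {s : SymmetricAlgebra F V} (hs : s ∈ symDeg F V d)
    (h : ∀ f ∈ symDeg F (Module.Dual F V) d, symPairing F V f s = 0) : s = 0 := by
  classical
  let b := Module.finBasis F V
  have h1 : ∀ α, symPairing F V (b.dualBasis.symmetricAlgebra α) s = 0 := fun α => by
    by_cases hα : α.degree = d
    · exact h _ (hα ▸ symmetricAlgebra_basis_mem_symDeg b.dualBasis α)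
    · exact symPairing_eq_zero_of_ne (Ne.symm hα) hs (symmetricAlgebra_basis_mem_symDeg _ α)
  apply b.symmetricAlgebra.repr.injective
  ext α
  have h2 : symPairing F V (b.dualBasis.symmetricAlgebra α) s =
      b.symmetricAlgebra.repr s α * (α.prod fun _ n => n.factorial : ℕ) := by
    conv_lhs => rw [← b.symmetricAlgebra.linearCombination_repr s]
    rw [Finsupp.linearCombination_apply, Finsupp.sum, map_sum]
    simp only [map_smul, symPairing_basis, smul_eq_mul, mul_ite, mul_zero]
    rw [Finset.sum_ite_eq]
    split_ifs with h3
    · rfl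
    · rw [Finsupp.notMem_support_iff.1 h3, zero_mul]
  rw [h1] at h2
  rw [map_zero, Finsupp.zero_apply]
  refine (mul_eq_zero.1 h2.symm).resolve_right ?_
  exact_mod_cast Finset.prod_ne_zero_iff.2 fun i _ => Nat.factorial_ne_zero _

end PairingSeparating

section HilbertSeries

variable {F : Type*} [Field F] {G : Type*} [Group G]
variable {V : Type*} [AddCommGroup V] [Module F V] [FiniteDimensional F V]
variable {M : Type*} [AddCommGroup M] [Module F M]

/-- The dimensions of the graded pieces of the module of invariants of `S(V) ⊗ M`, in terms of
those of the ring of invariants. -/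
theorem IsBasicDerivations.finrank_tensorDeg {ρ : Representation F G V} {σ : Representation F G M}
    {r : ℕ} {θ : Fin r → SymmetricAlgebra F V ⊗[F] M} (hθ : IsBasicDerivations ρ σ θ)
    {e : Fin r → ℕ} (he : ∀ i, θ i ∈ tensorDeg F V M (e i)) (d : ℕ) :
    Module.finrank F ↥(tensorDeg F V M d ⊓ ((symRep ρ).tprod σ).invariants) =
      ∑ i, if e i ≤ d then
        Module.finrank F ↥(symDeg F V (d - e i) ⊓ (symRep ρ).invariants) else 0 := by
  let R : Fin r → Submodule F (SymmetricAlgebra F V) := fun i =>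
    if e i ≤ d then symDeg F V (d - e i) ⊓ (symRep ρ).invariants else ⊥
  have hRpos : ∀ i, e i ≤ d → R i = symDeg F V (d - e i) ⊓ (symRep ρ).invariants :=
    fun i hi => if_pos hi
  have hRneg : ∀ i, ¬ e i ≤ d → R i = ⊥ := fun i hi => if_neg hi
  have hR : ∀ i, ∀ f ∈ R i, f ∈ (symRep ρ).invariants := by
    intro i f hf
    simp only [R] at hf
    split_ifs at hf
    · exact hf.2
    · rw [(Submodule.mem_bot F).1 hf]; exact zero_mem _
  have hfin : ∀ i, FiniteDimensional F (R i) := fun i => by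
    by_cases hi : e i ≤ d
    · rw [hRpos i hi]; exact Submodule.finiteDimensional_of_le inf_le_left
    · rw [hRneg i hi]; infer_instance
  let Φ : (∀ i, R i) →ₗ[F] SymmetricAlgebra F V ⊗[F] M :=
    ∑ i, (LinearMap.toSpanSingleton (SymmetricAlgebra F V) _ (θ i)).restrictScalars F ∘ₗ
      (R i).subtype ∘ₗ LinearMap.proj i
  have hΦ : ∀ c, Φ c = ∑ i, (c i : SymmetricAlgebra F V) • θ i := fun c => by
    simp [Φ, LinearMap.sum_apply]
  have hinj : Function.Injective Φ := by
    rw [injective_iff_map_eq_zero]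
    intro c hc
    obtain ⟨c₀, -, hc₀⟩ := hθ.basis 0 (zero_mem _)
    have h1 := (hc₀ (fun i => c i) ⟨fun i => hR i _ (c i).2, by rw [← hΦ, hc]⟩).trans
      (hc₀ 0 ⟨fun i => zero_mem _, by simp⟩).symm
    funext i
    exact Subtype.ext (congrFun h1 i)
  have hrange : LinearMap.range Φ =
      tensorDeg F V M d ⊓ ((symRep ρ).tprod σ).invariants := by
    apply le_antisymm
    · rintro _ ⟨c, rfl⟩
      rw [hΦ]
      refine sum_mem fun i _ => ⟨?_, fun g => ?_⟩
      · have h := (c i).2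
        simp only [R] at h
        split_ifs at h with hi
        · have h1 := smul_mem_tensorDeg h.1 (he i)
          rwa [Nat.sub_add_cancel hi] at h1
        · rw [(Submodule.mem_bot F).1 h, zero_smul]; exact zero_mem _
      · rw [tprod_smul, hθ.invariant i g, hR i _ (c i).2 g]
    · rintro x ⟨hxd, hx⟩
      obtain ⟨c, ⟨hc, hxc⟩, -⟩ := hθ.basis x hx
      refine ⟨fun i => ⟨if e i ≤ d then symComp (d - e i) (c i) else 0, ?_⟩, ?_⟩
      · simp only [R]
        split_ifs
        · refine ⟨symComp_mem _ _, fun g => ?_⟩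
          rw [symRep_symComp, hc i g]
        · exact zero_mem _
      · rw [hΦ, ← rTensor_symComp_of_mem hxd, hxc, map_sum]
        exact Finset.sum_congr rfl fun i _ => (rTensor_symComp_smul (he i) _ _).symm
  rw [← hrange, LinearMap.finrank_range_of_inj hinj, Module.finrank_pi_fintype]
  refine Finset.sum_congr rfl fun i _ => ?_
  split_ifs with hi
  · rw [hRpos i hi]
  · rw [hRneg i hi, finrank_bot]

/-- The exponents are recovered, up to their sum, from the product of the polynomial `∑ X ^ e i` and
the nonzero power series with coefficients `H`. -/
theorem sum_eq_sum_of_shifted_sums_eq {r : ℕ} {H : ℕ → ℕ} (hH : H 0 ≠ 0) {e e' : Fin r → ℕ}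
    (h : ∀ d, (∑ i, if e i ≤ d then H (d - e i) else 0) =
      ∑ i, if e' i ≤ d then H (d - e' i) else 0) : ∑ i, e i = ∑ i, e' i := by
  let P : (Fin r → ℕ) → Polynomial ℤ := fun e => ∑ i, Polynomial.X ^ e i
  let Q : PowerSeries ℤ := PowerSeries.mk fun d => (H d : ℤ)
  have hQ : Q ≠ 0 := fun h0 => hH (by simpa [Q] using congrArg (PowerSeries.coeff 0) h0)
  have hcoeff : ∀ e : Fin r → ℕ, ∀ d, PowerSeries.coeff d ((P e : PowerSeries ℤ) * Q) =
      ((∑ i, if e i ≤ d then H (d - e i) else 0 : ℕ) : ℤ) := by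
    intro e d
    have h1 : (P e : PowerSeries ℤ) = ∑ i, (PowerSeries.X : PowerSeries ℤ) ^ e i := by
      change Polynomial.coeToPowerSeries.ringHom (∑ i, Polynomial.X ^ e i) = _
      rw [map_sum]
      simp only [map_pow, Polynomial.coeToPowerSeries.ringHom_apply, Polynomial.coe_X]
    rw [h1, Finset.sum_mul, map_sum, Nat.cast_sum]
    refine Finset.sum_congr rfl fun i _ => ?_
    rw [PowerSeries.coeff_X_pow_mul']
    split_ifs <;> simp [Q]
  have hP : P e = P e' := by
    apply Polynomial.coe_injective ℤ
    apply mul_right_cancel₀ hQ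
    ext d
    rw [hcoeff, hcoeff, h]
  have h2 : ∀ e : Fin r → ℕ, (Polynomial.derivative (P e)).eval 1 = ((∑ i, e i : ℕ) : ℤ) := by
    intro e
    simp [P, Polynomial.eval_finsetSum, Polynomial.derivative_X_pow]
  have h3 := h2 e
  rw [hP, h2 e'] at h3
  exact_mod_cast h3.symm

/-- Basic derivations for `M` over `S(V*)` and for `M*` over `S(V)` have the same total degree,
by comparison of Hilbert series. -/
theorem sum_degrees_eq [CharZero F] [Finite G] {ρ : Representation F G V}
    {σ : Representation F G M} {r : ℕ} (b : Module.Basis (Fin r) F M)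
    {θ : Fin r → SymmetricAlgebra F (Module.Dual F V) ⊗[F] M}
    (hθ : IsBasicDerivations ρ.dual σ θ)
    {ω : Fin r → SymmetricAlgebra F V ⊗[F] Module.Dual F M} (hω : IsBasicDerivations ρ σ.dual ω)
    {e e' : Fin r → ℕ} (he : ∀ i, θ i ∈ tensorDeg F (Module.Dual F V) M (e i))
    (he' : ∀ i, ω i ∈ tensorDeg F V (Module.Dual F M) (e' i)) : ∑ i, e i = ∑ i, e' i := by
  classical
  have : FiniteDimensional F M := Module.Finite.of_basis b
  have hinv : ∀ g x y, symPairing F V (symRep ρ.dual g x) (symRep ρ g y) = symPairing F V x y :=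
    fun g x y => symPairing_equivariant ρ g y x
  have hR : ∀ d, Module.finrank F ↥(symDeg F (Module.Dual F V) d ⊓ (symRep ρ.dual).invariants) =
      Module.finrank F ↥(symDeg F V d ⊓ (symRep ρ).invariants) := fun d =>
    le_antisymm
      (finrank_inf_invariants_le hinv (fun g y hy => symMap_mem_symDeg _ hy)
        fun f hf h => symPairing_separating_left hf h)
      (finrank_inf_invariants_le (β := (symPairing F V).flip) (fun g x y => hinv g y x)
        (fun g y hy => symMap_mem_symDeg _ hy) fun s hs h => symPairing_separating_right hs h)
  have hev' : ∀ g (μ : Module.Dual F M) m, LinearMap.id (R := F) (σ.dual g μ) (σ g m) = μ m :=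
    fun g μ m => by
      rw [LinearMap.id_apply, dual_apply_eq_dualMap, LinearMap.dualMap_apply,
        ← LinearMap.comp_apply (σ g⁻¹), inv_comp_self, LinearMap.id_apply]
  have hev : ∀ g m (μ : Module.Dual F M),
      Module.Dual.eval F M (σ g m) (σ.dual g μ) = Module.Dual.eval F M m μ :=
    fun g m μ => hev' g μ m
  -- The natural pairing of `S(V*) ⊗ M` and `S(V) ⊗ M*` is perfect in each degree.
  have hU : ∀ d, Module.finrank F ↥(tensorDeg F (Module.Dual F V) M d ⊓
        ((symRep ρ.dual).tprod σ).invariants) =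
      Module.finrank F ↥(tensorDeg F V (Module.Dual F M) d ⊓
        ((symRep ρ).tprod σ.dual).invariants) := fun d =>
    le_antisymm
      (finrank_inf_invariants_le (tensorPairing_equivariant hinv hev) (fun g y hy => map_mem_tensorDeg (ρ g) (σ.dual g) hy)
        fun x hx h => tensorPairing_separating (fun f hf h => symPairing_separating_left hf h) b
          (c' := b.dualBasis) (by simp) hx h)
      (finrank_inf_invariants_le (β := tensorPairing (symPairing F V).flip LinearMap.id)
        (tensorPairing_equivariant (fun g x y => hinv g y x) hev')
        (fun g y hy => map_mem_tensorDeg (ρ.dual g) (σ g) hy)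
        fun x hx h => tensorPairing_separating (fun s hs h => symPairing_separating_right hs h)
          b.dualBasis (c' := b) (fun μ i => by simp) hx h)
  refine sum_eq_sum_of_shifted_sums_eq
    (H := fun d => Module.finrank F ↥(symDeg F V d ⊓ (symRep ρ).invariants)) ?_ fun d => ?_
  · have : FiniteDimensional F ↥(symDeg F V 0 ⊓ (symRep ρ).invariants) :=
      Submodule.finiteDimensional_of_le inf_le_left
    have h1 : (1 : SymmetricAlgebra F V) ∈ symDeg F V 0 ⊓ (symRep ρ).invariants :=
      ⟨mem_symDeg_zero.2 ⟨1, map_one _⟩, fun g => by rw [symRep_apply, map_one]⟩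
    have : Nontrivial ↥(symDeg F V 0 ⊓ (symRep ρ).invariants) :=
      ⟨⟨1, h1⟩, 0, fun h => one_ne_zero (congrArg Subtype.val h)⟩
    exact Module.finrank_pos.ne'
  · rw [← hω.finrank_tensorDeg he', ← hU, hθ.finrank_tensorDeg he]
    simp only [hR]

end HilbertSeries

/-! ### Jacobians -/

section Jacobian

variable {F : Type*} [Field F] {G : Type*} [Group G]
variable {V : Type*} [AddCommGroup V] [Module F V]
variable {M : Type*} [AddCommGroup M] [Module F M]
variable {r : ℕ} (b : Module.Basis (Fin r) F M)

theorem prod_mem_symDeg {α : Type*} (s : Finset α) {e : α → ℕ} {f : α → SymmetricAlgebra F V}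
    (hf : ∀ i ∈ s, f i ∈ symDeg F V (e i)) : ∏ i ∈ s, f i ∈ symDeg F V (∑ i ∈ s, e i) := by
  classical
  induction s using Finset.induction_on with
  | empty =>
    rw [Finset.prod_empty, Finset.sum_empty]
    exact mem_symDeg_zero.2 ⟨1, map_one _⟩
  | insert i s hi ih =>
    rw [Finset.prod_insert hi, Finset.sum_insert hi]
    exact mul_mem_symDeg (hf i (Finset.mem_insert_self i s))
      (ih fun j hj => hf j (Finset.mem_insert_of_mem hj))

theorem jacobian_mem_symDeg {θ : Fin r → SymmetricAlgebra F V ⊗[F] M} {e : Fin r → ℕ}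
    (he : ∀ i, θ i ∈ tensorDeg F V M (e i)) : jacobian b θ ∈ symDeg F V (∑ i, e i) := by
  rw [jacobian, Matrix.det_apply']
  refine sum_mem fun π _ => ?_
  rw [← zsmul_eq_mul, ← Equiv.sum_comp π e]
  exact zsmul_mem (prod_mem_symDeg _ fun i _ => repr_mem_symDeg b (he _) _) _

/-- The determinant character of a representation. -/
def detChar (σ : Representation F G M) : G →* Fˣ :=
  (LinearMap.det.comp σ).toHomUnits

theorem detChar_apply (σ : Representation F G M) (g : G) :
    (detChar σ g : F) = LinearMap.det (σ g) := rfl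

theorem detChar_dual [FiniteDimensional F M] (σ : Representation F G M) : detChar σ.dual = (detChar σ)⁻¹ := by
  ext g
  rw [MonoidHom.inv_apply, ← map_inv, detChar_apply, detChar_apply, dual_apply_eq_dualMap,
    LinearMap.det_dualMap]

theorem repr_tprod (ρ : Representation F G V) (σ : Representation F G M) (g : G)
    (x : SymmetricAlgebra F V ⊗[F] M) (k : Fin r) :
    (Algebra.TensorProduct.basis (SymmetricAlgebra F V) b).repr (((symRep ρ).tprod σ) g x) k =
      ∑ j, symRep ρ g ((Algebra.TensorProduct.basis (SymmetricAlgebra F V) b).repr x j) *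
        algebraMap F _ (LinearMap.toMatrix b b (σ g) k j) := by
  induction x using TensorProduct.induction_on with
  | zero => simp
  | add x y hx hy => simp only [map_add, Finsupp.add_apply, hx, hy, add_mul, Finset.sum_add_distrib]
  | tmul s m =>
    rw [Representation.tprod_apply, TensorProduct.map_tmul, repr_tmul,
      ← LinearMap.toMatrix_mulVec_repr b b, Matrix.mulVec, dotProduct, Finset.sum_smul]
    refine Finset.sum_congr rfl fun j _ => ?_
    rw [repr_tmul, map_smul]
    simp only [Algebra.smul_def, map_mul]
    ring

theorem jacobian_mem_semiInvariants {ρ : Representation F G V} {σ : Representation F G M}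
    {θ : Fin r → SymmetricAlgebra F V ⊗[F] M} (hθ : ∀ i, θ i ∈ ((symRep ρ).tprod σ).invariants) :
    jacobian b θ ∈ semiInvariants (symRep ρ) (detChar σ)⁻¹ := by
  intro g
  set A : Matrix (Fin r) (Fin r) (SymmetricAlgebra F V) := Matrix.of fun i j =>
    (Algebra.TensorProduct.basis (SymmetricAlgebra F V) b).repr (θ i) j
  have h1 : A = A.map (symMap (ρ g)) *
      ((LinearMap.toMatrix b b (σ g)).map (algebraMap F (SymmetricAlgebra F V))).transpose := by
    ext i k
    simp only [A, Matrix.of_apply, Matrix.mul_apply, Matrix.map_apply, Matrix.transpose_apply]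
    conv_lhs => rw [← hθ i g, repr_tprod]
    rfl
  have h2 : jacobian b θ = symRep ρ g (jacobian b θ) * algebraMap F _ (detChar σ g : F) := by
    change A.det = symMap (ρ g) A.det * _
    conv_lhs => rw [h1]
    rw [Matrix.det_mul, Matrix.det_transpose, detChar_apply, ← LinearMap.det_toMatrix b,
      RingHom.map_det, AlgHom.map_det]
    rfl
  conv_rhs => rw [h2]
  rw [mul_comm, ← Algebra.smul_def, smul_smul, MonoidHom.inv_apply, Units.inv_mul, one_smul]

end Jacobian

section TopDegree

variable {F : Type*} [Field F] {G : Type*} [Group G]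
variable {V : Type*} [AddCommGroup V] [Module F V]
variable {M : Type*} [AddCommGroup M] [Module F M]

theorem mul_mem_semiInvariants {ρ : Representation F G V} {χ χ' : G →* Fˣ}
    {f f' : SymmetricAlgebra F V} (hf : f ∈ semiInvariants (symRep ρ) χ)
    (hf' : f' ∈ semiInvariants (symRep ρ) χ') : f * f' ∈ semiInvariants (symRep ρ) (χ * χ') := by
  intro g
  rw [symRep_mul, hf g, hf' g, smul_mul_smul_comm, MonoidHom.mul_apply, Units.val_mul]

theorem mem_semiInvariants_of_mul_mem {ρ : Representation F G V} {χ χ' : G →* Fˣ}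
    {f f' : SymmetricAlgebra F V} (hf0 : f ≠ 0) (hf : f ∈ semiInvariants (symRep ρ) χ)
    (hff' : f * f' ∈ semiInvariants (symRep ρ) χ') :
    f' ∈ semiInvariants (symRep ρ) (χ⁻¹ * χ') := by
  intro g
  have h := hff' g
  rw [symRep_mul, hf g, smul_mul_assoc, ← mul_smul_comm, ← mul_smul_comm] at h
  rw [MonoidHom.mul_apply, MonoidHom.inv_apply, Units.val_mul, mul_smul, ← mul_left_cancel₀ hf0 h,
    smul_smul, Units.inv_mul, one_smul]

/-- The differential operator given by the jacobian of `ω` does not annihilate `Δ`. Indeed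
`Δ = J h` for the jacobian `J` of `θ`; pairing the leading component of `h` with the
semi-invariants yields an `h'` such that the product of `h'` with the jacobian of `ω` is a
semi-invariant of the degree of `Δ`, and in this degree `Δ` is the only semi-invariant up to
scalars with which it can pair nontrivially. -/
theorem symDiff_jacobian_ne_zero [CharZero F] [Finite G] [FiniteDimensional F V]
    {ρ : Representation F G V} (hρ : Function.Injective ρ) (hρ' : Function.Injective ρ.dual)
    {σ : Representation F G M} {r : ℕ} (b : Module.Basis (Fin r) F M) {χ : G →* Fˣ}
    {θ : Fin r → SymmetricAlgebra F (Module.Dual F V) ⊗[F] M}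
    (hθ : IsBasicDerivations ρ.dual σ θ)
    {ω : Fin r → SymmetricAlgebra F V ⊗[F] Module.Dual F M} (hω : IsBasicDerivations ρ σ.dual ω)
    {Δ : SymmetricAlgebra F (Module.Dual F V)} (hΔ : IsVandermondian ρ.dual χ Δ)
    (hJ : jacobian b θ ∣ Δ) : symDiff F V (jacobian b.dualBasis ω) Δ ≠ 0 := by
  intro hzero
  have := Module.Finite.of_basis b
  have hΔ0 := hΔ.ne_zero hρ'
  obtain ⟨h, hh⟩ := hJ
  choose e he using hθ.homogeneous
  choose e' he' using hω.homogeneous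
  have hee' := sum_degrees_eq b hθ hω he he'
  set J := jacobian b θ
  set J' := jacobian b.dualBasis ω
  have hJ0 : J ≠ 0 := hθ.jacobian_ne_zero hρ' b
  have hJ'0 : J' ≠ 0 := hω.jacobian_ne_zero hρ b.dualBasis
  have hJd : J ∈ symDeg F _ (∑ i, e i) := jacobian_mem_symDeg b he
  have hJ'd : J' ∈ symDeg F _ (∑ i, e i) := hee' ▸ jacobian_mem_symDeg b.dualBasis he'
  have hJχ : J ∈ semiInvariants (symRep ρ.dual) (detChar σ)⁻¹ :=
    jacobian_mem_semiInvariants b hθ.invariant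
  have hJ'χ : J' ∈ semiInvariants (symRep ρ) (detChar σ) := by
    have := jacobian_mem_semiInvariants b.dualBasis hω.invariant
    have h1 : (detChar σ.dual)⁻¹ = detChar σ := by rw [detChar_dual]; ext g; simp
    rwa [h1] at this
  have hh0 : h ≠ 0 := by rintro rfl; exact hΔ0 (by rw [hh, mul_zero])
  have hhχ := mem_semiInvariants_of_mul_mem hJ0 hJχ (hh ▸ hΔ.mem_semiInvariants)
  have hdeg : symNatDegree Δ = ∑ i, e i + symNatDegree h := by
    rw [hh, symNatDegree_mul hJ0 hh0, symNatDegree_of_mem hJd hJ0]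
  have hinv : ∀ g x y, symPairing F V (symRep ρ.dual g x) (symRep ρ g y) = symPairing F V x y :=
    fun g x y => symPairing_equivariant ρ g y x
  obtain ⟨h', hh'd, hh'χ, hh'⟩ := exists_semiInvariant_pairing_ne_zero hinv
    (X := symDeg F (Module.Dual F V) (symNatDegree h)) (Y := symDeg F V (symNatDegree h))
    (fun g y hy => symMap_mem_symDeg _ hy) (fun f hf h => symPairing_separating_left hf h)
    (symComp_mem (symNatDegree h) h) (fun g => by rw [symRep_symComp, hhχ g, map_smul])
    (symComp_natDegree_ne_zero hh0)
  have hh'0 : h' ≠ 0 := by rintro rfl; exact hh' (map_zero _)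
  have hpχ : h' * J' ∈ semiInvariants (symRep ρ) χ⁻¹ := by
    have := mul_mem_semiInvariants hh'χ hJ'χ
    have h1 : ((detChar σ)⁻¹⁻¹ * χ)⁻¹ * detChar σ = χ⁻¹ := by ext g; simp
    rwa [h1] at this
  have hpd : h' * J' ∈ symDeg F V (symNatDegree Δ) := by
    rw [hdeg, add_comm]; exact mul_mem_symDeg hh'd hJ'd
  obtain ⟨u, hud, huχ, hu⟩ := exists_semiInvariant_pairing_ne_zero (β := (symPairing F V).flip)
    (fun g x y => hinv g y x) (X := symDeg F V (symNatDegree Δ))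
    (Y := symDeg F (Module.Dual F V) (symNatDegree Δ)) (fun g y hy => symMap_mem_symDeg _ hy)
    (fun s hs h => symPairing_separating_right hs h) hpd hpχ (mul_ne_zero hh'0 hJ'0)
  have h1 : χ⁻¹⁻¹ = χ := by ext g; simp
  rw [h1] at huχ
  rw [LinearMap.flip_apply] at hu
  obtain ⟨f, -, rfl⟩ := (hΔ u).1 huχ
  have hf0 : f ≠ 0 := by rintro rfl; simp at hu
  have hfdeg : symNatDegree f = 0 := by
    have := symNatDegree_of_mem hud (mul_ne_zero hf0 hΔ0)
    rw [symNatDegree_mul hf0 hΔ0] at this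
    omega
  have hfc : f = algebraMap F _ (SymmetricAlgebra.algebraMapInv f) := by
    conv_lhs => rw [← sum_symComp f, hfdeg]
    simp [symComp_zero_apply]
  rw [hfc, ← Algebra.smul_def, map_smul, LinearMap.smul_apply, symPairing_apply, map_mul,
    Module.End.mul_apply, hzero, map_zero, map_zero, smul_zero] at hu
  exact hu rfl

end TopDegree

/-! ### Independence of the alternants -/

section Independence

variable {F : Type*} [Field F]
variable {S : Type*} [CommRing S] [Algebra F S]
variable {N : Type*} [AddCommGroup N] [Module F N]

/-- The inclusion of `S ⊗ N` into `S ⊗ ∧N`. -/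
def tensorι (S N : Type*) [CommRing S] [Algebra F S] [AddCommGroup N] [Module F N] :
    S ⊗[F] N →ₗ[S] S ⊗[F] ExteriorAlgebra F N :=
  (ExteriorAlgebra.ι F).baseChange S

theorem tensorι_tmul (s : S) (n : N) :
    tensorι (F := F) S N (s ⊗ₜ n) = s ⊗ₜ ExteriorAlgebra.ι F n := by
  simp [tensorι]

theorem tensorι_anticomm (a b : S ⊗[F] N) :
    tensorι (F := F) S N a * tensorι (F := F) S N b =
      -(tensorι (F := F) S N b * tensorι (F := F) S N a) := by
  induction a using TensorProduct.induction_on with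
  | zero => simp
  | add a a' ha ha' => rw [map_add, add_mul, ha, ha', mul_add, neg_add]
  | tmul s n =>
    induction b using TensorProduct.induction_on with
    | zero => simp
    | add b b' hb hb' => rw [map_add, mul_add, hb, hb', add_mul, neg_add]
    | tmul t n' =>
      rw [tensorι_tmul, tensorι_tmul, Algebra.TensorProduct.tmul_mul_tmul,
        Algebra.TensorProduct.tmul_mul_tmul, ← TensorProduct.tmul_neg, mul_comm s,
        eq_neg_of_add_eq_zero_left (ExteriorAlgebra.ι_add_mul_swap n n')]

theorem tensorι_sq (a : S ⊗[F] N) : tensorι (F := F) S N a * tensorι (F := F) S N a = 0 := by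
  induction a using TensorProduct.induction_on with
  | zero => simp
  | add a b ha hb => rw [map_add, add_mul, mul_add, mul_add, ha, hb, tensorι_anticomm a b]; abel
  | tmul s n =>
    rw [tensorι_tmul, Algebra.TensorProduct.tmul_mul_tmul, ExteriorAlgebra.ι_sq_zero,
      TensorProduct.tmul_zero]

variable {V : Type*} [AddCommGroup V] [Module F V]
variable {M : Type*} [AddCommGroup M] [Module F M]

theorem dStar_eq (a : SymmetricAlgebra F V ⊗[F] Module.Dual F M) :
    dStar a = superAct F V M (tensorι (F := F) _ _ a) := rfl

theorem dStar_anticomm (a b : SymmetricAlgebra F V ⊗[F] Module.Dual F M) :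
    dStar a * dStar b = -(dStar b * dStar a) := by
  rw [dStar_eq, dStar_eq, ← superAct_mul, ← superAct_mul, tensorι_anticomm, map_neg]

theorem dStar_sq (a : SymmetricAlgebra F V ⊗[F] Module.Dual F M) : dStar a * dStar a = 0 := by
  rw [dStar_eq, ← superAct_mul, tensorι_sq, map_zero]

/-- The product of all `d*` maps `Δ ⊗ 1` to `∂_J Δ ⊗ vol`, where `J` is the jacobian of `ω`. -/
theorem prod_dStar_apply_ne_zero {r : ℕ} (b : Module.Basis (Fin r) F M)
    {ω : Fin r → SymmetricAlgebra F V ⊗[F] Module.Dual F M}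
    {Δ : SymmetricAlgebra F (Module.Dual F V)}
    (h : symDiff F V (jacobian b.dualBasis ω) Δ ≠ 0) :
    ((List.finRange r).map fun i => dStar (ω i)).prod (Δ ⊗ₜ[F] 1) ≠ 0 := by
  have h1 : ∀ l : List (Fin r), (l.map fun i => dStar (ω i)).prod =
      superAct F V M (l.map fun i => tensorι (F := F) _ _ (ω i)).prod := by
    intro l
    induction l with
    | nil => exact superAct_one.symm
    | cons i l ih =>
      rw [List.map_cons, List.map_cons, List.prod_cons, List.prod_cons, superAct_mul, ih, dStar_eq]
  have h2 : ∀ l : List (Fin r), (l.map fun i => tensorι (F := F) (SymmetricAlgebra F V) _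
      (Algebra.TensorProduct.basis (SymmetricAlgebra F V) b.dualBasis i)).prod =
      1 ⊗ₜ (l.map fun i => ExteriorAlgebra.ι F (b.dualBasis i)).prod := by
    intro l
    induction l with
    | nil => rfl
    | cons i l ih =>
      rw [List.map_cons, List.map_cons, List.prod_cons, List.prod_cons, ih,
        Algebra.TensorProduct.basis_apply, tensorι_tmul, Algebra.TensorProduct.tmul_mul_tmul,
        one_mul]
  have h3 : ((List.finRange r).map fun i => ExteriorAlgebra.ι F (b.dualBasis i)).prod =
      ExteriorAlgebra.ιMulti F r b.dualBasis := by
    rw [ExteriorAlgebra.ιMulti_apply, List.ofFn_eq_map]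
  rw [h1, prod_eq_det_smul _ tensorι_sq
    (Algebra.TensorProduct.basis (SymmetricAlgebra F V) b.dualBasis), ← jacobian_eq_det, h2, h3,
    TensorProduct.smul_tmul', smul_eq_mul, mul_one, superAct_tmul, mul_one]
  intro h0
  have h5 := congrArg (fun x => TensorProduct.rid F _
    ((LinearMap.lTensor _ ((extPairing F M).flip (ExteriorAlgebra.ιMulti F r b))) x)) h0
  simp only [LinearMap.lTensor_tmul, LinearMap.flip_apply, extPairing_ιMulti_dualBasis, TensorProduct.rid_tmul, one_smul,
    map_zero] at h5
  exact h h5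

/-- If the product of all elements of an anticommuting family with squares zero does not annihilate
`x`, then the ordered partial products, applied to `x`, are linearly independent. -/
theorem linearIndependent_ordProd_apply {X : Type*} [AddCommGroup X] [Module F X] {r : ℕ}
    {a : Fin r → Module.End F X} (h : ∀ i j, a i * a j = -(a j * a i)) (h0 : ∀ i, a i * a i = 0)
    {x : X} (hx : ((List.finRange r).map a).prod x ≠ 0) :
    LinearIndependent F fun I : Finset (Fin r) => (ordProd a I : Module.End F X) x := by
  classical
  rw [Fintype.linearIndependent_iff]
  intro c hc
  by_contra! hne
  -- Apply the product over the complement of a minimal `I` with nonzero coefficient.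
  obtain ⟨I, hI, hmin⟩ := Finset.exists_min_image (Finset.univ.filter fun I => c I ≠ 0)
    Finset.card (by obtain ⟨I, hI⟩ := hne; exact ⟨I, by simpa using hI⟩)
  simp only [Finset.mem_filter, Finset.mem_univ, true_and] at hI hmin
  obtain ⟨ε, hε⟩ := exists_ordProd_mul_compl h Iᶜ
  have h1 := congrArg (fun y => (ordProd a Iᶜ : Module.End F X) y) hc
  beta_reduce at h1
  rw [map_sum, map_zero, Finset.sum_eq_single I] at h1
  · rw [map_smul, ← Module.End.mul_apply] at h1
    rw [compl_compl] at hε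
    rw [hε] at h1
    rcases Int.units_eq_one_or ε with rfl | rfl
    · rw [one_smul] at h1
      exact (smul_ne_zero hI hx) h1
    · rw [Units.neg_smul, one_smul, LinearMap.neg_apply, smul_neg, neg_eq_zero] at h1
      exact (smul_ne_zero hI hx) h1
  · intro J _ hJI
    by_cases hJ : c J = 0
    · rw [hJ, zero_smul, map_zero]
    · rw [map_smul, ← Module.End.mul_apply, ordProd_mul_of_not_disjoint h h0, LinearMap.zero_apply,
        smul_zero]
      intro hd
      have hle : J ≤ I := by rwa [disjoint_comm, disjoint_compl_right_iff] at hd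
      exact hJI (Finset.eq_of_subset_of_card_le hle (hmin J hJ))
  · simp

end Independence

/-! ### The basis of the semi-invariants -/

section Basis

variable {F : Type*} [Field F] {G : Type*} [Group G]
variable {V : Type*} [AddCommGroup V] [Module F V]
variable {M : Type*} [AddCommGroup M] [Module F M]

theorem dual_injective {ρ : Representation F G V} (hρ : Function.Injective ρ) :
    Function.Injective ρ.dual := by
  intro g h hgh
  refine inv_injective (hρ (LinearMap.ext fun v => ?_))
  rw [← sub_eq_zero, ← Module.forall_dual_apply_eq_zero_iff F]
  intro φ
  rw [map_sub, sub_eq_zero]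
  exact LinearMap.congr_fun (LinearMap.congr_fun hgh φ) v

theorem mkQ_eq_zero_iff {ρ : Representation F G V} {σ : Representation F G M}
    {x : SuperAlg F V M} : (coinvariantSubmodule ρ σ).mkQ x = 0 ↔ x ∈ coinvariantIdeal ρ σ := by
  rw [Submodule.mkQ_apply, Submodule.Quotient.mk_eq_zero]
  rfl

theorem superCoinvRep_mkQ (ρ : Representation F G V) (σ : Representation F G M) (g : G)
    (x : SuperAlg F V M) :
    superCoinvRep ρ σ g ((coinvariantSubmodule ρ σ).mkQ x) =
      (coinvariantSubmodule ρ σ).mkQ (superRep ρ σ g x) := rfl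

/-- Semi-invariants lift along the projection to the super coinvariant algebra. -/
theorem exists_mkQ_eq_of_mem_semiInvariants [CharZero F] [Finite G] {ρ : Representation F G V}
    {σ : Representation F G M} {χ : G →* Fˣ} {y : SuperCoinv ρ σ}
    (hy : y ∈ semiInvariants (superCoinvRep ρ σ) χ) :
    ∃ x ∈ semiInvariants (superRep ρ σ) χ, (coinvariantSubmodule ρ σ).mkQ x = y := by
  have := Fintype.ofFinite G
  obtain ⟨x, rfl⟩ := (coinvariantSubmodule ρ σ).mkQ_surjective y
  refine ⟨(Fintype.card G : F)⁻¹ • semiTrace (superRep ρ σ) χ x,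
    Submodule.smul_mem _ _ (semiTrace_mem _ _ _), ?_⟩
  have h : (coinvariantSubmodule ρ σ).mkQ (semiTrace (superRep ρ σ) χ x) =
      semiTrace (superCoinvRep ρ σ) χ ((coinvariantSubmodule ρ σ).mkQ x) := by
    simp only [semiTrace_apply, map_sum, map_smul, superCoinvRep_mkQ]
  rw [map_smul, h, semiTrace_of_mem hy, smul_smul, inv_mul_cancel₀ (by simp), one_smul]

/-- The alternants form a basis of the semi-invariant harmonics and of the semi-invariants of the
super coinvariant algebra, for every faithful representation `ρ` of a finite group. -/
theorem superAlternant_basis [CharZero F] [Finite G] [FiniteDimensional F V]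
    {ρ : Representation F G V} (hρ : Function.Injective ρ) {σ : Representation F G M} {r : ℕ}
    (b : Module.Basis (Fin r) F M) {χ : G →* Fˣ}
    {θ : Fin r → SymmetricAlgebra F (Module.Dual F V) ⊗[F] M}
    (hθ : IsBasicDerivations ρ.dual σ θ)
    {ω : Fin r → SymmetricAlgebra F V ⊗[F] Module.Dual F M} (hω : IsBasicDerivations ρ σ.dual ω)
    {Δ : SymmetricAlgebra F (Module.Dual F V)} (hΔ : IsVandermondian ρ.dual χ Δ)
    (hJ : jacobian b θ ∣ Δ) (hM : σ.invariants = ⊥) :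
    (LinearIndependent F (superAlternant ω Δ) ∧
      Submodule.span F (Set.range (superAlternant ω Δ)) =
        harmonics ρ σ ⊓ semiInvariants (superRep ρ.dual σ.dual) χ) ∧
    (LinearIndependent F (fun I : Finset (Fin r) =>
        (coinvariantSubmodule ρ.dual σ.dual).mkQ (superAlternant ω Δ I)) ∧
      Submodule.span F (Set.range (fun I : Finset (Fin r) =>
        (coinvariantSubmodule ρ.dual σ.dual).mkQ (superAlternant ω Δ I))) =
        semiInvariants (superCoinvRep ρ.dual σ.dual) χ) := by
  have := Module.Finite.of_basis b
  have hρ' := dual_injective hρ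
  set q := (coinvariantSubmodule ρ.dual σ.dual).mkQ
  have hind : LinearIndependent F (superAlternant ω Δ) :=
    linearIndependent_ordProd_apply (fun i j => dStar_anticomm _ _) (fun i => dStar_sq _)
      (prod_dStar_apply_ne_zero b (symDiff_jacobian_ne_zero hρ hρ' b hθ hω hΔ hJ))
  have hle : Submodule.span F (Set.range (superAlternant ω Δ)) ≤
      harmonics ρ σ ⊓ semiInvariants (superRep ρ.dual σ.dual) χ := by
    rw [Submodule.span_le]
    rintro _ ⟨I, rfl⟩
    exact ⟨superAlternant_mem_harmonics hω hΔ hM I, superAlternant_mem_semiInvariants hω hΔ I⟩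
  have hindq : LinearIndependent F fun I : Finset (Fin r) => q (superAlternant ω Δ I) := by
    refine hind.map (Submodule.disjoint_def.2 fun x hx hx' => ?_)
    exact eq_zero_of_mem_harmonics_of_mem_coinvariantIdeal ρ σ (hle hx).1 (mkQ_eq_zero_iff.1 hx')
  have hleq : Submodule.span F (Set.range fun I : Finset (Fin r) => q (superAlternant ω Δ I)) ≤
      semiInvariants (superCoinvRep ρ.dual σ.dual) χ := by
    rw [Submodule.span_le]
    rintro _ ⟨I, rfl⟩ g
    rw [superCoinvRep_mkQ, superAlternant_mem_semiInvariants hω hΔ I g, map_smul]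
  obtain ⟨η, hη⟩ := exists_sub_mem_coinvariantIdeal b hθ.invariant hΔ hJ
    (hθ.jacobian_ne_zero hρ' b)
  have hupper : semiInvariants (superCoinvRep ρ.dual σ.dual) χ ≤
      Submodule.span F (Set.range fun I : Finset (Fin r) => q (η I)) := by
    intro y hy
    obtain ⟨x, hx, rfl⟩ := exists_mkQ_eq_of_mem_semiInvariants hy
    obtain ⟨c, hc⟩ := hη x hx
    have h1 := mkQ_eq_zero_iff.2 hc
    rw [map_sub, sub_eq_zero] at h1
    rw [h1, map_sum]
    refine sum_mem fun I _ => ?_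
    rw [map_smul]
    exact Submodule.smul_mem _ _ (Submodule.subset_span ⟨I, rfl⟩)
  -- Both families consist of `2 ^ r` elements, so the inclusions are equalities.
  have := FiniteDimensional.span_of_finite F (Set.finite_range fun I : Finset (Fin r) => q (η I))
  have heq := Submodule.eq_of_le_of_finrank_le (hleq.trans hupper)
    (by rw [finrank_span_eq_card hindq]; exact finrank_range_le_card _)
  have hspanq := le_antisymm hleq (heq ▸ hupper)
  refine ⟨⟨hind, le_antisymm hle fun x hx => ?_⟩, hindq, hspanq⟩
  have hqx : q x ∈ Submodule.span F (Set.range fun I : Finset (Fin r) =>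
      q (superAlternant ω Δ I)) := by
    rw [hspanq]
    intro g
    rw [superCoinvRep_mkQ, hx.2 g, map_smul]
  rw [Set.range_comp' q, Submodule.span_image] at hqx
  obtain ⟨y, hy, hyx⟩ := hqx
  have h1 : x - y = 0 := by
    refine eq_zero_of_mem_harmonics_of_mem_coinvariantIdeal ρ σ (sub_mem hx.1 (hle hy).1)
      (mkQ_eq_zero_iff.1 ?_)
    rw [map_sub, sub_eq_zero]
    exact hyx.symm
  rw [sub_eq_zero.1 h1]
  exact hy

theorem defRep_injective (G : Subgroup (LinearMap.GeneralLinearGroup F V)) :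
    Function.Injective (defRep G) :=
  fun _ _ h => Subtype.ext (Units.ext h)

end Basis

end SuperCoinvariant

end

theorem mainTheorem1 {F : Type*} [Field F] [CharZero F]
    {V : Type*} [AddCommGroup V] [Module F V] [FiniteDimensional F V]
    (G : Subgroup (LinearMap.GeneralLinearGroup F V))
    (hG : SuperCoinvariant.IsPseudoReflectionGroup G)
    {M : Type*} [AddCommGroup M] [Module F M] (σ : Representation F G M)
    {r : ℕ} (b : Module.Basis (Fin r) F M) (χ : G →* Fˣ)
    (θ : Fin r → SymmetricAlgebra F (Module.Dual F V) ⊗[F] M)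
    (hθ : SuperCoinvariant.IsBasicDerivations (SuperCoinvariant.defRep G).dual σ θ)
    (ω : Fin r → SymmetricAlgebra F V ⊗[F] Module.Dual F M)
    (hω : SuperCoinvariant.IsBasicDerivations (SuperCoinvariant.defRep G) σ.dual ω)
    (Δ : SymmetricAlgebra F (Module.Dual F V))
    (hΔ : SuperCoinvariant.IsVandermondian (SuperCoinvariant.defRep G).dual χ Δ)
    (hJ : SuperCoinvariant.jacobian b θ ∣ Δ)
    (hM : σ.invariants = ⊥) :
    (LinearIndependent F (SuperCoinvariant.superAlternant ω Δ) ∧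
      Submodule.span F (Set.range (SuperCoinvariant.superAlternant ω Δ)) =
        SuperCoinvariant.harmonics (SuperCoinvariant.defRep G) σ ⊓
          SuperCoinvariant.semiInvariants
            (SuperCoinvariant.superRep (SuperCoinvariant.defRep G).dual σ.dual) χ) ∧
    (LinearIndependent F (fun I : Finset (Fin r) =>
        (SuperCoinvariant.coinvariantSubmodule (SuperCoinvariant.defRep G).dual σ.dual).mkQ
          (SuperCoinvariant.superAlternant ω Δ I)) ∧
      Submodule.span F (Set.range (fun I : Finset (Fin r) =>
        (SuperCoinvariant.coinvariantSubmodule (SuperCoinvariant.defRep G).dual σ.dual).mkQ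
          (SuperCoinvariant.superAlternant ω Δ I))) =
        SuperCoinvariant.semiInvariants
          (SuperCoinvariant.superCoinvRep (SuperCoinvariant.defRep G).dual σ.dual) χ) := by
  have : Finite G := hG.1
  exact SuperCoinvariant.superAlternant_basis (SuperCoinvariant.defRep_injective G) b hθ hω hΔ hJ hM
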